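/- **Model.** A *quantum algorithm* is a classical algorithm (a random access machine program with unit-cost instructions: constants, addition, truncated subtraction, direct and indirect memory access, tests and loops) that can, any number of times, build a quantum circuit gate by gate, evaluate it on $|0\rangle$, and read the measured qubits. Gates come from a fixed finite universal set ($H,T,Z,X$, CNOT, Toffoli), together with query gates. The *running time* is the number of classical steps plus the number of gates (elementary gates and queries) of all evaluated circuits; the *query complexity* is the number of oracle queries. Let $E$ be a set whose elements are encoded injectively as bit strings $\langle y\rangle$. Access to a map $\sigma:\mathbb N\to E$ is access to $|i\rangle|z\rangle\mapsto|i\rangle|z\oplus\langle\sigma(i)\rangle\rangle$, plus the right to return an element $\sigma(i)$ as output at the price of one query. A *bounded-error oracle recognizing* $x\in E$ is a unitary $\mathcal O_x$ acting on an input register, an answer qubit and an ancilla register (of any kind) such that measuring the answer qubit of $\mathcal O_x|\langle x\rangle\rangle|0\rangle|0\rangle$ gives $1$ with probability at least $9/10$ and, for all $y\in E$, $y\neq x$, measuring the answer qubit of $\mathcal O_x|\langle y\rangle\rangle|0\rangle|0\rangle$ gives $0$ with probability at least $9/10$. Access to $\mathcal O_x$ means access to $\mathcal O_x$ and $\mathcal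 O_x^{\dagger}$, on arbitrarily many separate registers. **Lemma.** There are a quantum algorithm $\mathcal A$, without input, and constants $c>0$ and $K$ such that the following holds. Let $X$ be a random variable with values in a set $E$ as above, and let $\sigma:\mathbb N=\{0,1,2,\dots\}\to E$ be a bijection that orders $E$ by non-increasing probability, i.e. $\Pr[X=\sigma(i)]\ge\Pr[X=\sigma(j)]$ for all $i\le j$. Let $(\mathcal O_x)_{x\in E}$ be a family of oracles such that $\mathcal O_x$ is a bounded-error oracle recognizing $x$. Then, for every $x\in E$, the algorithm $\mathcal A$ with access to $\sigma$ and $\mathcal O_x$ outputs $x$ with probability at least $c$, and $$\mathbb E_X[T(X)]\le K\cdot G^{qc}(X),\qquad \mathbb E_X[Q(X)]\le K\cdot G^{qc}(X),\qquad G^{qc}(X)=\sum_{i\ge 0}\sqrt{i+1}\cdot\Pr[X=\sigma(i)],$$ where $T(x)$ and $Q(x)$ are the expected running time and the expected number of queries of $\mathcal A$ with access to $\sigma$ and $\mathcal O_x$. -/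

import Mathlib

open scoped ENNReal

noncomputable section

namespace QGuess

/-! ### Square-summable amplitudes and unitaries on them -/

/-- The Hilbert space `ℓ²(ι)` with computational basis `ι`. -/
abbrev L2 (ι : Type*) : Type _ := lp (fun _ : ι => ℂ) 2

/-- Unitary operators of `ℓ²(ι)`. -/
abbrev Unit2 (ι : Type*) : Type _ := L2 ι ≃ₗᵢ[ℂ] L2 ι

theorem hasSum_sq {ι : Type*} (v : L2 ι) : HasSum (fun i => ‖v i‖ ^ 2) (‖v‖ ^ 2) := by
  have h := lp.hasSum_norm (p := 2) (by norm_num) v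
  simpa using h

theorem memL2 {ι : Type*} {f : ι → ℂ} (h : Summable fun i => ‖f i‖ ^ 2) : Memℓp f 2 := by
  apply memℓp_gen
  simpa using h

theorem norm_eq_of_sq {ι κ : Type*} {v : L2 ι} {w : L2 κ} (h : ‖v‖ ^ 2 = ‖w‖ ^ 2) :
    ‖v‖ = ‖w‖ := by
  have := abs_eq_abs.mpr (sq_eq_sq_iff_eq_or_eq_neg.mp h)
  simpa using this

/-- Relabelling of the computational basis. -/
def relabel {ι κ : Type*} (e : ι ≃ κ) : L2 ι ≃ₗᵢ[ℂ] L2 κ where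
  toFun v := ⟨fun k => v (e.symm k),
    memL2 ((e.symm.summable_iff (f := fun i => ‖v i‖ ^ 2)).mpr (hasSum_sq v).summable)⟩
  invFun w := ⟨fun i => w (e i),
    memL2 ((e.summable_iff (f := fun k => ‖w k‖ ^ 2)).mpr (hasSum_sq w).summable)⟩
  map_add' _ _ := rfl
  map_smul' _ _ := rfl
  left_inv v := by ext i; simp
  right_inv w := by ext k; simp
  norm_map' v := by
    apply norm_eq_of_sq
    refine (hasSum_sq _).unique ?_
    exact (e.symm.hasSum_iff (f := fun i => ‖v i‖ ^ 2)).mpr (hasSum_sq v)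

theorem relabel_apply {ι κ : Type*} (e : ι ≃ κ) (v : L2 ι) (k : κ) :
    relabel e v k = v (e.symm k) := rfl

/-- The vector `s ↦ v (s, r)` of `ℓ²(S)`. -/
def slice {S R : Type*} (v : L2 (S × R)) (r : R) : L2 S :=
  ⟨fun s => v (s, r), memL2 ((hasSum_sq v).summable.comp_injective
    (i := fun s : S => (s, r)) (fun _ _ h => (Prod.mk.inj h).1))⟩

theorem slice_apply {S R : Type*} (v : L2 (S × R)) (r : R) (s : S) : slice v r s = v (s, r) := rfl

theorem hasSum_slice {S R : Type*} (v : L2 (S × R)) :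
    HasSum (fun r => ‖slice v r‖ ^ 2) (‖v‖ ^ 2) := by
  have h : HasSum (fun p : R × S => ‖v (p.2, p.1)‖ ^ 2) (‖v‖ ^ 2) :=
    ((Equiv.prodComm R S).hasSum_iff (f := fun p => ‖v p‖ ^ 2)).mpr (hasSum_sq v)
  exact h.prod_fiberwise (fun r => hasSum_sq (slice v r))

theorem summable_act {S R : Type*} (U : Unit2 S) (v : L2 (S × R)) :
    Summable fun p : S × R => ‖U (slice v p.2) p.1‖ ^ 2 := by
  rw [← (Equiv.prodComm R S).summable_iff]
  refine (summable_prod_of_nonneg (fun _ => sq_nonneg _)).mpr ⟨fun r => ?_, ?_⟩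
  · exact (hasSum_sq (U (slice v r))).summable
  · have : (fun r => ∑' s, ‖U (slice v r) s‖ ^ 2) = fun r => ‖slice v r‖ ^ 2 := by
      funext r
      rw [(hasSum_sq (U (slice v r))).tsum_eq, U.norm_map]
    exact this ▸ (hasSum_slice v).summable

/-- The underlying function of `U ⊗ 1`. -/
def actFun {S R : Type*} (U : Unit2 S) (v : L2 (S × R)) : L2 (S × R) :=
  ⟨fun p => U (slice v p.2) p.1, memL2 (summable_act U v)⟩

theorem slice_actFun {S R : Type*} (U : Unit2 S) (v : L2 (S × R)) (r : R) :
    slice (actFun U v) r = U (slice v r) := rfl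

/-- `U ⊗ 1` on `ℓ²(S × R)`. -/
def act {S : Type*} (R : Type*) (U : Unit2 S) : Unit2 (S × R) where
  toFun := actFun U
  invFun := actFun U.symm
  map_add' v w := by
    ext p
    have : slice (v + w) p.2 = slice v p.2 + slice w p.2 := rfl
    change U (slice (v + w) p.2) p.1 = _
    rw [this, map_add]; rfl
  map_smul' c v := by
    ext p
    have : slice (c • v) p.2 = c • slice v p.2 := rfl
    change U (slice (c • v) p.2) p.1 = _
    rw [this, map_smul]; rfl
  left_inv v := by
    ext p
    change U.symm (slice (actFun U v) p.2) p.1 = v p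
    rw [slice_actFun, U.symm_apply_apply]; rfl
  right_inv v := by
    ext p
    change U (slice (actFun U.symm v) p.2) p.1 = v p
    rw [slice_actFun, U.apply_symm_apply]; rfl
  norm_map' v := by
    apply norm_eq_of_sq
    refine (hasSum_slice (actFun U v)).unique ?_
    have : (fun r => ‖slice (actFun U v) r‖ ^ 2) = fun r => ‖slice v r‖ ^ 2 := by
      funext r
      rw [slice_actFun, U.norm_map]
    exact this ▸ hasSum_slice v

theorem act_apply {S R : Type*} (U : Unit2 S) (v : L2 (S × R)) (p : S × R) :
    act R U v p = U (slice v p.2) p.1 := rfl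

/-- The unitary `U` of a subsystem `S` of a system `B ≃ S × R`, acting on the whole system. -/
def actOn {B S R : Type*} (e : B ≃ S × R) (U : Unit2 S) : Unit2 B :=
  ((relabel e).trans (act R U)).trans (relabel e.symm)

/-- The unitary of a finite-dimensional system given by a unitary matrix. -/
def ofMatrix {S : Type} [Fintype S] [DecidableEq S] (M : Matrix.unitaryGroup S ℂ) : Unit2 S :=
  ((lpPiLpₗᵢ (p := 2) (fun _ : S => ℂ) ℂ).trans
    (Unitary.linearIsometryEquiv ⟨Matrix.toEuclideanCLM (n := S) (𝕜 := ℂ) M.1,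
      Unitary.map_mem Matrix.toEuclideanCLM M.2⟩)).trans
    (lpPiLpₗᵢ (p := 2) (fun _ : S => ℂ) ℂ).symm

theorem ofMatrix_apply {S : Type} [Fintype S] [DecidableEq S] (M : Matrix.unitaryGroup S ℂ)
    (v : L2 S) (s : S) : ofMatrix M v s = ∑ t, M.1 s t * v t := rfl

/-! ### One-qubit gates -/

/-- Hadamard gate. -/
def hadamardMatrix : Matrix Bool Bool ℂ :=
  fun a b => (if a && b then -1 else 1) * ((Real.sqrt 2 : ℝ) : ℂ)⁻¹

/-- The diagonal matrix `diag(1, z)`. -/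
def phaseMatrix (z : ℂ) : Matrix Bool Bool ℂ := Matrix.diagonal fun b => if b then z else 1

theorem hadamardMatrix_mem : hadamardMatrix ∈ Matrix.unitaryGroup Bool ℂ := by
  have h2 : (((Real.sqrt 2 : ℝ) : ℂ)⁻¹) * (((Real.sqrt 2 : ℝ) : ℂ)⁻¹) = 1 / 2 := by
    rw [← mul_inv, ← Complex.ofReal_mul, Real.mul_self_sqrt (by norm_num)]
    norm_num
  rw [Matrix.mem_unitaryGroup_iff]
  ext a b
  cases a <;> cases b <;>
    (simp [Matrix.mul_apply, hadamardMatrix, Matrix.star_apply, h2]; try norm_num)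

theorem phaseMatrix_mem {z : ℂ} (hz : ‖z‖ = 1) : phaseMatrix z ∈ Matrix.unitaryGroup Bool ℂ := by
  have h : z * (starRingEnd ℂ) z = 1 := by
    rw [Complex.mul_conj, Complex.normSq_eq_norm_sq, hz]; simp
  rw [Matrix.mem_unitaryGroup_iff]
  ext a b
  cases a <;> cases b <;>
    simp [Matrix.mul_apply, phaseMatrix, Matrix.star_apply, h, Matrix.diagonal]

/-- The Hadamard gate `H`. -/
def gateH : Unit2 Bool := ofMatrix ⟨hadamardMatrix, hadamardMatrix_mem⟩

/-- The gate `T = diag(1, exp(iπ/4))`. -/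
def gateT : Unit2 Bool :=
  ofMatrix ⟨phaseMatrix (Complex.exp ((Real.pi / 4 : ℝ) * Complex.I)),
    phaseMatrix_mem (Complex.norm_exp_ofReal_mul_I _)⟩

/-- The gate `Z = diag(1, -1)`. -/
def gateZ : Unit2 Bool := ofMatrix ⟨phaseMatrix (-1), phaseMatrix_mem (by simp)⟩

/-! ### Quantum memory

The memory consists of work qubits `0, 1, 2, …` and of query slots `0, 1, 2, …`.  A query slot
holds an input register for (codes of) elements, whose basis states are the natural numbers, i.e.
the bit strings in binary notation, and an ancilla register for the private use of the
membership oracle, whose computational basis `A` is arbitrary.  A circuit touches finitely many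
qubits and slots. -/

/-- Computational basis of the memory: contents of the work qubits, and of the query slots. -/
abbrev Basis (A : Type*) : Type _ := (ℕ → Bool) × (ℕ → ℕ × A)

/-- Splitting off the work qubit `w`. -/
def wireSplit (A : Type*) (w : ℕ) :
    Basis A ≃ Bool × (({j : ℕ // j ≠ w} → Bool) × (ℕ → ℕ × A)) :=
  (Equiv.prodCongr (Equiv.funSplitAt w Bool) (Equiv.refl _)).trans (Equiv.prodAssoc _ _ _)

/-- Splitting off the work qubit `w` and the query slot `s`, as a system with components
(input register, answer qubit, ancilla register). -/
def slotSplit (A : Type*) (w s : ℕ) :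
    Basis A ≃ (ℕ × Bool × A) × (({j : ℕ // j ≠ w} → Bool) × ({j : ℕ // j ≠ s} → ℕ × A)) :=
  (Equiv.prodCongr (Equiv.funSplitAt w Bool) (Equiv.funSplitAt s (ℕ × A))).trans
    { toFun := fun p => ((p.2.1.1, p.1.1, p.2.1.2), (p.1.2, p.2.2))
      invFun := fun q => ((q.1.2.1, q.2.1), ((q.1.1, q.1.2.2), q.2.2))
      left_inv := fun _ => rfl
      right_inv := fun _ => rfl }

/-- Bit flip of the qubit `t` if `c` holds of the memory with the qubit `t` set to `0`
(so `c` cannot depend on the qubit `t`). -/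
def flipIf {A : Type*} (t : ℕ) (c : (ℕ → Bool) → Bool) : Equiv.Perm (Basis A) :=
  Function.Involutive.toPerm
    (fun b => (Function.update b.1 t (xor (b.1 t) (c (Function.update b.1 t false))), b.2))
    (fun b => by
      refine Prod.ext ?_ rfl
      funext j
      by_cases h : j = t
      · subst h; simp
      · simp [h])

/-- The number in binary notation on the work qubits `base, …, base + len - 1`
(least significant bit first). -/
def readNat (b : ℕ → Bool) (base len : ℕ) : ℕ :=
  ∑ j ∈ Finset.range len, if b (base + j) then 2 ^ j else 0

/-- `|i⟩|y⟩ ↦ |i⟩|y ⊕ f i⟩`, where `i` is the number on the work qubits `base, …, base + len - 1`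
and `y` is the content of the input register of the slot `s`. -/
def xorInto {A : Type*} (f : ℕ → ℕ) (base len s : ℕ) : Equiv.Perm (Basis A) :=
  Function.Involutive.toPerm
    (fun b => (b.1, Function.update b.2 s
      ((b.2 s).1 ^^^ f (readNat b.1 base len), (b.2 s).2)))
    (fun b => by
      refine Prod.ext rfl ?_
      funext j
      by_cases h : j = s
      · subst h; simp
      · simp [h])

/-! ### Gates and circuits -/

/-- Gates: a fixed universal set of elementary gates (Clifford+T and Toffoli) and the query gates. -/
inductive Gate : Type
  /-- Hadamard gate -/
  | H (w : ℕ)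
  /-- the gate `diag(1, exp(iπ/4))` -/
  | T (w : ℕ)
  /-- the gate `diag(1, -1)` -/
  | Z (w : ℕ)
  /-- negation -/
  | X (w : ℕ)
  /-- negation of `t` controlled by `a` (the identity if `a = t`) -/
  | CNOT (a t : ℕ)
  /-- negation of `t` controlled by `a` and `b` (the identity if `a = t` or `b = t`) -/
  | CCNOT (a b t : ℕ)
  /-- query to the enumeration -/
  | enum (base len s : ℕ)
  /-- query to the membership oracle, on slot `s`, with answer qubit `w` -/
  | query (w s : ℕ)
  /-- query to the inverse of the membership oracle -/
  | queryInv (w s : ℕ)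

/-- A gate whose parameters are renamed by `m`. -/
def Gate.map (m : ℕ → ℕ) : Gate → Gate
  | .H w => .H (m w)
  | .T w => .T (m w)
  | .Z w => .Z (m w)
  | .X w => .X (m w)
  | .CNOT a t => .CNOT (m a) (m t)
  | .CCNOT a b t => .CCNOT (m a) (m b) (m t)
  | .enum base len s => .enum (m base) (m len) (m s)
  | .query w s => .query (m w) (m s)
  | .queryInv w s => .queryInv (m w) (m s)

/-- Whether a gate is a query. -/
def Gate.isQuery : Gate → Bool
  | .enum _ _ _ => true
  | .query _ _ => true
  | .queryInv _ _ => true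
  | _ => false

/-- A (unitary) membership oracle: it acts on an input register, an answer qubit, and an ancilla
register with computational basis `A`. -/
abbrev Oracle (A : Type*) : Type _ := Unit2 (ℕ × Bool × A)

/-- The probability that measuring the answer qubit of `O |y⟩|0⟩|0⟩` yields `b`. -/
def answerProb {A : Type*} [Inhabited A] (O : Oracle A) (y : ℕ) (b : Bool) : ℝ :=
  by
    classical
    exact ∑' p : ℕ × A, ‖O (lp.single 2 (y, false, default) (1 : ℂ)) (p.1, b, p.2)‖ ^ 2

/-- The unitary implemented by a gate, for the enumeration `f` (giving codes of elements) and the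
membership oracle `O`. -/
def Gate.unitary {A : Type*} (f : ℕ → ℕ) (O : Oracle A) : Gate → Unit2 (Basis A)
  | .H w => actOn (wireSplit A w) gateH
  | .T w => actOn (wireSplit A w) gateT
  | .Z w => actOn (wireSplit A w) gateZ
  | .X w => relabel (flipIf w fun _ => true)
  | .CNOT a t => relabel (flipIf t fun b => b a)
  | .CCNOT a b t => relabel (flipIf t fun c => c a && c b)
  | .enum base len s => relabel (xorInto f base len s)
  | .query w s => actOn (slotSplit A w s) O
  | .queryInv w s => actOn (slotSplit A w s) O.symm

/-- A circuit; the first gate of the list is applied first. -/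
abbrev Circuit : Type := List Gate

/-- The state obtained by applying a circuit to a state. -/
def Circuit.apply {A : Type*} (f : ℕ → ℕ) (O : Oracle A) (C : Circuit) (v : L2 (Basis A)) :
    L2 (Basis A) :=
  C.foldl (fun v g => g.unitary f O v) v

/-- The basis state `|0⟩` of the whole memory. -/
def zeroBasis (A : Type*) [Inhabited A] : Basis A := (fun _ => false, fun _ => (0, default))

/-- The state `|0⟩` of the whole memory. -/
def zeroState (A : Type*) [Inhabited A] : L2 (Basis A) := by
  classical
  exact lp.single 2 (zeroBasis A) (1 : ℂ)

theorem norm_zeroState (A : Type*) [Inhabited A] : ‖zeroState A‖ = 1 := by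
  classical
  simp only [zeroState]
  rw [lp.norm_single (by norm_num)]
  simp

theorem Circuit.norm_apply {A : Type*} (f : ℕ → ℕ) (O : Oracle A) (C : Circuit)
    (v : L2 (Basis A)) : ‖C.apply f O v‖ = ‖v‖ := by
  induction C generalizing v with
  | nil => rfl
  | cons g C ih =>
    change ‖Circuit.apply f O C (g.unitary f O v)‖ = ‖v‖
    rw [ih, LinearIsometryEquiv.norm_map]

/-- Measurement of a unit vector in the computational basis. -/
def measure {ι : Type*} (v : L2 ι) (hv : ‖v‖ = 1) : PMF ι :=
  ⟨fun i => ENNReal.ofReal (‖v i‖ ^ 2), by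
    have h := hasSum_sq v
    rw [hv] at h
    have h1 := ENNReal.ofReal_tsum_of_nonneg (f := fun i => ‖v i‖ ^ 2)
      (fun _ => by positivity) h.summable
    rw [h.tsum_eq] at h1
    have h2 : ∑' i, ENNReal.ofReal (‖v i‖ ^ 2) = 1 := by rw [← h1]; simp
    exact h2 ▸ ENNReal.summable.hasSum⟩

/-- Evaluation of a circuit: the work qubits of `C |0⟩` are measured. -/
def Circuit.eval {A : Type*} [Inhabited A] (f : ℕ → ℕ) (O : Oracle A) (C : Circuit) :
    PMF (ℕ → Bool) :=
  (measure (C.apply f O (zeroState A)) (by rw [Circuit.norm_apply, norm_zeroState])).map Prod.fst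

/-! ### Classical algorithms with quantum evaluation

The classical part is a program for a random access machine with memory cells `0, 1, 2, …` that
hold natural numbers.  It builds circuits gate by gate, evaluates them, and reads the outcomes
bit by bit. -/

/-- Basic instructions.  Below, `M[r]` is the content of the cell `r`. -/
inductive Instr : Type
  /-- `M[r] := n` -/
  | const (r n : ℕ)
  /-- `M[r] := M[a] + M[b]` -/
  | add (r a b : ℕ)
  /-- `M[r] := M[a] - M[b]` (truncated) -/
  | sub (r a b : ℕ)
  /-- `M[r] := M[M[a]]` -/
  | load (r a : ℕ)
  /-- `M[M[a]] := M[r]` -/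
  | store (a r : ℕ)
  /-- append a gate, with parameters taken from the given cells, to the current circuit -/
  | emit (g : Gate)
  /-- evaluate the current circuit on `|0⟩`, measure, and start with an empty circuit again -/
  | eval
  /-- `M[r] :=` the bit measured on the work qubit `M[a]` in the last evaluation -/
  | read (r a : ℕ)
  /-- query the enumeration on the number `M[a]`, return the resulting element, and halt -/
  | ret (a : ℕ)

/-- Programs. -/
inductive Prog : Type
  | instr (i : Instr)
  | seq (p q : Prog)
  /-- if `M[r] ≠ 0` then `p` else `q` -/
  | cond (r : ℕ) (p q : Prog)
  /-- while `M[r] ≠ 0` do `p` -/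
  | loop (r : ℕ) (p : Prog)

/-- Configurations of the machine. -/
structure Config : Type where
  /-- what remains to be executed -/
  code : List Prog
  /-- classical memory -/
  mem : ℕ → ℕ
  /-- the current circuit -/
  circ : Circuit
  /-- outcome of the last evaluation -/
  outcome : ℕ → Bool
  /-- the index of the returned element, if any -/
  result : Option ℕ

/-- The initial configuration: no input, memory zero. -/
def Config.start (p : Prog) : Config := ⟨[p], fun _ => 0, [], fun _ => false, none⟩

/-- Effect of a basic instruction on a configuration (with the instruction already removed from
the code). -/
def Instr.exec {A : Type*} [Inhabited A] (f : ℕ → ℕ) (O : Oracle A) (c : Config) :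
    Instr → PMF Config
  | .const r n => PMF.pure { c with mem := Function.update c.mem r n }
  | .add r a b => PMF.pure { c with mem := Function.update c.mem r (c.mem a + c.mem b) }
  | .sub r a b => PMF.pure { c with mem := Function.update c.mem r (c.mem a - c.mem b) }
  | .load r a => PMF.pure { c with mem := Function.update c.mem r (c.mem (c.mem a)) }
  | .store a r => PMF.pure { c with mem := Function.update c.mem (c.mem a) (c.mem r) }
  | .emit g => PMF.pure { c with circ := c.circ ++ [g.map c.mem] }
  | .eval => (c.circ.eval f O).map fun o => { c with circ := [], outcome := o }
  | .read r a => PMF.pure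
      { c with mem := Function.update c.mem r (if c.outcome (c.mem a) then 1 else 0) }
  | .ret a => PMF.pure { c with code := [], result := some (c.mem a) }

/-- One step of the machine; a configuration with empty code has halted. -/
def Config.step {A : Type*} [Inhabited A] (f : ℕ → ℕ) (O : Oracle A) (c : Config) : PMF Config :=
  match c.code with
  | [] => PMF.pure c
  | .instr i :: k => i.exec f O { c with code := k }
  | .seq p q :: k => PMF.pure { c with code := p :: q :: k }
  | .cond r p q :: k => PMF.pure { c with code := (if c.mem r ≠ 0 then p else q) :: k }
  | .loop r p :: k =>
      PMF.pure { c with code := if c.mem r ≠ 0 then p :: .loop r p :: k else k }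

/-- Time of the next step: an evaluation costs `1` plus the size of the circuit, any other
step costs `1`. -/
def Config.stepTime (c : Config) : ℕ :=
  match c.code with
  | [] => 0
  | .instr .eval :: _ => 1 + c.circ.length
  | _ => 1

/-- Number of queries made by the next step. -/
def Config.stepQueries (c : Config) : ℕ :=
  match c.code with
  | .instr .eval :: _ => c.circ.countP Gate.isQuery
  | .instr (.ret _) :: _ => 1
  | _ => 0

/-- Distribution of the configuration after `n` steps. -/
def Prog.run {A : Type*} [Inhabited A] (f : ℕ → ℕ) (O : Oracle A) (p : Prog) : ℕ → PMF Config
  | 0 => PMF.pure (Config.start p)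
  | n + 1 => (Prog.run f O p n).bind (Config.step f O)

/-- Expected total of the costs `cost` of the steps of the run of `p`. -/
def Prog.expectedCost {A : Type*} [Inhabited A] (f : ℕ → ℕ) (O : Oracle A) (p : Prog)
    (cost : Config → ℕ) : ℝ≥0∞ :=
  ∑' n : ℕ, ∑' c : Config, p.run f O n c * (cost c : ℝ≥0∞)

section Guessing

variable {E A : Type*} [Inhabited A]

/-- Expected running time of `p` with access to the enumeration `σ` of `E` (through the binary
encoding `code` of the elements of `E`) and the membership oracle `O`. -/
def Prog.time (p : Prog) (code : E → ℕ) (σ : ℕ → E) (O : Oracle A) : ℝ≥0∞ :=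
  p.expectedCost (code ∘ σ) O Config.stepTime

/-- Expected number of queries of `p`, to `σ`, `O` and the inverse of `O`. -/
def Prog.queries (p : Prog) (code : E → ℕ) (σ : ℕ → E) (O : Oracle A) : ℝ≥0∞ :=
  p.expectedCost (code ∘ σ) O Config.stepQueries

/-- The probability that `p` halts and returns the element `x`. -/
def Prog.returnProb (p : Prog) (code : E → ℕ) (σ : ℕ → E) (O : Oracle A) (x : E) : ℝ≥0∞ :=
  ⨆ n : ℕ, (p.run (code ∘ σ) O n).toOuterMeasure {c | ∃ i, c.result = some i ∧ σ i = x}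

/-- `O` recognizes the element `x` of `E` with bounded error. -/
def Recognizes (code : E → ℕ) (O : Oracle A) (x : E) : Prop :=
  9 / 10 ≤ answerProb O (code x) true ∧ ∀ y, y ≠ x → 9 / 10 ≤ answerProb O (code y) false

end Guessing

/-- Quantum guessing complexity of a random variable with values in `E`, where `σ` lists `E` by
non-increasing probability; the element `σ i` is the guess number `i + 1`. -/
def guessingComplexity {Ω E : Type*} [MeasurableSpace Ω] (P : MeasureTheory.Measure Ω)
    (X : Ω → E) (σ : ℕ → E) : ℝ≥0∞ :=
  ∑' i : ℕ, ENNReal.ofReal (Real.sqrt (i + 1)) * P {ω | X ω = σ i}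

end QGuess

end

noncomputable section

namespace QGuess

/-! ### Projections and signs in the computational basis -/

/-! It suffices to have one program that, whenever `O` recognizes `σ i`, returns `σ i` with
probability at least `1/10` (`le_iSup_run`) and takes `O(√(i+1))` expected steps (`time_le_sqrt`).
Summing over `i` with weights `Pr[X = σ i]` then gives the bound by the guessing complexity
(`lintegral_le_guessingComplexity`), and a step never makes more queries than it takes time.

The program searches growing prefixes of the enumeration. Stage `K` treats `2^n` indices with `9^K ≤
2^n ≤ 2·9^K`, costs `O(3^K)` per round, and has 16 rounds; the program stops as soon as a candidate
passes a verification. The difficulty is to have no logarithmic factor: a plain Grover search would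
lose one by repeating the erroneous oracle in each iteration, and another one in the gates of a
diffusion on all `n` index qubits.

Both are avoided by recursive amplitude amplification, `W_{k+1} = W_k D_k W_k⁻¹ S_k W_k`, which
ideally triples the amplitude of the target at each level. Since level `k` occurs only of order
`3^(K-k)` times in `W_K`, it may have cost polynomial in `k`: `S_k` takes the majority of `2(10+k)`
queries, with error amplitude at most `(2/3)^(10+k)`, and `D_k` reflects about the uniform
superposition of the first `m_k ≤ 4k+5` index qubits only. The sizes add up to `O(3^K)`
(`length_ampC`). A diffusion on `m` qubits mixes only the `2^m` indices of a block; it works as long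
as the share of the target in its block, of order `9^k 2^(-m)`, is small. In
`Amplification.le_amplitude` the relative loss of level `k` is `2 ε_k + (4/3)·9^k 2^(-m_k)`, and
these losses sum to at most `1/2` (`loss_le`). Hence the target has weight at least `1/8` at the
end.

Every level owns a bank of query slots. The unitary `W_k` only touches the banks below `k`, so bank
`k` is clean when `S_k` is applied to `W_k ψ` (`ampU_clean`), and this is the only state for which
correctness of the reflection is needed. The uncomputation after `S_k` is imperfect, but the
remaining estimates are norm bounds that hold for arbitrary contents of the banks. A last bank
verifies the outcome: a round succeeds with probability at least `1/9` once `i < 9^K`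
(`eval_success`), and accepts a wrong index with probability at most `(2/5)^(10+K)`
(`eval_false_accept`). All wrong acceptances together cost at most `1/90`.

For the time, once `i < 9^K` each round fails with probability at most `8/9`, while the cost triples
only every 16 rounds, that is, grows by at most `15/14` per round on average. As `(8/9)·(15/14) =
20/21 < 1`, the expected cost is a convergent geometric series, dominated by `3^K ≤ 3√(i+1)` for the
least suitable `K` (`meanTime_late`, `meanTime_early`).

The remaining part shows that the machine really carries this out within the time bound. The program
keeps the gates in a list in memory, so an inverse circuit is obtained by reading a segment
backwards. Everything between two evaluations is deterministic and is treated with a weakest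
precondition `wp` on abstract states that carry the number of steps. -/

theorem norm_sq_eq_tsum {ι : Type*} (v : L2 ι) : ‖v‖ ^ 2 = ∑' i, ‖v i‖ ^ 2 :=
  (hasSum_sq v).tsum_eq.symm

/-- The projection of `ℓ²(ι)` onto the span of the basis states in `S`. -/
def proj {ι : Type*} (S : Set ι) : L2 ι →ₗ[ℂ] L2 ι where
  toFun v := ⟨S.indicator v, memL2 (Summable.of_nonneg_of_le (fun _ => sq_nonneg _)
    (fun i => by
      by_cases h : i ∈ S <;> simp [h]) (hasSum_sq v).summable)⟩
  map_add' v w := by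
    ext i
    exact congrFun (Set.indicator_add S v w) i
  map_smul' c v := by
    ext i
    exact congrFun (Set.indicator_const_smul S c v) i

section proj

variable {ι κ : Type*} (S T : Set ι) (v w : L2 ι)

theorem proj_apply (i : ι) : proj S v i = S.indicator v i := rfl

theorem proj_apply_of_mem {i : ι} (h : i ∈ S) : proj S v i = v i := by simp [proj_apply, h]

theorem proj_apply_of_notMem {i : ι} (h : i ∉ S) : proj S v i = 0 := by simp [proj_apply, h]

theorem proj_proj : proj S (proj T v) = proj (S ∩ T) v := by
  ext i
  by_cases h : i ∈ S <;> by_cases h' : i ∈ T <;> simp [proj_apply, h, h']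

theorem proj_comm : proj S (proj T v) = proj T (proj S v) := by
  rw [proj_proj, proj_proj, Set.inter_comm]

theorem norm_sq_proj_add_compl : ‖proj S v‖ ^ 2 + ‖proj Sᶜ v‖ ^ 2 = ‖v‖ ^ 2 := by
  refine ((hasSum_sq (proj S v)).add (hasSum_sq (proj Sᶜ v))).unique ?_
  convert hasSum_sq v using 2 with i
  by_cases h : i ∈ S <;> simp [proj_apply, h]

theorem proj_add_compl : proj S v + proj Sᶜ v = v := by
  ext i
  by_cases h : i ∈ S <;> simp [proj_apply, h]

theorem norm_proj_le : ‖proj S v‖ ≤ ‖v‖ := by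
  have := norm_sq_proj_add_compl S v
  exact le_of_sq_le_sq (by nlinarith [sq_nonneg ‖proj Sᶜ v‖]) (norm_nonneg _)

variable {S T} in
theorem norm_proj_mono (h : S ⊆ T) : ‖proj S v‖ ≤ ‖proj T v‖ := by
  have : proj S v = proj S (proj T v) := by
    rw [proj_proj, Set.inter_eq_left.mpr h]
  rw [this]
  exact norm_proj_le _ _

theorem norm_sq_proj_union_le : ‖proj (S ∪ T) v‖ ^ 2 ≤ ‖proj S v‖ ^ 2 + ‖proj T v‖ ^ 2 := by
  refine hasSum_le (fun i => ?_) (hasSum_sq (proj (S ∪ T) v))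
    ((hasSum_sq (proj S v)).add (hasSum_sq (proj T v)))
  by_cases h : i ∈ S <;> by_cases h' : i ∈ T <;> simp [proj_apply, h, h']

theorem inner_proj_left : inner ℂ (proj S v) w = inner ℂ v (proj S w) := by
  rw [lp.inner_eq_tsum, lp.inner_eq_tsum]
  congr 1
  funext i
  by_cases h : i ∈ S <;> simp [proj_apply, h]

theorem proj_eq_self_iff : proj S v = v ↔ ∀ i, v i ≠ 0 → i ∈ S := by
  constructor
  · intro h i hi
    by_contra hS
    apply hi
    rw [← h, proj_apply_of_notMem S v hS]
  · intro h
    ext i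
    by_cases hS : i ∈ S
    · exact proj_apply_of_mem S v hS
    · rw [proj_apply_of_notMem S v hS]
      by_contra h0
      exact hS (h i (Ne.symm h0))

/-- Lets a condition computed on scratch qubits be replaced by its intended meaning, which it has
only on states with clean scratch. -/
theorem proj_congr_of_support {S T : Set ι} {v : L2 ι} {Z : Set ι} (hv : proj Z v = v)
    (h : ∀ i ∈ Z, (i ∈ S ↔ i ∈ T)) : proj S v = proj T v := by
  have : S ∩ Z = T ∩ Z := by
    ext i
    exact and_congr_left (h i)
  rw [← hv, proj_proj, proj_proj, this]

theorem relabel_proj (e : ι ≃ κ) :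
    relabel e (proj S v) = proj (e.symm ⁻¹' S) (relabel e v) := by
  ext k
  by_cases h : e.symm k ∈ S <;> simp [relabel_apply, proj_apply, h]

end proj

/-- The diagonal unitary with the sign `-1` on the basis states in `S`. -/
def sgn {ι : Type*} (S : Set ι) : Unit2 ι where
  toFun v := v - (2 : ℂ) • proj S v
  invFun v := v - (2 : ℂ) • proj S v
  map_add' v w := by
    simp only [map_add, smul_add]; abel
  map_smul' c v := by
    rw [map_smul, RingHom.id_apply, smul_sub, smul_comm]
  left_inv v := by
    simp only [map_sub, map_smul, proj_proj, Set.inter_self]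
    module
  right_inv v := by
    simp only [map_sub, map_smul, proj_proj, Set.inter_self]
    module
  norm_map' v := by
    apply norm_eq_of_sq
    refine (hasSum_sq _).unique ?_
    convert hasSum_sq v using 3 with i
    change ‖v i - (2 : ℂ) • S.indicator v i‖ = ‖v i‖
    by_cases h : i ∈ S
    · have : v i - (2 : ℂ) • v i = - v i := by simp only [smul_eq_mul]; ring
      simp only [h, Set.indicator_of_mem]
      rw [this, norm_neg]
    · simp [h]

section sgn

variable {ι : Type*} (S T : Set ι) (v : L2 ι)

theorem sgn_eq : sgn S v = v - (2 : ℂ) • proj S v := rfl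

theorem sgn_symm : (sgn S).symm = sgn S := rfl

theorem sgn_apply [DecidablePred (· ∈ S)] (i : ι) : sgn S v i = if i ∈ S then - v i else v i := by
  change v i - (2 : ℂ) • S.indicator v i = _
  by_cases h : i ∈ S
  · simp only [h, Set.indicator_of_mem, if_true, smul_eq_mul]; ring
  · simp [h]

theorem sgn_proj : sgn S (proj T v) = proj T (sgn S v) := by
  rw [sgn_eq, sgn_eq, map_sub, map_smul, proj_comm]

end sgn

/-- `U` commutes with the projection onto `S`. -/
def Commutes {ι : Type*} (U : Unit2 ι) (S : Set ι) : Prop := ∀ v, U (proj S v) = proj S (U v)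

section Commutes

variable {ι : Type*} {U V : Unit2 ι} {S T : Set ι}

theorem Commutes.symm (h : Commutes U S) : Commutes U.symm S := fun v => by
  apply U.injective
  rw [h, U.apply_symm_apply, U.apply_symm_apply]

theorem Commutes.trans (hU : Commutes U S) (hV : Commutes V S) : Commutes (U.trans V) S :=
  fun v => by
    change V (U (proj S v)) = proj S (V (U v))
    rw [hU, hV]

theorem Commutes.refl : Commutes (LinearIsometryEquiv.refl ℂ (L2 ι)) S := fun _ => rfl

theorem commutes_sgn : Commutes (sgn T) S := fun v => sgn_proj T S v

theorem Commutes.proj_eq_self (h : Commutes U S) {v : L2 ι} (hv : proj S v = v) :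
    proj S (U v) = U v := by rw [← h, hv]

theorem Commutes.compl (h : Commutes U S) : Commutes U Sᶜ := fun v => by
  have h1 : proj Sᶜ v = v - proj S v := eq_sub_of_add_eq' (proj_add_compl S v)
  have h2 : proj Sᶜ (U v) = U v - proj S (U v) := eq_sub_of_add_eq' (proj_add_compl S _)
  rw [h1, h2, map_sub, h]

/-- For `U ⊗ 1` the configuration of the other factor is a parameter. If membership in `X` depends
only on it, the projection keeps or kills each slice as a whole, and `U` acts slice by slice. -/
theorem commutes_actOn {B S R : Type*} (e : B ≃ S × R) (U : Unit2 S) {X : Set B}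
    (hX : ∀ b b', (e b).2 = (e b').2 → (b ∈ X ↔ b' ∈ X)) : Commutes (actOn e U) X := by
  intro v
  ext b
  change U (slice (relabel e (proj X v)) (e b).2) (e b).1 = _
  by_cases h : b ∈ X
  · rw [proj_apply_of_mem X _ h]
    change _ = U (slice (relabel e v) (e b).2) (e b).1
    refine congrArg (fun z : L2 S => U z (e b).1) ?_
    ext s
    change proj X v (e.symm (s, (e b).2)) = v (e.symm (s, (e b).2))
    apply proj_apply_of_mem
    exact (hX b _ (by simp)).mp h
  · rw [proj_apply_of_notMem X _ h]
    have : slice (relabel e (proj X v)) (e b).2 = 0 := by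
      ext s
      change proj X v (e.symm (s, (e b).2)) = 0
      apply proj_apply_of_notMem
      intro h'
      exact h ((hX b _ (by simp)).mpr h')
    rw [this, map_zero]; rfl

theorem commutes_relabel {e : Equiv.Perm ι} (h : ∀ i, e i ∈ S ↔ i ∈ S) :
    Commutes (relabel e) S := by
  intro v
  rw [relabel_proj]
  congr 2
  ext i
  have := h (e.symm i)
  rw [e.apply_symm_apply] at this
  exact this.symm

end Commutes

/-! ### Circuits as unitaries -/

/-- The unitary implemented by a circuit. -/
def Circuit.unitary {A : Type*} (f : ℕ → ℕ) (O : Oracle A) : Circuit → Unit2 (Basis A)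
  | [] => LinearIsometryEquiv.refl ℂ _
  | g :: C => (g.unitary f O).trans (Circuit.unitary f O C)

/-- The inverse of a gate other than `T`. -/
def Gate.inv : Gate → Gate
  | .query w s => .queryInv w s
  | .queryInv w s => .query w s
  | g => g

theorem Gate.inv_inv (g : Gate) : g.inv.inv = g := by cases g <;> rfl

/-- The gate is not a `T` gate. -/
def Gate.NoT : Gate → Prop
  | .T _ => False
  | _ => True

/-- The inverse of a circuit without `T` gates. -/
def Circuit.inv (C : Circuit) : Circuit := (C.map Gate.inv).reverse

theorem Circuit.inv_inv (C : Circuit) : C.inv.inv = C := by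
  have : Gate.inv ∘ Gate.inv = id := funext Gate.inv_inv
  simp [Circuit.inv, List.map_reverse, this]

theorem Circuit.inv_append (C D : Circuit) : Circuit.inv (C ++ D) = D.inv ++ C.inv := by
  simp [Circuit.inv]

theorem Circuit.length_inv (C : Circuit) : C.inv.length = C.length := by
  simp [Circuit.inv]

theorem Gate.NoT.inv {g : Gate} (h : g.NoT) : g.inv.NoT := by
  cases g <;> exact h

theorem Circuit.noT_inv {C : Circuit} (h : ∀ g ∈ C, g.NoT) : ∀ g ∈ C.inv, g.NoT := by
  intro g hg
  simp only [Circuit.inv, List.mem_reverse, List.mem_map] at hg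
  obtain ⟨g', h', rfl⟩ := hg
  exact (h g' h').inv

theorem gateZ_apply (v : L2 Bool) (s : Bool) : gateZ v s = if s then - v s else v s := by
  rw [gateZ, ofMatrix_apply]
  cases s <;> simp [phaseMatrix, Matrix.diagonal]

theorem gateH_apply (v : L2 Bool) (s : Bool) :
    gateH v s = ((Real.sqrt 2 : ℝ) : ℂ)⁻¹ * (v false + if s then - v true else v true) := by
  rw [gateH, ofMatrix_apply]
  cases s <;> simp [hadamardMatrix] <;> ring

theorem gateH_symm : gateH.symm = gateH := by
  have h2 : (((Real.sqrt 2 : ℝ) : ℂ)⁻¹) * (((Real.sqrt 2 : ℝ) : ℂ)⁻¹) = 1 / 2 := by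
    rw [← mul_inv, ← Complex.ofReal_mul, Real.mul_self_sqrt (by norm_num)]
    norm_num
  ext1 v
  apply gateH.injective
  rw [gateH.apply_symm_apply]
  ext s
  rw [gateH_apply, gateH_apply, gateH_apply]
  cases s <;> simp <;> linear_combination (-2 * v _) * h2

section unitary

variable {A : Type*} (f : ℕ → ℕ) (O : Oracle A)

theorem Circuit.apply_eq (C : Circuit) (v : L2 (Basis A)) : C.apply f O v = C.unitary f O v := by
  induction C generalizing v with
  | nil => rfl
  | cons g C ih => exact ih _

theorem Circuit.unitary_append (C D : Circuit) (v : L2 (Basis A)) :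
    Circuit.unitary f O (C ++ D) v = D.unitary f O (C.unitary f O v) := by
  induction C generalizing v with
  | nil => rfl
  | cons g C ih => exact ih _

theorem Circuit.unitary_singleton (g : Gate) (v : L2 (Basis A)) :
    Circuit.unitary f O [g] v = g.unitary f O v := rfl

theorem actOn_apply {B S R : Type*} (e : B ≃ S × R) (U : Unit2 S) (v : L2 B) (b : B) :
    actOn e U v b = U (slice (relabel e v) (e b).2) (e b).1 := rfl

theorem unitary_Z (w : ℕ) : Gate.unitary f O (.Z w) = sgn {b | b.1 w = true} := by
  classical
  ext1 v
  ext b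
  rw [sgn_apply]
  change actOn (wireSplit A w) gateZ v b = _
  rw [actOn_apply, gateZ_apply]
  have : slice (relabel (wireSplit A w) v) ((wireSplit A w) b).2 (b.1 w) = v b := by
    change v ((wireSplit A w).symm ((wireSplit A w) b)) = v b
    rw [Equiv.symm_apply_apply]
  have h1 : ((wireSplit A w) b).1 = b.1 w := rfl
  rw [h1, this]
  rfl

theorem Gate.unitary_inv {g : Gate} (h : g.NoT) : g.inv.unitary f O = (g.unitary f O).symm := by
  cases g with
  | H w => exact congrArg (actOn (wireSplit A w)) gateH_symm.symm
  | T w => exact h.elim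
  | Z w =>
    change Gate.unitary f O (.Z w) = (Gate.unitary f O (.Z w)).symm
    rw [unitary_Z, sgn_symm]
  | _ => rfl

theorem Circuit.unitary_inv {C : Circuit} (h : ∀ g ∈ C, g.NoT) :
    C.inv.unitary f O = (C.unitary f O).symm := by
  induction C with
  | nil => rfl
  | cons g C ih =>
    ext1 v
    have h1 : Circuit.inv (g :: C) = Circuit.inv C ++ [g.inv] := by simp [Circuit.inv]
    rw [h1, Circuit.unitary_append, ih fun g hg => h g (List.mem_cons_of_mem _ hg)]
    change g.inv.unitary f O _ = _
    rw [Gate.unitary_inv f O (h g List.mem_cons_self)]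
    rfl

/-! ### Conditions on the memory that a gate cannot change -/

/-- The set does not depend on the work qubit `w`. -/
def IndepWire (w : ℕ) (S : Set (Basis A)) : Prop :=
  ∀ b β, (Function.update b.1 w β, b.2) ∈ S ↔ b ∈ S

/-- The set does not depend on the query slot `s`. -/
def IndepSlot (s : ℕ) (S : Set (Basis A)) : Prop :=
  ∀ b z, (b.1, Function.update b.2 s z) ∈ S ↔ b ∈ S

/-- The set does not depend on the qubits and slots that the gate may change. -/
def Gate.Fixes (S : Set (Basis A)) : Gate → Prop
  | .H w => IndepWire w S
  | .T w => IndepWire w S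
  | .Z w => IndepWire w S
  | .X w => IndepWire w S
  | .CNOT _ w => IndepWire w S
  | .CCNOT _ _ w => IndepWire w S
  | .enum _ _ s => IndepSlot s S
  | .query w s => IndepWire w S ∧ IndepSlot s S
  | .queryInv w s => IndepWire w S ∧ IndepSlot s S

variable {f O}

theorem commutes_wire {w : ℕ} {S : Set (Basis A)} (h : IndepWire w S) (U : Unit2 Bool) :
    Commutes (actOn (wireSplit A w) U) S := by
  apply commutes_actOn
  intro b b' hb
  rw [← h b (b'.1 w)]
  suffices (Function.update b.1 w (b'.1 w), b.2) = b' by rw [this]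
  have h1 := congrArg (fun z => (wireSplit A w).symm (b'.1 w, z)) hb
  have h2 : (wireSplit A w).symm (b'.1 w, ((wireSplit A w) b').2) = b' :=
    (wireSplit A w).symm_apply_apply b'
  rw [← h2, ← h1]
  refine Prod.ext (funext fun j => ?_) rfl
  by_cases hj : j = w
  · subst hj; simp [wireSplit, Equiv.funSplitAt]
  · simp [wireSplit, Equiv.funSplitAt, hj]

theorem commutes_slot {w s : ℕ} {S : Set (Basis A)} (h : IndepWire w S) (h' : IndepSlot s S)
    (U : Oracle A) : Commutes (actOn (slotSplit A w s) U) S := by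
  apply commutes_actOn
  intro b b' hb
  rw [← h b (b'.1 w), ← h' _ (b'.2 s)]
  suffices (Function.update b.1 w (b'.1 w), Function.update b.2 s (b'.2 s)) = b' by rw [this]
  have h1 := congrArg (fun z => (slotSplit A w s).symm (((b'.2 s).1, b'.1 w, (b'.2 s).2), z)) hb
  have h2 : (slotSplit A w s).symm (((b'.2 s).1, b'.1 w, (b'.2 s).2), ((slotSplit A w s) b').2)
      = b' := (slotSplit A w s).symm_apply_apply b'
  rw [← h2, ← h1]
  refine Prod.ext (funext fun j => ?_) (funext fun j => ?_)
  · by_cases hj : j = w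
    · subst hj; simp [slotSplit, Equiv.funSplitAt]
    · simp [slotSplit, Equiv.funSplitAt, hj]
  · by_cases hj : j = s
    · subst hj; simp [slotSplit, Equiv.funSplitAt]
    · simp [slotSplit, Equiv.funSplitAt, hj]

/-- The source of all statements that some qubits or slots are left alone: clean banks, zero scratch
and the values of high index qubits are all preserved in this way. -/
theorem Gate.Fixes.commutes {S : Set (Basis A)} {g : Gate} (h : g.Fixes S) :
    Commutes (g.unitary f O) S := by
  cases g with
  | H w => exact commutes_wire h _
  | T w => exact commutes_wire h _
  | Z w => exact commutes_wire h _
  | X w => exact commutes_relabel fun b => h b _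
  | CNOT a w => exact commutes_relabel fun b => h b _
  | CCNOT a c w => exact commutes_relabel fun b => h b _
  | enum b l s => exact commutes_relabel fun b => h b _
  | query w s => exact commutes_slot h.1 h.2 _
  | queryInv w s => exact commutes_slot h.1 h.2 _

theorem Circuit.commutes {S : Set (Basis A)} {C : Circuit} (h : ∀ g ∈ C, g.Fixes S) :
    Commutes (C.unitary f O) S := by
  induction C with
  | nil => exact Commutes.refl
  | cons g C ih =>
    exact (h g List.mem_cons_self).commutes.trans (ih fun g hg => h g (List.mem_cons_of_mem _ hg))

theorem indepWire_wires {w : ℕ} {p : (ℕ → Bool) → Prop}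
    (h : ∀ x β, p (Function.update x w β) ↔ p x) : IndepWire w {b : Basis A | p b.1} :=
  fun b β => h b.1 β

/-! ### Classical reversible circuits -/

/-- The permutation of the basis given by a classical gate. -/
def Gate.perm (A : Type*) : Gate → Equiv.Perm (Basis A)
  | .X w => flipIf w fun _ => true
  | .CCNOT a b t => flipIf t fun c => c a && c b
  | _ => Equiv.refl _

/-- Gates `X` and Toffoli. -/
def Gate.Classical : Gate → Prop
  | .X _ => True
  | .CCNOT _ _ _ => True
  | _ => False

theorem Gate.Classical.noT {g : Gate} (h : g.Classical) : g.NoT := by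
  cases g <;> first | exact h | trivial

/-- The action of a classical gate on the work qubits. -/
def Gate.bits : Gate → (ℕ → Bool) → (ℕ → Bool)
  | .X w, x => Function.update x w (!x w)
  | .CCNOT a b t, x => Function.update x t
      (xor (x t) (Function.update x t false a && Function.update x t false b))
  | _, x => x

theorem Gate.perm_apply (g : Gate) (b : Basis A) : g.perm A b = (g.bits b.1, b.2) := by
  cases g with
  | X w => simp [Gate.perm, Gate.bits, flipIf, Function.Involutive.toPerm]
  | CCNOT a c w => rfl
  | _ => rfl

/-- The action of a classical circuit on the work qubits. -/
def Circuit.bits (C : Circuit) (x : ℕ → Bool) : ℕ → Bool := C.foldl (fun x g => g.bits x) x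

theorem Circuit.bits_append (C D : Circuit) (x : ℕ → Bool) :
    Circuit.bits (C ++ D) x = D.bits (C.bits x) := List.foldl_append

/-- Reduces circuits of `X` and Toffoli gates to their action on bit strings, so that the threshold
circuit can be verified by computing with bits. -/
theorem Circuit.exists_perm {C : Circuit} (h : ∀ g ∈ C, g.Classical) :
    ∃ e : Equiv.Perm (Basis A), C.unitary f O = relabel e ∧ ∀ b, e b = (C.bits b.1, b.2) := by
  induction C with
  | nil => exact ⟨Equiv.refl _, rfl, fun _ => rfl⟩
  | cons g C ih =>
    obtain ⟨e, h1, h2⟩ := ih fun g hg => h g (List.mem_cons_of_mem _ hg)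
    have hg := h g List.mem_cons_self
    refine ⟨(g.perm A).trans e, ?_, fun b => ?_⟩
    · change (g.unitary f O).trans (Circuit.unitary f O C) = _
      rw [h1]
      cases g <;> first | exact hg.elim | rfl
    · rw [Equiv.trans_apply, Gate.perm_apply, h2]
      rfl

theorem relabel_sgn {ι : Type*} (e : Equiv.Perm ι) (S : Set ι) (v : L2 ι) :
    (relabel e).symm (sgn S (relabel e v)) = sgn (e ⁻¹' S) v := by
  apply (relabel e).injective
  rw [LinearIsometryEquiv.apply_symm_apply, sgn_eq, sgn_eq, map_sub, map_smul, relabel_proj]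
  congr 3
  ext i
  simp

/-- A phase flip computed by a classical circuit and a work qubit. -/
theorem Circuit.unitary_phase {C : Circuit} (h : ∀ g ∈ C, g.Classical) (w : ℕ)
    (v : L2 (Basis A)) :
    Circuit.unitary f O (C ++ .Z w :: C.inv) v = sgn {b | C.bits b.1 w = true} v := by
  obtain ⟨e, h1, h2⟩ := Circuit.exists_perm (f := f) (O := O) h
  rw [Circuit.unitary_append]
  change C.inv.unitary f O (Gate.unitary f O (.Z w) _) = _
  rw [Circuit.unitary_inv f O fun g hg => (h g hg).noT, unitary_Z, h1, relabel_sgn]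
  congr 2
  ext b
  simp [h2]

/-! ### Hadamard gates on basis states -/

theorem unitary_H_apply {w : ℕ} {y : L2 (Basis A)} (hy : proj {b | b.1 w = false} y = y)
    (b : Basis A) : Gate.unitary f O (.H w) y b =
      ((Real.sqrt 2 : ℝ) : ℂ)⁻¹ * y (Function.update b.1 w false, b.2) := by
  change actOn (wireSplit A w) gateH y b = _
  rw [actOn_apply, gateH_apply]
  have hs : ∀ β, slice (relabel (wireSplit A w) y) ((wireSplit A w) b).2 β =
      y (Function.update b.1 w β, b.2) := by
    intro β
    change y ((wireSplit A w).symm (β, ((wireSplit A w) b).2)) = _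
    congr 1
  have h0 : y (Function.update b.1 w true, b.2) = 0 := by
    rw [← hy, proj_apply_of_notMem]
    simp
  rw [hs, hs, h0]
  simp

/-- After `H` on a qubit in state `0` the state is invariant under flipping that qubit. So both
values carry the same weight, half of the total. -/
theorem norm_sq_proj_H {w : ℕ} {y : L2 (Basis A)} (hy : proj {b | b.1 w = false} y = y)
    (β : Bool) : ‖proj {b | b.1 w = β} (Gate.unitary f O (.H w) y)‖ ^ 2 = ‖y‖ ^ 2 / 2 := by
  set z := Gate.unitary f O (.H w) y with hz
  have hinv : relabel (flipIf w fun _ => true) z = z := by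
    ext b
    rw [relabel_apply, hz, unitary_H_apply hy, unitary_H_apply hy]
    have : (flipIf (A := A) w fun _ => true).symm b =
        (Function.update b.1 w (xor (b.1 w) true), b.2) := rfl
    rw [this]
    simp
  have hpre : ((flipIf (A := A) w fun _ => true).symm ⁻¹' {b | b.1 w = true}) =
      {b | b.1 w = false} := by
    ext b
    have : (flipIf (A := A) w fun _ => true).symm b =
        (Function.update b.1 w (xor (b.1 w) true), b.2) := rfl
    simp [this]
  have heq : ‖proj {b | b.1 w = true} z‖ = ‖proj {b | b.1 w = false} z‖ := by
    rw [← LinearIsometryEquiv.norm_map (relabel (flipIf w fun _ => true)), relabel_proj, hinv,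
      hpre]
  have hc : ({b : Basis A | b.1 w = true})ᶜ = {b | b.1 w = false} := by
    ext b; simp
  have hsum := norm_sq_proj_add_compl {b | b.1 w = true} z
  rw [hc, heq, hz, LinearIsometryEquiv.norm_map] at hsum
  have : ‖proj {b | b.1 w = false} z‖ ^ 2 = ‖y‖ ^ 2 / 2 := by linarith
  cases β
  · exact this
  · rw [heq]; exact this

end unitary

/-! ### Queries to the membership oracle -/

section query

variable {A : Type*} [Inhabited A]

open Classical in
/-- The input state `|y⟩|0⟩|0⟩` of the membership oracle. -/
def inputState (A : Type*) [Inhabited A] (y : ℕ) : L2 (ℕ × Bool × A) :=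
  lp.single 2 (y, false, default) (1 : ℂ)

theorem norm_inputState (y : ℕ) : ‖inputState A y‖ = 1 := by
  classical
  rw [inputState, lp.norm_single (by norm_num)]
  simp

theorem answerProb_eq (O : Oracle A) (y : ℕ) (β : Bool) :
    answerProb O y β = ‖proj {s | s.2.1 = β} (O (inputState A y))‖ ^ 2 := by
  rw [norm_sq_eq_tsum]
  have hinj : Function.Injective fun p : ℕ × A => (p.1, β, p.2) := by
    rintro ⟨a, b⟩ ⟨c, d⟩ h
    simpa using h
  rw [← hinj.tsum_eq]
  · refine tsum_congr fun p => ?_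
    rw [proj_apply_of_mem _ _ (by simp)]
    rfl
  · rintro ⟨a, b, c⟩ h
    rw [Function.mem_support] at h
    by_cases hb : b = β
    · exact ⟨(a, c), by simp [hb]⟩
    · rw [proj_apply_of_notMem _ _ (by simpa using hb)] at h
      simp at h

theorem answerProb_add (O : Oracle A) (y : ℕ) (β : Bool) :
    answerProb O y β + answerProb O y (!β) = 1 := by
  rw [answerProb_eq, answerProb_eq]
  have h := norm_sq_proj_add_compl {s : ℕ × Bool × A | s.2.1 = β} (O (inputState A y))
  have hc : ({s : ℕ × Bool × A | s.2.1 = β})ᶜ = {s | s.2.1 = !β} := by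
    ext s
    rcases s with ⟨_, b, _⟩
    cases b <;> cases β <;> simp
  rw [hc, LinearIsometryEquiv.norm_map, norm_inputState] at h
  simpa using h

/-- The state is cut into slices by the contents of the memory outside the input register, answer
qubit and ancilla. By `hχ` and `hY`, each slice is a multiple of one input state `|y⟩|0⟩|0⟩`, to
which the error bound of the oracle applies; distinct slices are orthogonal, so the bounds add up.
This is how an error bound for single inputs extends to superpositions. -/
theorem norm_sq_proj_query {f : ℕ → ℕ} {O : Oracle A} {w s : ℕ} {β : Bool} {δ : ℝ}
    {Y : Basis A → ℕ} (hY : ∀ b γ z, Y (Function.update b.1 w γ, Function.update b.2 s z) = Y b)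
    {χ : L2 (Basis A)}
    (hχ : ∀ b, χ b ≠ 0 → b.1 w = false ∧ b.2 s = (Y b, default) ∧ answerProb O (Y b) β ≤ δ) :
    ‖proj {b | b.1 w = β} (Gate.unitary f O (.query w s) χ)‖ ^ 2 ≤ δ * ‖χ‖ ^ 2 := by
  set e := slotSplit A w s with he
  set v := relabel e χ with hv
  have h1 : ‖proj {b | b.1 w = β} (Gate.unitary f O (.query w s) χ)‖ ^ 2 =
      ‖proj {p | p.1.2.1 = β} (act _ O v)‖ ^ 2 := by
    change ‖proj {b | b.1 w = β} (relabel e.symm (act _ O v))‖ ^ 2 = _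
    rw [← LinearIsometryEquiv.norm_map (relabel e.symm) (proj {p | p.1.2.1 = β} (act _ O v)),
      relabel_proj]
    rfl
  rw [h1, ← LinearIsometryEquiv.norm_map (relabel e) χ, ← hv]
  refine hasSum_le (fun r => ?_) (hasSum_slice _) ((hasSum_slice v).mul_left δ)
  have h2 : slice (proj {p | p.1.2.1 = β} (act _ O v)) r =
      proj {q | q.2.1 = β} (O (slice v r)) := by
    ext q
    change Set.indicator _ _ _ = Set.indicator _ _ _
    by_cases hq : q.2.1 = β
    · rw [Set.indicator_of_mem (by simpa using hq), Set.indicator_of_mem (by simpa using hq)]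
      rfl
    · rw [Set.indicator_of_notMem (by simpa using hq), Set.indicator_of_notMem (by simpa using hq)]
  rw [h2]
  have hup : ∀ q, (Function.update (e.symm ((0, false, default), r)).1 w q.2.1,
      Function.update (e.symm ((0, false, default), r)).2 s (q.1, q.2.2)) = e.symm (q, r) := by
    intro q
    refine Prod.ext (funext fun j => ?_) (funext fun j => ?_)
    · by_cases hj : j = w
      · subst hj; simp [he, slotSplit, Equiv.funSplitAt]
      · simp [he, slotSplit, Equiv.funSplitAt, hj]
    · by_cases hj : j = s
      · subst hj; simp [he, slotSplit, Equiv.funSplitAt]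
      · simp [he, slotSplit, Equiv.funSplitAt, hj]
  set y := Y (e.symm ((0, false, default), r)) with hy
  have hYr : ∀ q, Y (e.symm (q, r)) = y := fun q => by rw [← hup q, hY]
  have h3 : ∀ q, slice v r q ≠ 0 → q = (y, false, default) ∧ answerProb O y β ≤ δ := by
    intro q hq
    have := hχ (e.symm (q, r)) hq
    rw [hYr, ← hup q] at this
    simp only [Function.update_self, Prod.mk.injEq] at this
    obtain ⟨ha, ⟨hb, hc⟩, hd⟩ := this
    exact ⟨Prod.ext hb (Prod.ext ha hc), hd⟩
  by_cases h0 : slice v r = 0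
  · simp [h0]
  · obtain ⟨q, hq⟩ : ∃ q, slice v r q ≠ 0 := by
      by_contra! h
      exact h0 (lp.ext (funext h))
    obtain ⟨rfl, hδ⟩ := h3 q hq
    have h4 : slice v r = slice v r (y, false, default) • inputState A y := by
      ext q
      by_cases hqq : q = (y, false, default)
      · subst hqq; simp [inputState]
      · have : slice v r q = 0 := by
          by_contra h
          exact hqq (h3 q h).1
        rw [this]
        simp [inputState, hqq]
    rw [h4, map_smul, map_smul, norm_smul, norm_smul, mul_pow, mul_pow, ← answerProb_eq,
      norm_inputState]
    nlinarith [sq_nonneg ‖slice v r (y, false, default)‖]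

end query

/-! ### The number on the index qubits -/

theorem readNat_succ (x : ℕ → Bool) (base n : ℕ) :
    readNat x base (n + 1) = readNat x base n + if x (base + n) then 2 ^ n else 0 :=
  Finset.sum_range_succ _ _

theorem readNat_lt (x : ℕ → Bool) (base n : ℕ) : readNat x base n < 2 ^ n := by
  induction n with
  | zero => simp [readNat]
  | succ n ih =>
    rw [readNat_succ, pow_succ]
    split_ifs <;> omega

theorem readNat_congr {x y : ℕ → Bool} {base n : ℕ} (h : ∀ j < n, x (base + j) = y (base + j)) :
    readNat x base n = readNat y base n :=
  Finset.sum_congr rfl fun j hj => by rw [h j (Finset.mem_range.mp hj)]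

theorem readNat_inj {x y : ℕ → Bool} {base n : ℕ} (h : readNat x base n = readNat y base n) :
    ∀ j < n, x (base + j) = y (base + j) := by
  induction n with
  | zero => simp
  | succ n ih =>
    rw [readNat_succ, readNat_succ] at h
    have hx := readNat_lt x base n
    have hy := readNat_lt y base n
    have : x (base + n) = y (base + n) ∧ readNat x base n = readNat y base n := by
      cases h1 : x (base + n) <;> cases h2 : y (base + n) <;> simp [h1, h2] at h ⊢ <;> omega
    intro j hj
    rcases Nat.lt_succ_iff_lt_or_eq.mp hj with h' | rfl
    · exact ih this.2 j h'
    · exact this.1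

theorem exists_readNat_eq {n i : ℕ} (h : i < 2 ^ n) : ∃ x, readNat x 0 n = i := by
  induction n generalizing i with
  | zero => exact ⟨fun _ => false, by simp [readNat]; omega⟩
  | succ n ih =>
    rw [pow_succ] at h
    have key : ∀ i' < 2 ^ n, ∀ β : Bool, ∃ x, readNat x 0 (n + 1) = i' + if β then 2 ^ n else 0 := by
      intro i' hi' β
      obtain ⟨x, rfl⟩ := ih hi'
      refine ⟨Function.update x n β, ?_⟩
      rw [readNat_succ, readNat_congr (y := x)]
      · simp
      · intro j hj
        rw [Function.update_of_ne (by omega)]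
    by_cases hi : i < 2 ^ n
    · simpa using key i hi false
    · obtain ⟨x, hx⟩ := key (i - 2 ^ n) (by omega) true
      exact ⟨x, by rw [hx]; simp; omega⟩

/-! ### Banks of queries -/

/-- Queries of the membership oracle on the element with the index on the work qubits `0, …, n - 1`,
on the slots `s₀, …, s₀ + M - 1`; the answer qubit of the slot `s` is `n + 2 s`. -/
def bankC (n s₀ M : ℕ) : Circuit :=
  (List.range M).flatMap fun j => [.enum 0 n (s₀ + j), .query (n + 2 * (s₀ + j)) (s₀ + j)]

theorem bankC_succ (n s₀ M : ℕ) : bankC n s₀ (M + 1) =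
    bankC n s₀ M ++ [.enum 0 n (s₀ + M), .query (n + 2 * (s₀ + M)) (s₀ + M)] := by
  simp [bankC, List.range_succ]

/-- The number of qubits `w, w + d, …, w + (M - 1) d` with the value `β`. -/
def bitCount (β : Bool) (x : ℕ → Bool) (w d M : ℕ) : ℕ :=
  ∑ j ∈ Finset.range M, if x (w + d * j) = β then 1 else 0

theorem bitCount_succ (β : Bool) (x : ℕ → Bool) (w d M : ℕ) :
    bitCount β x w d (M + 1) = bitCount β x w d M + if x (w + d * M) = β then 1 else 0 :=
  Finset.sum_range_succ _ _

theorem bitCount_congr {β : Bool} {x y : ℕ → Bool} {w d M : ℕ}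
    (h : ∀ j < M, x (w + d * j) = y (w + d * j)) : bitCount β x w d M = bitCount β y w d M :=
  Finset.sum_congr rfl fun j hj => by rw [h j (Finset.mem_range.mp hj)]

theorem bitCount_add_not (β : Bool) (x : ℕ → Bool) (w d M : ℕ) :
    bitCount β x w d M + bitCount (!β) x w d M = M := by
  induction M with
  | zero => simp [bitCount]
  | succ M ih =>
    rw [bitCount_succ, bitCount_succ]
    cases x (w + d * M) <;> cases β <;> simp at ih ⊢ <;> omega

theorem bankC_mem {n s₀ M : ℕ} {g : Gate} (hg : g ∈ bankC n s₀ M) :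
    ∃ s, s₀ ≤ s ∧ s < s₀ + M ∧ (g = .enum 0 n s ∨ g = .query (n + 2 * s) s) := by
  simp only [bankC, List.mem_flatMap, List.mem_range, List.mem_cons, List.not_mem_nil,
    or_false] at hg
  obtain ⟨j, hj, h⟩ := hg
  exact ⟨s₀ + j, by omega, by omega, h⟩

theorem bankC_noT {n s₀ M : ℕ} : ∀ g ∈ bankC n s₀ M, g.NoT := by
  intro g hg
  obtain ⟨s, -, -, rfl | rfl⟩ := bankC_mem hg <;> trivial

theorem bankC_fixes {A : Type*} {n s₀ M : ℕ} {S : Set (Basis A)}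
    (h : ∀ s, s₀ ≤ s → s < s₀ + M → IndepWire (n + 2 * s) S ∧ IndepSlot s S) :
    ∀ g ∈ bankC n s₀ M, g.Fixes S := by
  intro g hg
  obtain ⟨s, h1, h2, rfl | rfl⟩ := bankC_mem hg
  · exact (h s h1 h2).2
  · exact h s h1 h2

section bank

variable {A : Type*} [Inhabited A]

/-- The slots of a bank and their answer qubits are in the state `0`. -/
def cleanBank (A : Type*) [Inhabited A] (n s₀ M : ℕ) : Set (Basis A) :=
  {b | ∀ s, s₀ ≤ s → s < s₀ + M → b.1 (n + 2 * s) = false ∧ b.2 s = (0, default)}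

theorem cleanBank_anti (n s₀ : ℕ) {M M' : ℕ} (h : M ≤ M') :
    cleanBank A n s₀ M' ⊆ cleanBank A n s₀ M := fun _ hb s h1 h2 => hb s h1 (by omega)

/-- Few of the answers of a bank of queries are wrong. -/
theorem norm_sq_proj_bank {f : ℕ → ℕ} {O : Oracle A} {n s₀ : ℕ} {β : Bool} (M t : ℕ)
    {φ : L2 (Basis A)} (hφ : proj (cleanBank A n s₀ M) φ = φ)
    (hO : ∀ b, φ b ≠ 0 → answerProb O (f (readNat b.1 0 n)) β ≤ 1 / 10) :
    ‖proj {b | t ≤ bitCount β b.1 (n + 2 * s₀) 2 M} ((bankC n s₀ M).unitary f O φ)‖ ^ 2 ≤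
      2 ^ M * (1 / 10) ^ t * ‖φ‖ ^ 2 := by
  induction M generalizing t with
  | zero =>
    cases t with
    | zero =>
      have : {b : Basis A | 0 ≤ bitCount β b.1 (n + 2 * s₀) 2 0} = Set.univ := by simp
      rw [this]
      have := norm_proj_le Set.univ ((bankC n s₀ 0).unitary f O φ)
      rw [LinearIsometryEquiv.norm_map] at this
      simpa using pow_le_pow_left₀ (norm_nonneg _) this 2
    | succ t =>
      have : {b : Basis A | t + 1 ≤ bitCount β b.1 (n + 2 * s₀) 2 0} = ∅ := by simp [bitCount]
      rw [this]
      have h0 : proj ∅ ((bankC n s₀ 0).unitary f O φ) = 0 := by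
        ext b; simp [proj_apply]
      rw [h0]
      rw [norm_zero, zero_pow two_ne_zero]
      positivity
  | succ M ih =>
    have hφ' : proj (cleanBank A n s₀ M) φ = φ := by
      rw [proj_eq_self_iff] at hφ ⊢
      exact fun b hb => cleanBank_anti n s₀ (Nat.le_succ M) (hφ b hb)
    set v := (bankC n s₀ M).unitary f O φ with hv
    set w := n + 2 * (s₀ + M) with hw
    have hstep : (bankC n s₀ (M + 1)).unitary f O φ =
        Gate.unitary f O (.query w (s₀ + M)) (Gate.unitary f O (.enum 0 n (s₀ + M)) v) := by
      rw [bankC_succ, Circuit.unitary_append]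
      rfl
    rw [hstep]
    have hcnt : ∀ t, Commutes ((Gate.unitary f O (.enum 0 n (s₀ + M))).trans
        (Gate.unitary f O (.query w (s₀ + M))))
        {b : Basis A | t ≤ bitCount β b.1 (n + 2 * s₀) 2 M} := by
      intro t
      have hi : IndepWire w {b : Basis A | t ≤ bitCount β b.1 (n + 2 * s₀) 2 M} := by
        apply indepWire_wires (p := fun x => t ≤ bitCount β x (n + 2 * s₀) 2 M)
        intro x γ
        rw [bitCount_congr (y := x)]
        intro j hj
        rw [Function.update_of_ne (by omega)]
      exact (Gate.Fixes.commutes (g := .enum 0 n (s₀ + M)) (fun b z => Iff.rfl)).trans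
        (Gate.Fixes.commutes (g := .query w (s₀ + M)) ⟨hi, fun b z => Iff.rfl⟩)
    cases t with
    | zero =>
      have h1 := norm_proj_le {b : Basis A | 0 ≤ bitCount β b.1 (n + 2 * s₀) 2 (M + 1)}
        (Gate.unitary f O (.query w (s₀ + M)) (Gate.unitary f O (.enum 0 n (s₀ + M)) v))
      rw [LinearIsometryEquiv.norm_map, LinearIsometryEquiv.norm_map, hv,
        LinearIsometryEquiv.norm_map] at h1
      refine (pow_le_pow_left₀ (norm_nonneg _) h1 2).trans ?_
      rw [pow_zero, mul_one]
      exact le_mul_of_one_le_left (sq_nonneg _) (one_le_pow₀ (by norm_num))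
    | succ t =>
      -- Pascal's rule: either there are already `t + 1` wrong answers among the first `M`, or there
      -- are at least `t` and the new one is wrong as well. The two cases contribute equal bounds,
      -- whence the factor `2` per query in `2 ^ M`.
      have hsub : {b : Basis A | t + 1 ≤ bitCount β b.1 (n + 2 * s₀) 2 (M + 1)} ⊆
          {b | t + 1 ≤ bitCount β b.1 (n + 2 * s₀) 2 M} ∪
          ({b | b.1 w = β} ∩ {b | t ≤ bitCount β b.1 (n + 2 * s₀) 2 M}) := by
        intro b hb
        simp only [Set.mem_ofPred_eq, bitCount_succ] at hb
        have hw' : n + 2 * s₀ + 2 * M = w := by omega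
        rw [hw'] at hb
        by_cases h : b.1 w = β
        · right
          rw [if_pos h] at hb
          exact ⟨h, by simpa using hb⟩
        · left
          rw [if_neg h] at hb
          exact hb
      have h1 := pow_le_pow_left₀ (norm_nonneg _) (norm_proj_mono (v :=
        Gate.unitary f O (.query w (s₀ + M)) (Gate.unitary f O (.enum 0 n (s₀ + M)) v)) hsub) 2
      refine (h1.trans (norm_sq_proj_union_le _ _ _)).trans ?_
      have hA : ‖proj {b | t + 1 ≤ bitCount β b.1 (n + 2 * s₀) 2 M}
          (Gate.unitary f O (.query w (s₀ + M)) (Gate.unitary f O (.enum 0 n (s₀ + M)) v))‖ =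
          ‖proj {b | t + 1 ≤ bitCount β b.1 (n + 2 * s₀) 2 M} v‖ := by
        have := hcnt (t + 1) v
        change Gate.unitary f O (.query w (s₀ + M)) (Gate.unitary f O (.enum 0 n (s₀ + M)) _) =
          proj _ (Gate.unitary f O (.query w (s₀ + M))
            (Gate.unitary f O (.enum 0 n (s₀ + M)) v)) at this
        rw [← this, LinearIsometryEquiv.norm_map, LinearIsometryEquiv.norm_map]
      set u := proj {b | t ≤ bitCount β b.1 (n + 2 * s₀) 2 M} v with hu
      have hB : ‖proj ({b | b.1 w = β} ∩ {b | t ≤ bitCount β b.1 (n + 2 * s₀) 2 M})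
          (Gate.unitary f O (.query w (s₀ + M)) (Gate.unitary f O (.enum 0 n (s₀ + M)) v))‖ ^ 2 ≤
          1 / 10 * ‖u‖ ^ 2 := by
        rw [← proj_proj]
        have := hcnt t v
        change Gate.unitary f O (.query w (s₀ + M)) (Gate.unitary f O (.enum 0 n (s₀ + M)) u) =
          proj _ (Gate.unitary f O (.query w (s₀ + M))
            (Gate.unitary f O (.enum 0 n (s₀ + M)) v)) at this
        rw [← this, ← LinearIsometryEquiv.norm_map (Gate.unitary f O (.enum 0 n (s₀ + M))) u]
        apply norm_sq_proj_query (Y := fun b => f (readNat b.1 0 n))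
        · intro b γ z
          dsimp only
          rw [readNat_congr (y := b.1)]
          intro j hj
          rw [Function.update_of_ne (by omega)]
        · intro b hb
          -- The earlier queries of the bank change neither the new slot, nor its answer qubit, nor
          -- the index qubits, so support conditions on `φ` survive in `u`.
          have hfix : ∀ S : Set (Basis A), (∀ g ∈ bankC n s₀ M, g.Fixes S) → proj S φ = φ →
              proj S u = u := by
            intro S hS hSφ
            rw [hu, proj_comm, hv, (Circuit.commutes hS).proj_eq_self hSφ]
          have hu1 := hfix {b | b.1 w = false ∧ b.2 (s₀ + M) = (0, default)} (by
            apply bankC_fixes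
            intro s h1 h2
            constructor
            · intro b γ
              simp only [Set.mem_ofPred_eq]
              rw [Function.update_of_ne (by omega)]
            · intro b z
              simp only [Set.mem_ofPred_eq]
              rw [Function.update_of_ne (by omega)]) (by
            rw [proj_eq_self_iff] at hφ ⊢
            exact fun b hb => hφ b hb _ (by omega) (by omega))
          have hu2 := hfix {b | answerProb O (f (readNat b.1 0 n)) β ≤ 1 / 10} (by
            apply bankC_fixes
            intro s h1 h2
            constructor
            · apply indepWire_wires (p := fun x => answerProb O (f (readNat x 0 n)) β ≤ 1 / 10)
              intro x γ
              rw [readNat_congr (y := x)]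
              intro j hj
              rw [Function.update_of_ne (by omega)]
            · exact fun b z => Iff.rfl) (by
            rw [proj_eq_self_iff]
            exact hO)
          rw [proj_eq_self_iff] at hu1 hu2
          -- The enumeration query is an involution, so the amplitude at `b` comes from the basis
          -- state with the code XORed in once more; that slot was zero, hence it now holds exactly
          -- the code.
          have hb' : u (b.1, Function.update b.2 (s₀ + M)
              ((b.2 (s₀ + M)).1 ^^^ f (readNat b.1 0 n), (b.2 (s₀ + M)).2)) ≠ 0 := hb
          obtain ⟨h1, h2⟩ := hu1 _ hb'
          simp only [Function.update_self, Prod.mk.injEq, Nat.xor_eq_zero_iff] at h1 h2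
          have h3 := hu2 _ hb'
          exact ⟨h1, Prod.ext h2.1 h2.2, h3⟩
      rw [hA]
      have h2 := ih (t + 1) hφ'
      have h3 := ih t hφ'
      calc _ ≤ 2 ^ M * (1 / 10) ^ (t + 1) * ‖φ‖ ^ 2 +
            1 / 10 * (2 ^ M * (1 / 10) ^ t * ‖φ‖ ^ 2) := by
            refine add_le_add h2 (hB.trans ?_)
            gcongr
        _ = _ := by ring

end bank

/-! ### Recursive amplitude amplification with imperfect reflections -/

/-- Recursive amplitude amplification: each round applies `S k = 1 - 2 P k`, where `P k` is only
approximately the projection onto the target, and `D k = 2 U - 1`, where `U` is the projection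
onto the uniform superposition on the first `m k` index qubits.  The projection `proj (R l)`
checks the index qubits from `l` on. -/
structure Amplification {ι : Type*} (n K : ℕ) (m : ℕ → ℕ) (R : ℕ → Set ι)
    (U P : ℕ → L2 ι →ₗ[ℂ] L2 ι) (W S D : ℕ → Unit2 ι) (ψ : L2 ι) (q : ℝ) (ε : ℕ → ℝ) :
    Prop where
  mono : ∀ j k, j ≤ k → m j ≤ m k
  le : ∀ k < K, m k ≤ n
  q_nonneg : 0 ≤ q
  subset : ∀ l ≤ n, R 0 ⊆ R l
  zero : ∀ v, W 0 v = v
  succ : ∀ k v, W (k + 1) v = W k (D k ((W k).symm (S k (W k v))))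
  diffusion : ∀ k v, D k v = (2 : ℂ) • U (m k) v - v
  reflection : ∀ k v, S k v = v - (2 : ℂ) • P k v
  idem : ∀ l v, U l (U l v) = U l v
  selfAdj : ∀ l v w, inner ℂ (U l v) w = inner ℂ v (U l w)
  norm_U : ∀ l v, ‖U l v‖ ≤ ‖v‖
  norm_P : ∀ k v, ‖P k v‖ ≤ ‖v‖
  comm_U : ∀ l l' v, l' ≤ l → proj (R l) (U l' v) = U l' (proj (R l) v)
  comm_W : ∀ k l, (∀ j < k, m j ≤ l) → Commutes (W k) (R l)
  comm_S : ∀ k l, Commutes (S k) (R l)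
  uniform : ∀ l l' v, l' ≤ l → l ≤ n → ‖proj (R l') (U l v)‖ ≤ q ^ (l - l') * ‖proj (R l) v‖
  start : ∀ l ≤ n, U l ψ = ψ
  norm_start : ‖ψ‖ = 1
  amplitude_start : q ^ n ≤ ‖proj (R 0) ψ‖
  complete : ∀ k < K, ‖proj (R 0) (W k ψ - P k (W k ψ))‖ ≤ ε k * ‖proj (R 0) (W k ψ)‖
  sound : ∀ k < K, ∀ l ≤ n,
    ‖proj (R 0)ᶜ (proj (R l) (P k (W k ψ)))‖ ≤ ε k * ‖proj (R l) (W k ψ)‖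

namespace Amplification

variable {ι : Type*} {n K : ℕ} {m : ℕ → ℕ} {R : ℕ → Set ι} {U P : ℕ → L2 ι →ₗ[ℂ] L2 ι}
  {W S D : ℕ → Unit2 ι} {ψ : L2 ι} {q : ℝ} {ε : ℕ → ℝ}

/-- No correctness of `P` enters, which makes the bound usable on dirty states. By the recursion, `W
(k + 1)` is twice a term ending in `W k (U (m k) _)`, to which induction applies, minus a term that
is reflected by `S k` and therefore has the same projection norm as before: `2 + 1 = 3`. -/
theorem norm_le (h : Amplification n K m R U P W S D ψ q ε) {k : ℕ} (hk : k ≤ K) (l : ℕ)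
    (hl : ∀ j < k, m j ≤ l) (hn : l ≤ n) (ξ : L2 ι) :
    ‖proj (R 0) (W k (U l ξ))‖ ≤ 3 ^ k * q ^ l * ‖proj (R l) ξ‖ := by
  have hq := h.q_nonneg
  induction k generalizing l ξ with
  | zero =>
    rw [h.zero]
    simpa using h.uniform l 0 ξ (Nat.zero_le _) hn
  | succ k ih =>
    have hkl : m k ≤ l := hl k (Nat.lt_succ_self k)
    have hmk : ∀ j < k, m j ≤ m k := fun j hj => h.mono j k hj.le
    set ζ := (W k).symm (S k (W k (U l ξ))) with hζ
    have h1 : W (k + 1) (U l ξ) = (2 : ℂ) • W k (U (m k) ζ) - S k (W k (U l ξ)) := by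
      rw [h.succ, h.diffusion, map_sub, map_smul, (W k).apply_symm_apply]
    have h2 : ‖proj (R 0) (W k (U (m k) ζ))‖ ≤ 3 ^ k * q ^ l * ‖proj (R l) ξ‖ := by
      refine (ih (by omega) (m k) hmk (h.le k (by omega)) ζ).trans ?_
      -- `W k` and `S k` cannot move weight between blocks of indices that differ from bit `m k` on,
      -- so only the block of the target counts, and `U l` put the fraction `q ^ (l - m k)` of the
      -- amplitude there.
      have h3 : ‖proj (R (m k)) ζ‖ = ‖proj (R (m k)) (U l ξ)‖ := by
        rw [hζ, ← (h.comm_W k (m k) hmk).symm, LinearIsometryEquiv.norm_map, ← h.comm_S,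
          LinearIsometryEquiv.norm_map, ← h.comm_W k (m k) hmk, LinearIsometryEquiv.norm_map]
      rw [h3]
      have h4 := h.uniform l (m k) ξ hkl hn
      have h5 : q ^ l = q ^ m k * q ^ (l - m k) := by
        rw [← pow_add]; congr 1; omega
      rw [h5]
      calc _ ≤ 3 ^ k * q ^ m k * (q ^ (l - m k) * ‖proj (R l) ξ‖) := by gcongr
        _ = _ := by ring
    have h6 : ‖proj (R 0) (S k (W k (U l ξ)))‖ ≤ 3 ^ k * q ^ l * ‖proj (R l) ξ‖ := by
      rw [← h.comm_S, LinearIsometryEquiv.norm_map]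
      exact ih (by omega) l (fun j hj => hl j (by omega)) hn ξ
    rw [h1, map_sub, map_smul]
    refine (norm_sub_le _ _).trans ?_
    rw [norm_smul]
    norm_num
    rw [pow_succ]
    linarith

/-- The operator here is the adjoint of `proj (R 0) ∘ W k ∘ U l`, so it has the same operator norm,
bounded in `norm_le`. -/
theorem norm_adjoint_le (h : Amplification n K m R U P W S D ψ q ε) {k : ℕ} (hk : k ≤ K) (l : ℕ)
    (hl : ∀ j < k, m j ≤ l) (hn : l ≤ n)
    (η : L2 ι) :
    ‖U l ((W k).symm (proj (R 0) η))‖ ≤ 3 ^ k * q ^ l * ‖proj (R 0) η‖ := by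
  have hq := h.q_nonneg
  generalize hx : U l ((W k).symm (proj (R 0) η)) = x
  have h1 : ‖x‖ ^ 2 = ‖inner ℂ (proj (R 0) (W k (U l x))) (proj (R 0) η)‖ := by
    have e1 : inner ℂ x x = inner ℂ (proj (R 0) (W k (U l x))) (proj (R 0) η) := by
      rw [inner_proj_left, proj_proj, Set.inter_self]
      conv_rhs => rw [← (W k).apply_symm_apply (proj (R 0) η)]
      rw [LinearIsometryEquiv.inner_map_map, h.selfAdj, hx]
    rw [← e1, inner_self_eq_norm_sq_to_K]
    simp
  have h2 : ‖x‖ ^ 2 ≤ 3 ^ k * q ^ l * ‖x‖ * ‖proj (R 0) η‖ := by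
    rw [h1]
    refine (norm_inner_le_norm _ _).trans ?_
    gcongr
    refine (h.norm_le hk l hl hn x).trans ?_
    gcongr
    exact norm_proj_le _ _
  rcases (norm_nonneg x).eq_or_lt with h0 | h0
  · rw [← h0]; positivity
  · have : ‖x‖ * ‖x‖ ≤ ‖x‖ * (3 ^ k * q ^ l * ‖proj (R 0) η‖) := by nlinarith
    exact le_of_mul_le_mul_left this h0

/-- With `φ = W k ψ`, one round yields `3 φ` minus an error of the selection minus a term caused by
the overlap of the selected part with the uniform superposition of the block. Relative to the ideal
amplitude `3 ^ (k + 1) * q ^ n` these cost `2 ε k` and `(4/3) 9 ^ k q ^ (2 m k)` in total. -/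
theorem le_amplitude (h : Amplification n K m R U P W S D ψ q ε) {k : ℕ}
    (hk : k ≤ K) (hε : ∀ k, 0 ≤ ε k) :
    3 ^ k * q ^ n * (1 - ∑ j ∈ Finset.range k, (2 * ε j + 4 / 3 * (9 ^ j * q ^ (2 * m j)))) ≤
      ‖proj (R 0) (W k ψ)‖ := by
  have hq := h.q_nonneg
  induction k with
  | zero =>
    rw [h.zero]
    simpa using h.amplitude_start
  | succ k ih =>
    have ih := ih (by omega)
    have hkK : k < K := by omega
    have hmn := h.le k hkK
    have hmk : ∀ j < k, m j ≤ m k := fun j hj => h.mono j k hj.le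
    set b := ‖proj (R 0) (W k ψ)‖ with hb
    set φ := W k ψ with hφ
    have hb1 : b ≤ 3 ^ k * q ^ n := by
      have h1 := h.norm_le hkK.le n (fun j hj => h.le j (by omega)) le_rfl ψ
      rw [h.start n le_rfl] at h1
      refine h1.trans (mul_le_of_le_one_right (by positivity) ?_)
      exact (norm_proj_le _ _).trans h.norm_start.le
    have hcommP : ∀ l v, P k (proj (R l) v) = proj (R l) (P k v) := by
      intro l v
      have h1 := h.comm_S k l v
      rw [h.reflection, h.reflection, map_sub, map_smul] at h1
      have h2 := sub_right_injective h1
      exact smul_right_injective _ (two_ne_zero (α := ℂ)) h2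
    set ω := U (m k) ((W k).symm (P k φ)) with hω
    -- Expansion of `W (2U - 1) W⁻¹ (1 - 2P) W ψ` with `U ψ = ψ`. For exact selection the middle
    -- term has no component on the target, and `ω` is the overlap that prevents an exact tripling.
    have hψ : W (k + 1) ψ = (3 : ℂ) • φ - (2 : ℂ) • (φ - P k φ) - (4 : ℂ) • W k ω := by
      have h1 : (W k).symm φ = ψ := (W k).symm_apply_apply ψ
      rw [h.succ, h.diffusion, h.reflection, ← hφ]
      simp only [map_sub, map_smul, h1, h.start (m k) hmn, ← hω, ← hφ, (W k).apply_symm_apply]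
      module
    have hT : ‖proj (R 0) (W k ω)‖ ≤
        3 ^ k * q ^ m k * (3 ^ k * q ^ m k * b + ε k * q ^ (n - m k)) := by
      have h1 := h.norm_le hkK.le (m k) hmk hmn ω
      rw [hω, h.idem, ← hω] at h1
      refine h1.trans ?_
      gcongr
      -- The selected vector is split inside the block into the target, treated by the adjoint
      -- bound, and wrongly selected indices, which `sound` bounds by `ε k` times the amplitude of
      -- the block.
      have hRω : proj (R (m k)) ω = U (m k) ((W k).symm (proj (R 0) (P k φ))) +
          U (m k) ((W k).symm (proj (R 0)ᶜ (proj (R (m k)) (P k φ)))) := by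
        rw [hω, h.comm_U _ _ _ le_rfl, ← (h.comm_W k (m k) hmk).symm, ← map_add, ← map_add]
        have : proj (R 0) (P k φ) = proj (R 0) (proj (R (m k)) (P k φ)) := by
          rw [proj_proj, Set.inter_eq_left.mpr (h.subset _ hmn)]
        rw [this, proj_add_compl]
      rw [hRω]
      refine (norm_add_le _ _).trans (add_le_add ?_ ?_)
      · refine (h.norm_adjoint_le hkK.le (m k) hmk hmn _).trans ?_
        gcongr
        rw [← hcommP]
        exact h.norm_P _ _
      · refine (h.norm_U _ _).trans ?_
        rw [LinearIsometryEquiv.norm_map]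
        refine (h.sound k hkK (m k) hmn).trans ?_
        refine mul_le_mul_of_nonneg_left ?_ (hε k)
        rw [← hφ, hφ, ← h.comm_W k (m k) hmk, LinearIsometryEquiv.norm_map]
        have h2 := h.uniform n (m k) ψ hmn le_rfl
        rw [h.start n le_rfl] at h2
        refine h2.trans (mul_le_of_le_one_right (by positivity) ?_)
        exact (norm_proj_le _ _).trans h.norm_start.le
    have hlow : 3 * b - 2 * (ε k * b) - 4 * ‖proj (R 0) (W k ω)‖ ≤
        ‖proj (R 0) (W (k + 1) ψ)‖ := by
      rw [hψ, map_sub, map_sub, map_smul, map_smul, map_smul]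
      have h1 := norm_sub_norm_le ((3 : ℂ) • proj (R 0) φ - (2 : ℂ) • proj (R 0) (φ - P k φ))
        ((4 : ℂ) • proj (R 0) (W k ω))
      have h2 := norm_sub_norm_le ((3 : ℂ) • proj (R 0) φ) ((2 : ℂ) • proj (R 0) (φ - P k φ))
      rw [norm_smul] at h1
      rw [norm_smul, norm_smul] at h2
      rw [Complex.norm_ofNat, sub_le_iff_le_add] at h1
      rw [Complex.norm_ofNat, Complex.norm_ofNat, sub_le_iff_le_add] at h2
      have h3 := h.complete k hkK
      rw [← hφ, ← hb] at h3
      have h4 : ‖proj (R 0) φ‖ = b := rfl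
      rw [map_sub] at h1 h2 h3 ⊢
      linarith
    have hqq : q ^ m k * q ^ (n - m k) = q ^ n := by
      rw [← pow_add]; congr 1; omega
    have h9 : (3 : ℝ) ^ k * q ^ m k * (3 ^ k * q ^ m k) = 9 ^ k * q ^ (2 * m k) := by
      have : (9 : ℝ) ^ k = 3 ^ k * 3 ^ k := by rw [← mul_pow]; norm_num
      rw [this, two_mul, pow_add]; ring
    set x := 3 ^ k * q ^ n with hx
    set s := 9 ^ k * q ^ (2 * m k) with hs
    have hT' : ‖proj (R 0) (W k ω)‖ ≤ s * b + ε k * x := by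
      refine hT.trans (le_of_eq ?_)
      rw [mul_add, ← mul_assoc, h9, hx, ← hqq]
      ring
    have hs0 : 0 ≤ s := by positivity
    have h10 : s * b ≤ s * x := mul_le_mul_of_nonneg_left hb1 hs0
    have h11 : ε k * b ≤ ε k * x := mul_le_mul_of_nonneg_left hb1 (hε k)
    -- The amplitude loss is at most `2 ε x + 4 (s x + ε x)`, using `b ≤ x`; dividing by `3 x` gives
    -- exactly the new summand `2 ε + (4/3) s`.
    rw [Finset.sum_range_succ, pow_succ]
    have h12 : 3 ^ k * 3 * q ^ n = 3 * x := by rw [hx]; ring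
    rw [h12]
    nlinarith

end Amplification

/-! ### A reversible circuit for threshold functions

The table entry `(r, j)` tells whether `t ≤ j + c`, where `c` is the number of ones among the first
`r` input bits; it is stored on the scratch qubit number `r (M + 1) + j`. -/

/-- The qubit `s + δ`, initially `0`, is set to the qubit `s + 2` or `s`, depending on the qubit
`w`. -/
def selectC (w s δ : ℕ) : Circuit :=
  [.CCNOT s s (s + δ), .CCNOT w s (s + δ), .CCNOT w (s + 2) (s + δ)]

/-- First row of the table. -/
def thrInit (n M t : ℕ) : Circuit :=
  (List.range (M + 1 - t)).map fun j => .X (n + 1 + 2 * (t + j))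

/-- Computation of the next row of the table, which starts at the qubit `s`. -/
def thrRow (w s M : ℕ) : Circuit :=
  (List.range M).flatMap fun j => selectC w (s + 2 * j) (2 * (M + 1))

/-- Computation of all rows. -/
def thrRows (n w d M r : ℕ) : Circuit :=
  (List.range r).flatMap fun i => thrRow (w + d * i) (n + 1 + 2 * (i * (M + 1))) M

/-- Computes whether at least `t` of the `M` qubits `w, w + d, w + 2 d, …` are set. -/
def thrC (n w d M t : ℕ) : Circuit := thrInit n M t ++ thrRows n w d M M

/-- The output qubit of the threshold circuit. -/
def thrFlag (n M : ℕ) : ℕ := n + 1 + 2 * (M * (M + 1))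

/-- All scratch qubits are `0`. -/
def scratchZero (n : ℕ) (x : ℕ → Bool) : Prop := ∀ a, x (n + 1 + 2 * a) = false

/-- A multiplexer in Toffoli gates: the target becomes `x_s ⊕ (x_w ∧ x_s) ⊕ (x_w ∧ x_{s+2})`. A
repeated control, as in `CCNOT s s`, acts as a CNOT, so the circuit stays within the classical gates
treated here. -/
theorem selectC_bits {w s δ : ℕ} (hw : w ≠ s + δ) (hδ : 2 < δ) {x : ℕ → Bool}
    (h0 : x (s + δ) = false) : (selectC w s δ).bits x =
      Function.update x (s + δ) (if x w then x (s + 2) else x s) := by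
  have h1 : s ≠ s + δ := by omega
  have h2 : s + 2 ≠ s + δ := by omega
  funext j
  by_cases hj : j = s + δ
  · subst hj
    simp only [selectC, Circuit.bits, List.foldl, Gate.bits]
    simp only [Function.update_self, Function.update_of_ne hw, Function.update_of_ne h1,
      Function.update_of_ne h2, h0]
    cases x w <;> cases x s <;> cases x (s + 2) <;> rfl
  · simp [selectC, Circuit.bits, List.foldl, Gate.bits, hj]

/-- The row at `s` is read and the row at `s + 2 (M + 1)` is written. As these are disjoint and the
input qubit `w` is not in the new row, the order of the writes is irrelevant. Only the first `M`
entries are produced, because the entry number `M` would need a neighbour beyond the end of the row.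
-/
theorem thrRow_bits {w s M : ℕ} (hw : ∀ j < M, w ≠ s + 2 * (M + 1) + 2 * j) {x : ℕ → Bool}
    (h0 : ∀ j < M, x (s + 2 * (M + 1) + 2 * j) = false) (j : ℕ) :
    (thrRow w s M).bits x j = if s + 2 * (M + 1) ≤ j ∧ j < s + 2 * (M + 1) + 2 * M ∧
      (j - s) % 2 = 0 then (if x w then x (j - 2 * (M + 1) + 2) else x (j - 2 * (M + 1)))
      else x j := by
  have key : ∀ c ≤ M, ∀ j, Circuit.bits ((List.range c).flatMap fun j =>
      selectC w (s + 2 * j) (2 * (M + 1))) x j = if s + 2 * (M + 1) ≤ j ∧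
      j < s + 2 * (M + 1) + 2 * c ∧ (j - s) % 2 = 0 then
      (if x w then x (j - 2 * (M + 1) + 2) else x (j - 2 * (M + 1))) else x j := by
    intro c
    induction c with
    | zero =>
      intro _ j
      rw [if_neg (by omega)]
      rfl
    | succ c ih =>
      intro hc j
      have ih := ih (by omega)
      rw [List.range_succ, List.flatMap_append, Circuit.bits_append, List.flatMap_singleton]
      set y := Circuit.bits ((List.range c).flatMap fun j =>
        selectC w (s + 2 * j) (2 * (M + 1))) x with hy
      have hd : s + 2 * c + 2 * (M + 1) = s + 2 * (M + 1) + 2 * c := by ring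
      rw [selectC_bits (by rw [hd]; exact hw c (by omega)) (by omega)
        (by rw [ih, if_neg (by omega), hd]; exact h0 c (by omega))]
      have hyw : y w = x w := by
        rw [ih, if_neg]
        rintro ⟨h1, h2, h3⟩
        have := hw ((w - s - 2 * (M + 1)) / 2) (by omega)
        omega
      by_cases hj : j = s + 2 * c + 2 * (M + 1)
      · have a1 : y (s + 2 * c + 2) = x (s + 2 * c + 2) := by rw [ih, if_neg (by omega)]
        have a2 : y (s + 2 * c) = x (s + 2 * c) := by rw [ih, if_neg (by omega)]
        have a3 : s + 2 * (M + 1) ≤ j ∧ j < s + 2 * (M + 1) + 2 * (c + 1) ∧ (j - s) % 2 = 0 := by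
          omega
        rw [if_pos a3, hj, Function.update_self, hyw, a1, a2, Nat.add_sub_cancel]
      · rw [Function.update_of_ne hj, ih]
        congr 1
        apply propext
        omega
  exact key M le_rfl j

theorem thrInit_bits (n M t : ℕ) {x : ℕ → Bool} (hx : scratchZero n x) :
    (∀ j ≤ M, (thrInit n M t).bits x (n + 1 + 2 * j) = decide (t ≤ j)) ∧
    (∀ j, (∀ a ≤ M, j ≠ n + 1 + 2 * a) → (thrInit n M t).bits x j = x j) := by
  have key : ∀ c ≤ M + 1 - t, ∀ j, Circuit.bits ((List.range c).map fun j =>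
      Gate.X (n + 1 + 2 * (t + j))) x j = if n + 1 + 2 * t ≤ j ∧ j < n + 1 + 2 * (t + c) ∧
      (j - (n + 1)) % 2 = 0 then true else x j := by
    intro c
    induction c with
    | zero =>
      intro _ j
      rw [if_neg (by omega)]
      rfl
    | succ c ih =>
      intro hc j
      have ih := ih (by omega)
      rw [List.range_succ, List.map_append, Circuit.bits_append]
      set y := Circuit.bits ((List.range c).map fun j => Gate.X (n + 1 + 2 * (t + j))) x with hy
      change Function.update y (n + 1 + 2 * (t + c)) (!y (n + 1 + 2 * (t + c))) j = _
      by_cases hj : j = n + 1 + 2 * (t + c)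
      · rw [if_pos (by omega), ih, if_neg (by omega), hx, hj]
        simp
      · rw [Function.update_of_ne hj, ih]
        congr 1
        apply propext
        omega
  constructor
  · intro j hj
    rw [thrInit, key _ le_rfl, hx]
    by_cases h : t ≤ j
    · rw [if_pos (by omega)]; simp [h]
    · rw [if_neg (by omega)]; simp [h]
  · intro j hj
    rw [thrInit, key _ le_rfl, if_neg]
    rintro ⟨h1, h2, h3⟩
    have := hj ((j - (n + 1)) / 2) (by omega)
    omega

theorem thrC_bits {n w d M t : ℕ} {x : ℕ → Bool} (hx : scratchZero n x)
    (hw : ∀ r < M, ∀ a, w + d * r ≠ n + 1 + 2 * a) :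
    (thrC n w d M t).bits x (thrFlag n M) = decide (t ≤ bitCount true x w d M) := by
  -- Each row has one valid entry fewer than its predecessor, hence `j + r ≤ M`. In the last row
  -- only the entry `0` remains, and it is the output. The other two clauses say that inputs are
  -- intact and that later rows are still zero.
  have key : ∀ r ≤ M, ∀ y, y = (thrRows n w d M r).bits ((thrInit n M t).bits x) →
      (∀ j, (∀ a, j ≠ n + 1 + 2 * a) → y j = x j) ∧
      (∀ a, (r + 1) * (M + 1) ≤ a → y (n + 1 + 2 * a) = false) ∧
      (∀ j, j + r ≤ M → y (n + 1 + 2 * (r * (M + 1) + j)) =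
        decide (t ≤ j + bitCount true x w d r)) := by
    intro r
    induction r with
    | zero =>
      rintro - y rfl
      obtain ⟨h1, h2⟩ := thrInit_bits n M t hx
      refine ⟨fun j hj => h2 j fun a _ => hj a, fun a ha => ?_, fun j hj => ?_⟩
      · exact (h2 _ fun a' ha' => by omega).trans (hx a)
      · have := h1 j (by omega)
        simpa [bitCount, thrRows, Circuit.bits] using this
    | succ r ih =>
      rintro hr z rfl
      obtain ⟨h1, h2, h3⟩ := ih (by omega) _ rfl
      set y := (thrRows n w d M r).bits ((thrInit n M t).bits x) with hy
      have hstep : (thrRows n w d M (r + 1)).bits ((thrInit n M t).bits x) =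
          (thrRow (w + d * r) (n + 1 + 2 * (r * (M + 1))) M).bits y := by
        rw [thrRows, List.range_succ, List.flatMap_append, Circuit.bits_append,
          List.flatMap_singleton]
        rfl
      rw [hstep]
      have e1 : ∀ j, n + 1 + 2 * (r * (M + 1)) + 2 * (M + 1) + 2 * j =
          n + 1 + 2 * ((r + 1) * (M + 1) + j) := fun j => by ring
      have hrow := thrRow_bits (w := w + d * r) (s := n + 1 + 2 * (r * (M + 1))) (M := M) (x := y)
        (fun j _ => by rw [e1]; exact hw r (by omega) _)
        (fun j _ => by rw [e1]; exact h2 _ (by omega))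
      have e2 : (r + 1) * (M + 1) = r * (M + 1) + (M + 1) := by ring
      have e3 : (r + 1 + 1) * (M + 1) = r * (M + 1) + (M + 1) + (M + 1) := by ring
      generalize r * (M + 1) = ρ at *
      refine ⟨fun j hj => ?_, fun a ha => ?_, fun j hj => ?_⟩
      · rw [hrow, if_neg, h1 j hj]
        rintro ⟨h4, h5, h6⟩
        have := hj ((j - (n + 1)) / 2)
        omega
      · rw [hrow, if_neg (by omega)]
        exact h2 a (by omega)
      · rw [hrow, if_pos (by omega), h1 _ (hw r (by omega))]
        have e4 : n + 1 + 2 * ((r + 1) * (M + 1) + j) - 2 * (M + 1) + 2 =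
            n + 1 + 2 * (ρ + (j + 1)) := by omega
        have e5 : n + 1 + 2 * ((r + 1) * (M + 1) + j) - 2 * (M + 1) = n + 1 + 2 * (ρ + j) := by
          omega
        rw [e4, e5, h3 _ (by omega), h3 _ (by omega), bitCount_succ]
        cases x (w + d * r)
        · simp
        · simp only [if_true]
          congr 2
          ring
  have h := (key M le_rfl _ rfl).2.2 0 (by omega)
  rw [thrC, Circuit.bits_append]
  simpa [thrFlag] using h

theorem thrC_classical {n w d M t : ℕ} : ∀ g ∈ thrC n w d M t, g.Classical := by
  intro g hg
  simp only [thrC, thrInit, thrRows, thrRow, selectC, List.mem_append, List.mem_map,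
    List.mem_flatMap, List.mem_cons, List.not_mem_nil, or_false] at hg
  rcases hg with ⟨_, _, rfl⟩ | ⟨_, _, _, _, rfl | rfl | rfl⟩ <;> trivial

/-! ### Reflections -/

/-- The phase `-1` if at least `t` of the `M` qubits `w, w + d, w + 2 d, …` are set after the
circuit `B`. -/
def reflectC (B : Circuit) (n w d M t : ℕ) : Circuit :=
  (B ++ thrC n w d M t) ++ .Z (thrFlag n M) :: Circuit.inv (B ++ thrC n w d M t)

theorem reflectC_noT {B : Circuit} {n w d M t : ℕ} (hB : ∀ g ∈ B, g.NoT) :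
    ∀ g ∈ reflectC B n w d M t, g.NoT := by
  have h : ∀ g ∈ B ++ thrC n w d M t, g.NoT := by
    intro g hg
    rcases List.mem_append.mp hg with hg | hg
    · exact hB g hg
    · exact (thrC_classical g hg).noT
  intro g hg
  rw [reflectC, List.mem_append, List.mem_cons] at hg
  rcases hg with hg | rfl | hg
  · exact h g hg
  · trivial
  · exact Circuit.noT_inv h g hg

/-- States with all scratch qubits `0`. -/
def scratchSet (A : Type*) (n : ℕ) : Set (Basis A) := {b | scratchZero n b.1}

theorem sgn_congr_of_support {ι : Type*} {S T Z : Set ι} {v : L2 ι} (hv : proj Z v = v)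
    (h : ∀ i ∈ Z, (i ∈ S ↔ i ∈ T)) : sgn S v = sgn T v := by
  rw [sgn_eq, sgn_eq, proj_congr_of_support hv h]

/-- The threshold circuit is undone exactly by its mirror image, leaving a sign; on zero scratch
this sign is the intended one. Input qubits must avoid the scratch qubits, which are those at odd
distance beyond `n`; answer qubits sit at even distance. -/
theorem unitary_reflectC {A : Type*} {f : ℕ → ℕ} {O : Oracle A} {B : Circuit} {n w d M t : ℕ}
    (hB : ∀ g ∈ B, g.NoT) (hB' : Commutes (B.unitary f O) (scratchSet A n))
    (hw : ∀ r < M, ∀ a, w + d * r ≠ n + 1 + 2 * a)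
    {v : L2 (Basis A)} (hv : proj (scratchSet A n) v = v) :
    (reflectC B n w d M t).unitary f O v =
      (B.unitary f O).symm (sgn {b | t ≤ bitCount true b.1 w d M} (B.unitary f O v)) := by
  have h1 : reflectC B n w d M t = B ++ ((thrC n w d M t ++
      .Z (thrFlag n M) :: Circuit.inv (thrC n w d M t)) ++ B.inv) := by
    simp [reflectC, Circuit.inv_append]
  rw [h1, Circuit.unitary_append, Circuit.unitary_append, Circuit.unitary_inv f O hB,
    Circuit.unitary_phase thrC_classical]
  congr 1
  apply sgn_congr_of_support (hB'.proj_eq_self hv)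
  intro b hb
  change (thrC n w d M t).bits b.1 (thrFlag n M) = true ↔ t ≤ bitCount true b.1 w d M
  rw [thrC_bits hb hw, decide_eq_true_iff]

/-! ### The search circuit -/

/-- Hadamard gates on the qubits `0, …, m - 1`. -/
def hadC (m : ℕ) : Circuit := (List.range m).map .H

theorem hadC_succ (m : ℕ) : hadC (m + 1) = hadC m ++ [.H m] := by
  simp [hadC, List.range_succ]

theorem hadC_noT (m : ℕ) : ∀ g ∈ hadC m, g.NoT := by
  intro g hg
  obtain ⟨j, -, rfl⟩ := List.mem_map.mp hg
  trivial

/-- The first slot of the bank number `k`, which has `2 (10 + k)` slots. -/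
def slotBase (k : ℕ) : ℕ := k * (k + 19)

theorem slotBase_succ (k : ℕ) : slotBase (k + 1) = slotBase k + 2 * (10 + k) := by
  simp only [slotBase]; ring

theorem slotBase_mono : Monotone slotBase :=
  monotone_nat_of_le_succ fun k => by rw [slotBase_succ]; omega

/-- The bank number `k`. -/
def levelBank (n k : ℕ) : Circuit := bankC n (slotBase k) (2 * (10 + k))

/-- The reflection about the indices that are recognized by a majority of the bank `k`. -/
def selC (n k : ℕ) : Circuit :=
  reflectC (levelBank n k) n (n + 2 * slotBase k) 2 (2 * (10 + k)) (10 + k)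

/-- The reflection about the uniform superposition on the first `m` index qubits. -/
def difC (n m : ℕ) : Circuit := reflectC (hadC m) n 0 1 m 1

/-- Recursive amplitude amplification, `K` rounds. -/
def ampC (n : ℕ) (m : ℕ → ℕ) : ℕ → Circuit
  | 0 => []
  | k + 1 => ampC n m k ++ (selC n k ++ ((ampC n m k).inv ++ (difC n (m k) ++ ampC n m k)))

/-- Search on `n` index qubits followed by verification. -/
def searchC (n : ℕ) (m : ℕ → ℕ) (K : ℕ) : Circuit :=
  (hadC n).inv ++ (ampC n m K ++ levelBank n K)

theorem ampC_noT (n : ℕ) (m : ℕ → ℕ) (k : ℕ) : ∀ g ∈ ampC n m k, g.NoT := by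
  induction k with
  | zero => simp [ampC]
  | succ k ih =>
    intro g hg
    simp only [ampC, List.mem_append] at hg
    rcases hg with hg | hg | hg | hg | hg
    · exact ih g hg
    · exact reflectC_noT bankC_noT g hg
    · exact Circuit.noT_inv ih g hg
    · exact reflectC_noT (hadC_noT _) g hg
    · exact ih g hg

/-! ### The unitaries of the search circuit -/

section ideal

variable {A : Type*} (f : ℕ → ℕ) (O : Oracle A)

/-- The membership queries of the bank `k`. -/
def bankU (n k : ℕ) : Unit2 (Basis A) := (levelBank n k).unitary f O

/-- The majority of the answers of the bank `k` is positive. -/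
def majSet (A : Type*) (n k : ℕ) : Set (Basis A) :=
  {b | 10 + k ≤ bitCount true b.1 (n + 2 * slotBase k) 2 (2 * (10 + k))}

/-- The first `m` qubits are not all `0`. -/
def nonzeroSet (A : Type*) (m : ℕ) : Set (Basis A) := {b | 1 ≤ bitCount true b.1 0 1 m}

/-- The unitary of `selC`. -/
def selU (n k : ℕ) : Unit2 (Basis A) :=
  ((bankU f O n k).trans (sgn (majSet A n k))).trans (bankU f O n k).symm

/-- The unitary of `difC`. -/
def difU (m : ℕ) : Unit2 (Basis A) :=
  (((hadC m).unitary f O).trans (sgn (nonzeroSet A m))).trans ((hadC m).unitary f O).symm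

/-- The unitary of `ampC`. -/
def ampU (n : ℕ) (m : ℕ → ℕ) : ℕ → Unit2 (Basis A)
  | 0 => LinearIsometryEquiv.refl ℂ _
  | k + 1 => (ampU n m k).trans ((selU f O n k).trans ((ampU n m k).symm.trans
      ((difU f O (m k)).trans (ampU n m k))))

/-- The projection selected by `selU`. -/
def selP (n k : ℕ) : L2 (Basis A) →ₗ[ℂ] L2 (Basis A) :=
  ((bankU f O n k).symm : L2 (Basis A) →ₗ[ℂ] L2 (Basis A)) ∘ₗ proj (majSet A n k) ∘ₗ
    ((bankU f O n k) : L2 (Basis A) →ₗ[ℂ] L2 (Basis A))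

/-- The projection onto the uniform superposition on the first `m` qubits. -/
def uniP (m : ℕ) : L2 (Basis A) →ₗ[ℂ] L2 (Basis A) :=
  (((hadC m).unitary f O).symm : L2 (Basis A) →ₗ[ℂ] L2 (Basis A)) ∘ₗ proj (nonzeroSet A m)ᶜ ∘ₗ
    (((hadC m).unitary f O) : L2 (Basis A) →ₗ[ℂ] L2 (Basis A))

variable {f O}

theorem selP_apply (n k : ℕ) (v : L2 (Basis A)) : selP f O n k v =
    (bankU f O n k).symm (proj (majSet A n k) (bankU f O n k v)) := rfl

theorem uniP_apply (m : ℕ) (v : L2 (Basis A)) : uniP f O m v =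
    ((hadC m).unitary f O).symm (proj (nonzeroSet A m)ᶜ ((hadC m).unitary f O v)) := rfl

theorem selU_apply (n k : ℕ) (v : L2 (Basis A)) :
    selU f O n k v = v - (2 : ℂ) • selP f O n k v := by
  change (bankU f O n k).symm (sgn (majSet A n k) (bankU f O n k v)) = _
  rw [sgn_eq, map_sub, map_smul, LinearIsometryEquiv.symm_apply_apply, selP_apply]

theorem difU_apply (m : ℕ) (v : L2 (Basis A)) :
    difU f O m v = (2 : ℂ) • uniP f O m v - v := by
  change ((hadC m).unitary f O).symm (sgn (nonzeroSet A m) ((hadC m).unitary f O v)) = _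
  set w := (hadC m).unitary f O v with hw
  have h1 : sgn (nonzeroSet A m) w = (2 : ℂ) • proj (nonzeroSet A m)ᶜ w - w := by
    have := proj_add_compl (nonzeroSet A m) w
    have h2 : proj (nonzeroSet A m) w = w - proj (nonzeroSet A m)ᶜ w := eq_sub_of_add_eq this
    rw [sgn_eq, h2]
    module
  rw [h1, map_sub, map_smul, uniP_apply, hw, LinearIsometryEquiv.symm_apply_apply]

theorem mem_nonzeroSet_compl {m : ℕ} {b : Basis A} :
    b ∈ (nonzeroSet A m)ᶜ ↔ ∀ j < m, b.1 j = false := by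
  have : b ∈ (nonzeroSet A m)ᶜ ↔ bitCount true b.1 0 1 m = 0 := by
    change ¬ (1 ≤ _) ↔ _
    omega
  rw [this, bitCount, Finset.sum_eq_zero_iff]
  simp

theorem hadC_commutes {m : ℕ} {S : Set (Basis A)} (h : ∀ j < m, IndepWire j S) :
    Commutes ((hadC m).unitary f O) S := by
  apply Circuit.commutes
  intro g hg
  obtain ⟨j, hj, rfl⟩ := List.mem_map.mp hg
  exact h j (List.mem_range.mp hj)

theorem bankU_commutes {n k : ℕ} {S : Set (Basis A)} (h : ∀ s, slotBase k ≤ s →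
    s < slotBase (k + 1) → IndepWire (n + 2 * s) S ∧ IndepSlot s S) :
    Commutes (bankU f O n k) S := by
  apply Circuit.commutes
  apply bankC_fixes
  intro s h1 h2
  exact h s h1 (by rwa [slotBase_succ])

theorem selU_commutes {n k : ℕ} {S : Set (Basis A)} (h : ∀ s, slotBase k ≤ s →
    s < slotBase (k + 1) → IndepWire (n + 2 * s) S ∧ IndepSlot s S) :
    Commutes (selU f O n k) S :=
  ((bankU_commutes h).trans commutes_sgn).trans (bankU_commutes h).symm

theorem difU_commutes {m : ℕ} {S : Set (Basis A)} (h : ∀ j < m, IndepWire j S) :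
    Commutes (difU f O m) S :=
  ((hadC_commutes h).trans commutes_sgn).trans (hadC_commutes h).symm

theorem ampU_commutes {n : ℕ} {m : ℕ → ℕ} {K : ℕ} {S : Set (Basis A)}
    (h : ∀ s < slotBase K, IndepWire (n + 2 * s) S ∧ IndepSlot s S)
    (h' : ∀ k < K, ∀ j < m k, IndepWire j S) : Commutes (ampU f O n m K) S := by
  induction K with
  | zero => exact Commutes.refl
  | succ K ih =>
    have hK : slotBase K ≤ slotBase (K + 1) := slotBase_mono (Nat.le_succ K)
    have ih := ih (fun s hs => h s (by omega)) fun k hk => h' k (by omega)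
    exact ih.trans ((selU_commutes fun s _ hs => h s hs).trans (ih.symm.trans
      ((difU_commutes (h' K (by omega))).trans ih)))

theorem indepWire_scratch {n w : ℕ} (h : ∀ a, w ≠ n + 1 + 2 * a) :
    IndepWire w (scratchSet A n) := by
  apply indepWire_wires (p := scratchZero n)
  intro x β
  refine forall_congr' fun a => ?_
  rw [Function.update_of_ne (h a).symm]

theorem indepSlot_scratch {n s : ℕ} : IndepSlot s (scratchSet A n) := fun _ _ => Iff.rfl

theorem bankU_scratch (n k : ℕ) : Commutes (bankU f O n k) (scratchSet A n) :=
  bankU_commutes fun _ _ _ => ⟨indepWire_scratch fun a => by omega, indepSlot_scratch⟩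

theorem hadC_scratch {n m : ℕ} (h : m ≤ n) :
    Commutes ((hadC m).unitary f O) (scratchSet A n) :=
  hadC_commutes fun j hj => indepWire_scratch fun a => by omega

theorem ampU_scratch {n : ℕ} {m : ℕ → ℕ} (hm : ∀ k, m k ≤ n) (K : ℕ) :
    Commutes (ampU f O n m K) (scratchSet A n) :=
  ampU_commutes (fun _ _ => ⟨indepWire_scratch fun a => by omega, indepSlot_scratch⟩)
    fun k _ j hj => indepWire_scratch fun a => by have := hm k; omega

/-- Every factor maps states with zero scratch to such states, so the circuits can be replaced one
after the other by the ideal unitaries, which ignore scratch and commute with more projections. -/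
theorem unitary_ampC {n : ℕ} {m : ℕ → ℕ} (hm : ∀ k, m k ≤ n) (K : ℕ) {v : L2 (Basis A)}
    (hv : proj (scratchSet A n) v = v) : (ampC n m K).unitary f O v = ampU f O n m K v := by
  induction K generalizing v with
  | zero => rfl
  | succ K ih =>
    have hsel : ∀ v, proj (scratchSet A n) v = v →
        (selC n K).unitary f O v = selU f O n K v := fun v hv =>
      unitary_reflectC bankC_noT (bankU_scratch n K) (fun r _ a => by omega) hv
    have hdif : ∀ v, proj (scratchSet A n) v = v →
        (difC n (m K)).unitary f O v = difU f O (m K) v := fun v hv =>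
      unitary_reflectC (hadC_noT _) (hadC_scratch (hm K))
        (fun r hr a => by have := hm K; omega) hv
    have hinv : ∀ v, proj (scratchSet A n) v = v →
        (ampC n m K).inv.unitary f O v = (ampU f O n m K).symm v := by
      intro v hv
      rw [Circuit.unitary_inv f O (ampC_noT n m K)]
      apply ((ampC n m K).unitary f O).injective
      rw [LinearIsometryEquiv.apply_symm_apply, ih ((ampU_scratch hm K).symm.proj_eq_self hv),
        LinearIsometryEquiv.apply_symm_apply]
    have hs : Commutes (selU f O n K) (scratchSet A n) :=
      selU_commutes fun _ _ _ => ⟨indepWire_scratch fun a => by omega, indepSlot_scratch⟩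
    have hd : Commutes (difU f O (m K)) (scratchSet A n) :=
      difU_commutes fun j hj => indepWire_scratch fun a => by have := hm K; omega
    have h1 := (ampU_scratch (f := f) (O := O) hm K).proj_eq_self hv
    have h2 := hs.proj_eq_self h1
    have h3 := (ampU_scratch (f := f) (O := O) hm K).symm.proj_eq_self h2
    have h4 := hd.proj_eq_self h3
    rw [ampC, Circuit.unitary_append, Circuit.unitary_append, Circuit.unitary_append,
      Circuit.unitary_append, ih hv, hsel _ h1, hinv _ h2, hdif _ h3, ih h4]
    rfl

/-! ### Hadamard gates on all index qubits -/

theorem sqrt_two_inv_sq : ((Real.sqrt 2)⁻¹) ^ 2 = 1 / 2 := by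
  rw [inv_pow, Real.sq_sqrt (by norm_num)]; norm_num

/-- The qubits `l, …, n - 1` agree with `x`. -/
def agreeSet (A : Type*) (x : ℕ → Bool) (l n : ℕ) : Set (Basis A) :=
  {b | ∀ j, l ≤ j → j < n → b.1 j = x j}

theorem indepWire_agree {x : ℕ → Bool} {l n w : ℕ} (h : w < l ∨ n ≤ w) :
    IndepWire w (agreeSet A x l n) := by
  apply indepWire_wires (p := fun y => ∀ j, l ≤ j → j < n → y j = x j)
  intro y β
  refine forall_congr' fun j => forall_congr' fun h1 => forall_congr' fun h2 => ?_
  rw [Function.update_of_ne (by omega)]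

theorem indepSlot_agree {x : ℕ → Bool} {l n s : ℕ} : IndepSlot s (agreeSet A x l n) :=
  fun _ _ => Iff.rfl

theorem hadC_agree {x : ℕ → Bool} {l m n : ℕ} (h : m ≤ l) :
    Commutes ((hadC m).unitary f O) (agreeSet A x l n) :=
  hadC_commutes fun _ hj => indepWire_agree (Or.inl (by omega))

/-- Each Hadamard gate on a fresh qubit gives either value half of the weight; prescribing `m - l`
of the qubits therefore costs a factor `(√2)⁻¹` for each. -/
theorem norm_proj_hadC (x : ℕ → Bool) {l m : ℕ} (hl : l ≤ m) {y : L2 (Basis A)}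
    (hy : proj (nonzeroSet A m)ᶜ y = y) :
    ‖proj (agreeSet A x l m) (((hadC m).unitary f O).symm y)‖ =
      (Real.sqrt 2)⁻¹ ^ (m - l) * ‖y‖ := by
  induction m, hl using Nat.le_induction generalizing y with
  | base =>
    have : agreeSet A x l l = Set.univ := by
      ext b
      simp only [agreeSet, Set.mem_ofPred_eq, Set.mem_univ, iff_true]
      intro j h1 h2
      omega
    have h1 : proj Set.univ (((hadC l).unitary f O).symm y) = ((hadC l).unitary f O).symm y := by
      rw [proj_eq_self_iff]; simp
    rw [this, h1, LinearIsometryEquiv.norm_map]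
    simp
  | succ m hl ih =>
    have hsymm : ((hadC (m + 1)).unitary f O).symm y =
        ((hadC m).unitary f O).symm (Gate.unitary f O (.H m) y) := by
      apply ((hadC (m + 1)).unitary f O).injective
      rw [LinearIsometryEquiv.apply_symm_apply, hadC_succ, Circuit.unitary_append,
        LinearIsometryEquiv.apply_symm_apply, Circuit.unitary_singleton]
      have h1 := Gate.unitary_inv f O (g := .H m) trivial
      exact ((DFunLike.congr_fun h1 _).trans ((Gate.unitary f O (.H m)).symm_apply_apply y)).symm
    have hset : agreeSet A x l (m + 1) = agreeSet A x l m ∩ {b | b.1 m = x m} := by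
      ext b
      simp only [agreeSet, Set.mem_ofPred_eq, Set.mem_inter_iff]
      constructor
      · exact fun h => ⟨fun j h1 h2 => h j h1 (by omega), h m hl (by omega)⟩
      · rintro ⟨h1, h2⟩ j h3 h4
        rcases Nat.lt_succ_iff_lt_or_eq.mp h4 with h5 | rfl
        · exact h1 j h3 h5
        · exact h2
    have hm : Commutes ((hadC m).unitary f O) {b : Basis A | b.1 m = x m} := by
      apply hadC_commutes
      intro j hj
      apply indepWire_wires (p := fun y => y m = x m)
      intro y β
      rw [Function.update_of_ne (by omega)]
    have hy' := (proj_eq_self_iff _ _).mp hy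
    have hHm : ∀ j < m, Commutes (Gate.unitary f O (.H m)) {b : Basis A | b.1 j = false} := by
      intro j hj
      apply Gate.Fixes.commutes
      apply indepWire_wires (p := fun y => y j = false)
      intro y β
      rw [Function.update_of_ne (by omega)]
    rw [hsymm, hset, ← proj_proj, ← hm.symm, ih]
    · have h1 := norm_sq_proj_H (f := f) (O := O) (w := m) (y := y) (by
        rw [proj_eq_self_iff]
        intro b hb
        exact mem_nonzeroSet_compl.mp (hy' b hb) m (by omega)) (x m)
      have h2 : ‖proj {b | b.1 m = x m} (Gate.unitary f O (.H m) y)‖ = (Real.sqrt 2)⁻¹ * ‖y‖ := by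
        rw [← sq_eq_sq₀ (norm_nonneg _) (by positivity), h1, mul_pow, sqrt_two_inv_sq]
        ring
      rw [h2, Nat.succ_sub hl, pow_succ]
      ring
    · rw [proj_eq_self_iff]
      intro b hb
      rw [mem_nonzeroSet_compl]
      intro j hj
      have h3 : proj {b : Basis A | b.1 j = false} (proj {b | b.1 m = x m}
          (Gate.unitary f O (.H m) y)) = proj {b | b.1 m = x m} (Gate.unitary f O (.H m) y) := by
        rw [proj_comm, (hHm j hj).proj_eq_self]
        rw [proj_eq_self_iff]
        intro b hb
        exact mem_nonzeroSet_compl.mp (hy' b hb) j (by omega)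
      exact (proj_eq_self_iff _ _).mp h3 b hb

/-- The uniform superposition of all indices. -/
def uniformState (f : ℕ → ℕ) (O : Oracle A) [Inhabited A] (n : ℕ) : L2 (Basis A) :=
  ((hadC n).unitary f O).symm (zeroState A)

theorem proj_zeroState [Inhabited A] {S : Set (Basis A)} (h : zeroBasis A ∈ S) :
    proj S (zeroState A) = zeroState A := by
  rw [proj_eq_self_iff]
  intro b hb
  by_cases hb' : b = zeroBasis A
  · rwa [hb']
  · simp [zeroState, hb'] at hb

/-- Hadamard gates on later qubits do not disturb the earlier ones. -/
theorem exists_tail {m n : ℕ} (h : m ≤ n) : ∃ V : Unit2 (Basis A),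
    (∀ v, (hadC n).unitary f O v = V ((hadC m).unitary f O v)) ∧
    ∀ j < m, Commutes V {b | b.1 j = false} := by
  induction n, h using Nat.le_induction with
  | base => exact ⟨LinearIsometryEquiv.refl ℂ _, fun _ => rfl, fun _ _ => Commutes.refl⟩
  | succ n hn ih =>
    obtain ⟨V, h1, h2⟩ := ih
    refine ⟨V.trans (Gate.unitary f O (.H n)), fun v => ?_, fun j hj => (h2 j hj).trans ?_⟩
    · rw [hadC_succ, Circuit.unitary_append, h1]
      rfl
    · apply Gate.Fixes.commutes
      apply indepWire_wires (p := fun y => y j = false)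
      intro y β
      rw [Function.update_of_ne (by omega)]

/-- A uniform superposition on `n` qubits is also uniform on the first `m`. Hence the start state is
fixed by all the partial diffusions, although they act on different numbers of qubits. -/
theorem uniP_uniformState [Inhabited A] {m n : ℕ} (h : m ≤ n) :
    uniP f O m (uniformState f O n) = uniformState f O n := by
  obtain ⟨V, h1, h2⟩ := exists_tail (f := f) (O := O) h
  have h3 : (hadC m).unitary f O (uniformState f O n) = V.symm (zeroState A) := by
    apply V.injective
    rw [← h1, uniformState, LinearIsometryEquiv.apply_symm_apply,
      LinearIsometryEquiv.apply_symm_apply]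
  have h4 : proj (nonzeroSet A m)ᶜ (V.symm (zeroState A)) = V.symm (zeroState A) := by
    rw [proj_eq_self_iff]
    intro b hb
    rw [mem_nonzeroSet_compl]
    intro j hj
    have := (h2 j hj).symm.proj_eq_self (v := zeroState A) (proj_zeroState rfl)
    exact (proj_eq_self_iff _ _).mp this b hb
  rw [uniP_apply, h3, h4, ← h3, LinearIsometryEquiv.symm_apply_apply]

end ideal

/-! ### Success probability of the search circuit -/

/-- Number of index qubits of the diffusion of the round `k`. -/
def levelBits (n K k : ℕ) : ℕ := min (4 * k + 5) (n - 2 * (K - 1 - k))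

theorem levelBits_mono (n K j k : ℕ) (h : j ≤ k) : levelBits n K j ≤ levelBits n K k := by
  simp only [levelBits]; omega

theorem levelBits_le (n K k : ℕ) : levelBits n K k ≤ n := by
  simp only [levelBits]; omega

section majority

variable {A : Type*} {f : ℕ → ℕ} {O : Oracle A}

/-- A bank has `2 (10 + k)` slots and a tie counts as positive, so a rejection or an acceptance in
error needs at least `10 + k` wrong answers in either case. -/
theorem majSet_compl_subset (n k : ℕ) : (majSet A n k)ᶜ ⊆
    {b | 10 + k ≤ bitCount false b.1 (n + 2 * slotBase k) 2 (2 * (10 + k))} := by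
  intro b hb
  have h1 := bitCount_add_not true b.1 (n + 2 * slotBase k) 2 (2 * (10 + k))
  have h2 : ¬ (10 + k ≤ bitCount true b.1 (n + 2 * slotBase k) 2 (2 * (10 + k))) := hb
  change 10 + k ≤ bitCount false b.1 (n + 2 * slotBase k) 2 (2 * (10 + k))
  simp only [Bool.not_true] at h1
  omega

theorem agreeSet_zero_iff {x : ℕ → Bool} {n : ℕ} {b : Basis A} :
    b ∈ agreeSet A x 0 n ↔ readNat b.1 0 n = readNat x 0 n := by
  constructor
  · intro h
    exact readNat_congr fun j hj => by simpa using h j (Nat.zero_le _) hj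
  · intro h j _ hj
    simpa using readNat_inj h j hj

theorem selP_commutes {n k : ℕ} {S : Set (Basis A)} (h : Commutes (bankU f O n k) S)
    (v : L2 (Basis A)) : proj S (selP f O n k v) = selP f O n k (proj S v) := by
  rw [selP_apply, selP_apply, ← h.symm, h, proj_comm]

theorem bankU_agree {n k l : ℕ} {x : ℕ → Bool} : Commutes (bankU f O n k) (agreeSet A x l n) :=
  bankU_commutes fun _ _ _ => ⟨indepWire_agree (Or.inr (by omega)), indepSlot_agree⟩

end majority

section search

variable {A : Type*} [Inhabited A] {f : ℕ → ℕ} {O : Oracle A}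

/-- The bound `2 ^ M * (1 / 10) ^ t` with `M = 2 t` is `(4 / 10) ^ t`. -/
theorem norm_sq_proj_wrong {n k : ℕ} {β : Bool} {φ : L2 (Basis A)}
    (hφ : proj (cleanBank A n (slotBase k) (2 * (10 + k))) φ = φ)
    (hO : ∀ b, φ b ≠ 0 → answerProb O (f (readNat b.1 0 n)) β ≤ 1 / 10) :
    ‖proj {b | 10 + k ≤ bitCount β b.1 (n + 2 * slotBase k) 2 (2 * (10 + k))}
      (bankU f O n k φ)‖ ^ 2 ≤ (2 / 5) ^ (10 + k) * ‖φ‖ ^ 2 := by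
  refine (norm_sq_proj_bank _ (10 + k) hφ hO).trans (le_of_eq ?_)
  rw [pow_mul, ← mul_pow]
  norm_num

/-- Amplitude form of the previous bound, with `2 / 5 ≤ (2 / 3) ^ 2`. -/
theorem norm_proj_wrong {n k : ℕ} {β : Bool} {φ : L2 (Basis A)}
    (hφ : proj (cleanBank A n (slotBase k) (2 * (10 + k))) φ = φ)
    (hO : ∀ b, φ b ≠ 0 → answerProb O (f (readNat b.1 0 n)) β ≤ 1 / 10) :
    ‖proj {b | 10 + k ≤ bitCount β b.1 (n + 2 * slotBase k) 2 (2 * (10 + k))}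
      (bankU f O n k φ)‖ ≤ (2 / 3) ^ (10 + k) * ‖φ‖ := by
  refine le_of_sq_le_sq ((norm_sq_proj_wrong hφ hO).trans ?_) (by positivity)
  rw [mul_pow]
  refine mul_le_mul_of_nonneg_right ?_ (sq_nonneg _)
  rw [← pow_mul, mul_comm, pow_mul]
  gcongr
  norm_num

theorem uniformState_clean {n k : ℕ} : proj (cleanBank A n (slotBase k) (2 * (10 + k)))
    (uniformState f O n) = uniformState f O n := by
  have h : Commutes ((hadC n).unitary f O) (cleanBank A n (slotBase k) (2 * (10 + k))) := by
    apply hadC_commutes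
    intro j hj b β
    refine forall_congr' fun s => forall_congr' fun h1 => forall_congr' fun h2 => ?_
    dsimp only
    rw [Function.update_of_ne (by omega)]
  exact h.symm.proj_eq_self (proj_zeroState fun s _ _ => ⟨rfl, rfl⟩)

/-- The first `k` levels use the slots below `slotBase k` only. This is why every level has its own
bank: reuse would meet the remnants of an imperfect uncomputation. -/
theorem ampU_clean {n : ℕ} {m : ℕ → ℕ} (hm : ∀ k, m k ≤ n) (k : ℕ) :
    proj (cleanBank A n (slotBase k) (2 * (10 + k))) (ampU f O n m k (uniformState f O n)) =
      ampU f O n m k (uniformState f O n) := by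
  refine Commutes.proj_eq_self ?_ uniformState_clean
  apply ampU_commutes
  · intro s hs
    constructor
    · intro b β
      refine forall_congr' fun s => forall_congr' fun h1 => forall_congr' fun h2 => ?_
      dsimp only
      rw [Function.update_of_ne (by omega)]
    · intro b z
      refine forall_congr' fun s => forall_congr' fun h1 => forall_congr' fun h2 => ?_
      dsimp only
      rw [Function.update_of_ne (by omega)]
  · intro k' _ j hj b β
    refine forall_congr' fun s => forall_congr' fun h1 => forall_congr' fun h2 => ?_
    have := hm k'
    dsimp only
    rw [Function.update_of_ne (by omega)]

/-- Here the target is the index on the bits of `x`, `R l` is the block of indices that agree with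
it from bit `l` on, `q = 1/√2`, and `ε k` is the error amplitude of the bank `k`. -/
theorem amplification (n K : ℕ) (x : ℕ → Bool)
    (hgood : answerProb O (f (readNat x 0 n)) false ≤ 1 / 10)
    (hbad : ∀ i, i ≠ readNat x 0 n → answerProb O (f i) true ≤ 1 / 10) :
    Amplification n K (levelBits n K) (fun l => agreeSet A x l n) (uniP f O) (selP f O n)
      (ampU f O n (levelBits n K)) (selU f O n) (fun k => difU f O (levelBits n K k))
      (uniformState f O n) (Real.sqrt 2)⁻¹ (fun k => (2 / 3) ^ (10 + k)) where
  mono := levelBits_mono n K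
  le k _ := levelBits_le n K k
  q_nonneg := by positivity
  subset l _ b hb j _ h := hb j (Nat.zero_le _) h
  zero _ := rfl
  succ _ _ := rfl
  diffusion _ _ := difU_apply _ _
  reflection _ _ := selU_apply _ _ _
  idem l v := by
    rw [uniP_apply, uniP_apply, LinearIsometryEquiv.apply_symm_apply, proj_proj, Set.inter_self]
  selfAdj l v w := by
    set H := (hadC l).unitary f O
    rw [uniP_apply, uniP_apply, ← LinearIsometryEquiv.inner_map_map H,
      LinearIsometryEquiv.apply_symm_apply, inner_proj_left,
      ← LinearIsometryEquiv.inner_map_map H v, LinearIsometryEquiv.apply_symm_apply]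
  norm_U l v := by
    rw [uniP_apply, LinearIsometryEquiv.norm_map]
    refine (norm_proj_le _ _).trans ?_
    rw [LinearIsometryEquiv.norm_map]
  norm_P k v := by
    rw [selP_apply, LinearIsometryEquiv.norm_map]
    refine (norm_proj_le _ _).trans ?_
    rw [LinearIsometryEquiv.norm_map]
  comm_U l l' v h := by
    have := hadC_agree (f := f) (O := O) (x := x) (n := n) h
    rw [uniP_apply, uniP_apply, ← this.symm, this, proj_comm]
  comm_W k l h := ampU_commutes
    (fun _ _ => ⟨indepWire_agree (Or.inr (by omega)), indepSlot_agree⟩)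
    fun j hj w hw => indepWire_agree (Or.inl (hw.trans_le (h j hj)))
  comm_S k l := selU_commutes fun _ _ _ =>
    ⟨indepWire_agree (Or.inr (by omega)), indepSlot_agree⟩
  uniform l l' v h hn := by
    have hc := hadC_agree (f := f) (O := O) (x := x) (n := n) (le_refl l)
    have hset : agreeSet A x l' n = agreeSet A x l' l ∩ agreeSet A x l n := by
      ext b
      constructor
      · exact fun hb => ⟨fun j h1 h2 => hb j h1 (by omega), fun j h1 h2 => hb j (by omega) h2⟩
      · rintro ⟨h1, h2⟩ j h3 h4
        by_cases hj : j < l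
        · exact h1 j h3 hj
        · exact h2 j (by omega) h4
    rw [hset, ← proj_proj, uniP_apply, ← hc.symm, proj_comm, ← hc, norm_proj_hadC x h
      (by rw [proj_proj, Set.inter_self])]
    refine mul_le_mul_of_nonneg_left ?_ (by positivity)
    refine (norm_proj_le _ _).trans ?_
    rw [LinearIsometryEquiv.norm_map]
  start l h := uniP_uniformState h
  norm_start := by
    rw [uniformState, LinearIsometryEquiv.norm_map, norm_zeroState]
  amplitude_start := by
    rw [uniformState, norm_proj_hadC x (Nat.zero_le n), norm_zeroState]
    · simp
    · exact proj_zeroState (mem_nonzeroSet_compl.mpr fun _ _ => rfl)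
  complete k _ := by
    set φ := ampU f O n (levelBits n K) k (uniformState f O n) with hφ
    have h1 : φ - selP f O n k φ =
        (bankU f O n k).symm (proj (majSet A n k)ᶜ (bankU f O n k φ)) := by
      apply (bankU f O n k).injective
      rw [map_sub, selP_apply, LinearIsometryEquiv.apply_symm_apply,
        LinearIsometryEquiv.apply_symm_apply]
      exact (eq_sub_of_add_eq' (proj_add_compl _ _)).symm
    rw [h1, ← bankU_agree.symm, LinearIsometryEquiv.norm_map, proj_comm, ← bankU_agree]
    refine (norm_proj_mono _ (majSet_compl_subset n k)).trans (norm_proj_wrong ?_ ?_)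
    · rw [proj_comm, ampU_clean (levelBits_le n K)]
    · intro b hb
      have : b ∈ agreeSet A x 0 n := by
        by_contra h
        exact hb (proj_apply_of_notMem _ _ h)
      rw [agreeSet_zero_iff.mp this]
      exact hgood
  -- Selection commutes with conditions on the index qubits, so wrong selection can be studied on
  -- the part of the block off the target, where every positive answer is an error.
  sound k _ l _ := by
    set φ := ampU f O n (levelBits n K) k (uniformState f O n) with hφ
    rw [selP_commutes bankU_agree, selP_commutes bankU_agree.compl, selP_apply,
      LinearIsometryEquiv.norm_map]
    refine (norm_proj_wrong ?_ ?_).trans ?_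
    · rw [proj_comm, proj_comm _ (agreeSet A x l n), ampU_clean (levelBits_le n K)]
    · intro b hb
      have : b ∉ agreeSet A x 0 n := by
        intro h
        exact hb (proj_apply_of_notMem _ _ (Set.notMem_compl_iff.mpr h))
      exact hbad _ fun h => this (agreeSet_zero_iff.mpr h)
    · gcongr
      exact norm_proj_le _ _

/-- The power `2 ^ (-levelBits n K j)` is at most the sum of the powers for the two terms of the
minimum. The first gives `(1/32) Σ (9/16)^j ≤ 1/14`, the second `Σ 9^j 4^(K-1-j) / 9^K ≤ 1/5`. With
the selection errors, at most `6 (2/3)^10`, the total stays below `1/2`. -/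
theorem loss_le {n K : ℕ} (h : 9 ^ K ≤ 2 ^ n) : ∑ j ∈ Finset.range K,
    (2 * (2 / 3 : ℝ) ^ (10 + j) + 4 / 3 * (9 ^ j * (Real.sqrt 2)⁻¹ ^ (2 * levelBits n K j))) ≤
      1 / 2 := by
  have h3 : 3 * K ≤ n := by
    have : (2 : ℕ) ^ (3 * K) ≤ 2 ^ n := by
      refine le_trans ?_ h
      rw [pow_mul]
      exact Nat.pow_le_pow_left (by norm_num) K
    exact (Nat.pow_le_pow_iff_right (by norm_num)).mp this
  have hR : (9 : ℝ) ^ K ≤ 2 ^ n := by exact_mod_cast h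
  have hterm : ∀ j ∈ Finset.range K,
      (2 * (2 / 3 : ℝ) ^ (10 + j) + 4 / 3 * (9 ^ j * (Real.sqrt 2)⁻¹ ^ (2 * levelBits n K j))) ≤
      2 * (2 / 3) ^ 10 * (2 / 3) ^ j + 4 / 3 * (1 / 32 * (9 / 16) ^ j +
        9 ^ j * 4 ^ (K - 1 - j) / 9 ^ K) := by
    intro j hj
    have hj := Finset.mem_range.mp hj
    rw [pow_mul, sqrt_two_inv_sq, pow_add]
    have h1 : (1 / 2 : ℝ) ^ levelBits n K j ≤
        (1 / 2) ^ (4 * j + 5) + (1 / 2) ^ (n - 2 * (K - 1 - j)) := by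
      rcases min_choice (4 * j + 5) (n - 2 * (K - 1 - j)) with h' | h' <;>
        rw [levelBits, h'] <;> simp
    have h2 : (9 : ℝ) ^ j * (1 / 2) ^ (4 * j + 5) = 1 / 32 * (9 / 16) ^ j := by
      rw [pow_add, pow_mul, ← mul_assoc, ← mul_pow]
      norm_num
      ring
    have h4 : (1 / 2 : ℝ) ^ (n - 2 * (K - 1 - j)) ≤ 4 ^ (K - 1 - j) / 9 ^ K := by
      have h5 : (2 : ℝ) ^ n = 2 ^ (n - 2 * (K - 1 - j)) * 4 ^ (K - 1 - j) := by
        have : (4 : ℝ) = 2 ^ 2 := by norm_num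
        rw [this, ← pow_mul, ← pow_add]
        congr 1
        omega
      rw [h5] at hR
      rw [one_div, inv_pow, le_div_iff₀ (by positivity), inv_mul_le_iff₀ (by positivity)]
      exact hR
    have h6 : (9 : ℝ) ^ j * (1 / 2) ^ levelBits n K j ≤
        1 / 32 * (9 / 16) ^ j + 9 ^ j * 4 ^ (K - 1 - j) / 9 ^ K := by
      calc _ ≤ (9 : ℝ) ^ j * ((1 / 2) ^ (4 * j + 5) + 4 ^ (K - 1 - j) / 9 ^ K) := by
            gcongr; linarith
        _ = _ := by rw [mul_add, h2]; ring
    linarith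
  refine (Finset.sum_le_sum hterm).trans ?_
  rw [Finset.sum_add_distrib, ← Finset.mul_sum, ← Finset.mul_sum, Finset.sum_add_distrib,
    ← Finset.mul_sum, ← Finset.sum_div]
  have g1 : ∑ j ∈ Finset.range K, (2 / 3 : ℝ) ^ j ≤ 3 := by
    rw [geom_sum_eq (by norm_num), div_le_iff_of_neg (by norm_num)]
    have : (0 : ℝ) ≤ (2 / 3) ^ K := by positivity
    linarith
  have g2 : ∑ j ∈ Finset.range K, (9 / 16 : ℝ) ^ j ≤ 16 / 7 := by
    rw [geom_sum_eq (by norm_num), div_le_iff_of_neg (by norm_num)]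
    have : (0 : ℝ) ≤ (9 / 16) ^ K := by positivity
    linarith
  have g3 : (∑ j ∈ Finset.range K, (9 : ℝ) ^ j * 4 ^ (K - 1 - j)) / 9 ^ K ≤ 1 / 5 := by
    rw [div_le_iff₀ (by positivity)]
    have := geom_sum₂_mul (9 : ℝ) 4 K
    have h4 : (0 : ℝ) ≤ 4 ^ K := by positivity
    linarith
  nlinarith

theorem searchC_apply {n K : ℕ} : Circuit.apply f O (searchC n (levelBits n K) K) (zeroState A) =
    bankU f O n K (ampU f O n (levelBits n K) K (uniformState f O n)) := by
  rw [Circuit.apply_eq, searchC, Circuit.unitary_append, Circuit.unitary_append,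
    Circuit.unitary_inv f O (hadC_noT n), unitary_ampC (levelBits_le n K)]
  · rfl
  · exact (hadC_scratch le_rfl).symm.proj_eq_self (proj_zeroState fun _ => rfl)

/-- The amplification leaves weight at least `1/8` on the target, and the verification rejects at
most one ninth of it: `(1/8)(8/9) = 1/9`. -/
theorem norm_sq_success {n K : ℕ} (h1 : 9 ^ K ≤ 2 ^ n) (h2 : 2 ^ n ≤ 2 * 9 ^ K) {i : ℕ}
    (hi : i < 2 ^ n) (hgood : answerProb O (f i) false ≤ 1 / 10)
    (hbad : ∀ j, j ≠ i → answerProb O (f j) true ≤ 1 / 10) :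
    1 / 9 ≤ ‖proj ({b | readNat b.1 0 n = i} ∩ majSet A n K)
      (Circuit.apply f O (searchC n (levelBits n K) K) (zeroState A))‖ ^ 2 := by
  obtain ⟨x, rfl⟩ := exists_readNat_eq hi
  have hset : {b : Basis A | readNat b.1 0 n = readNat x 0 n} = agreeSet A x 0 n := by
    ext b
    exact agreeSet_zero_iff.symm
  have hamp := (amplification n K x hgood hbad).le_amplitude le_rfl fun k => by positivity
  rw [hset, searchC_apply, Set.inter_comm, ← proj_proj, ← bankU_agree]
  set φ := ampU f O n (levelBits n K) K (uniformState f O n) with hφ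
  set η := proj (agreeSet A x 0 n) φ with hη
  have hloss := loss_le h1
  have hb : 1 / 2 * (3 ^ K * (Real.sqrt 2)⁻¹ ^ n) ≤ ‖η‖ := by
    refine le_trans ?_ hamp
    rw [mul_comm]
    gcongr
    linarith
  -- Half of the ideal amplitude, squared: `(1/4) 9^K / 2^n`, and the size of the search space is at
  -- most `2 * 9^K`.
  have hb2 : 1 / 8 ≤ ‖η‖ ^ 2 := by
    refine le_trans ?_ (pow_le_pow_left₀ (by positivity) hb 2)
    have e1 : (1 / 2 * (3 ^ K * (Real.sqrt 2)⁻¹ ^ n)) ^ 2 = 1 / 4 * (9 ^ K / 2 ^ n) := by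
      rw [mul_pow, mul_pow, ← pow_mul, ← pow_mul, mul_comm K, mul_comm n, pow_mul, pow_mul,
        sqrt_two_inv_sq, one_div, one_div, inv_pow 2 n]
      norm_num [div_eq_mul_inv]
    have e2 : (1 : ℝ) / 2 ≤ 9 ^ K / 2 ^ n := by
      rw [div_le_div_iff₀ (by norm_num) (by positivity)]
      have : (2 : ℝ) ^ n ≤ 2 * 9 ^ K := by exact_mod_cast h2
      linarith
    rw [e1]
    linarith
  have hsplit := norm_sq_proj_add_compl (majSet A n K) (bankU f O n K η)
  rw [LinearIsometryEquiv.norm_map] at hsplit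
  have hwrong : ‖proj (majSet A n K)ᶜ (bankU f O n K η)‖ ^ 2 ≤ (2 / 5) ^ (10 + K) * ‖η‖ ^ 2 := by
    refine (pow_le_pow_left₀ (norm_nonneg _) (norm_proj_mono _ (majSet_compl_subset n K)) 2).trans
      (norm_sq_proj_wrong ?_ ?_)
    · rw [hη, proj_comm, ampU_clean (levelBits_le n K)]
    · intro b hb
      have : b ∈ agreeSet A x 0 n := by
        by_contra h
        exact hb (proj_apply_of_notMem _ _ h)
      rw [agreeSet_zero_iff.mp this]
      exact hgood
  have hpow : (2 / 5 : ℝ) ^ (10 + K) ≤ 1 / 9 := by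
    rw [pow_add]
    have : (2 / 5 : ℝ) ^ K ≤ 1 := pow_le_one₀ (by norm_num) (by norm_num)
    have h0 : (0 : ℝ) ≤ (2 / 5) ^ K := by positivity
    nlinarith
  nlinarith [sq_nonneg ‖η‖]

/-- Independent of the quality of the search: whatever wrong index is measured, the verifying bank
was clean, and a majority of its answers would have to be wrong. -/
theorem norm_sq_false_accept {n K i : ℕ} (hbad : ∀ j, j ≠ i → answerProb O (f j) true ≤ 1 / 10) :
    ‖proj ({b | readNat b.1 0 n ≠ i} ∩ majSet A n K)
      (Circuit.apply f O (searchC n (levelBits n K) K) (zeroState A))‖ ^ 2 ≤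
      (2 / 5) ^ (10 + K) := by
  rw [searchC_apply, Set.inter_comm, ← proj_proj]
  have hc : Commutes (bankU f O n K) {b : Basis A | readNat b.1 0 n ≠ i} := by
    apply bankU_commutes
    intro s _ _
    refine ⟨?_, fun _ _ => Iff.rfl⟩
    apply indepWire_wires (p := fun y => readNat y 0 n ≠ i)
    intro y β
    rw [readNat_congr (y := y)]
    intro j hj
    rw [Function.update_of_ne (by omega)]
  rw [← hc]
  refine (norm_sq_proj_wrong (β := true) ?_ ?_).trans ?_
  · rw [proj_comm, ampU_clean (levelBits_le n K)]
  · intro b hb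
    apply hbad
    by_contra h
    exact hb (proj_apply_of_notMem _ _ (by simpa using h))
  · refine mul_le_of_le_one_right (by positivity) (pow_le_one₀ (norm_nonneg _) ?_)
    refine (norm_proj_le _ _).trans ?_
    rw [LinearIsometryEquiv.norm_map, uniformState, LinearIsometryEquiv.norm_map, norm_zeroState]

theorem eval_toOuterMeasure (C : Circuit) (T : Set (ℕ → Bool)) :
    (C.eval f O).toOuterMeasure T =
      ENNReal.ofReal (‖proj {b | b.1 ∈ T} (C.apply f O (zeroState A))‖ ^ 2) := by
  rw [Circuit.eval, PMF.toOuterMeasure_map_apply, PMF.toOuterMeasure_apply, norm_sq_eq_tsum,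
    ENNReal.ofReal_tsum_of_nonneg (fun _ => sq_nonneg _) (hasSum_sq _).summable]
  refine tsum_congr fun b => ?_
  by_cases hb : b.1 ∈ T
  · rw [Set.indicator_of_mem (by exact hb), proj_apply_of_mem _ _ (by exact hb)]
    rfl
  · rw [Set.indicator_of_notMem (by exact hb), proj_apply_of_notMem _ _ (by exact hb)]
    simp

/-- Acceptance of the outcome of a stage. -/
def Accept (n K : ℕ) (o : ℕ → Bool) : Prop :=
  10 + K ≤ bitCount true o (n + 2 * slotBase K) 2 (2 * (10 + K))

theorem eval_success {n K : ℕ} (h1 : 9 ^ K ≤ 2 ^ n) (h2 : 2 ^ n ≤ 2 * 9 ^ K) {i : ℕ}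
    (hi : i < 2 ^ n) (hgood : answerProb O (f i) false ≤ 1 / 10)
    (hbad : ∀ j, j ≠ i → answerProb O (f j) true ≤ 1 / 10) :
    ENNReal.ofReal (1 / 9) ≤ ((searchC n (levelBits n K) K).eval f O).toOuterMeasure
      {o | Accept n K o ∧ readNat o 0 n = i} := by
  rw [eval_toOuterMeasure]
  refine ENNReal.ofReal_le_ofReal ((norm_sq_success h1 h2 hi hgood hbad).trans (le_of_eq ?_))
  congr 4
  rw [Set.inter_comm]
  rfl

theorem eval_false_accept {n K i : ℕ} (hbad : ∀ j, j ≠ i → answerProb O (f j) true ≤ 1 / 10) :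
    ((searchC n (levelBits n K) K).eval f O).toOuterMeasure
      {o | Accept n K o ∧ readNat o 0 n ≠ i} ≤ ENNReal.ofReal ((2 / 5) ^ (10 + K)) := by
  rw [eval_toOuterMeasure]
  refine ENNReal.ofReal_le_ofReal (le_trans (le_of_eq ?_) (norm_sq_false_accept (n := n) hbad))
  congr 4
  rw [Set.inter_comm]
  rfl

end search

/-! ### Deterministic execution -/

/-- The effect on the memory of an instruction that only changes the memory. -/
def Instr.eff (out : ℕ → Bool) (m : ℕ → ℕ) : Instr → ℕ → ℕ
  | .const r n => Function.update m r n
  | .add r a b => Function.update m r (m a + m b)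
  | .sub r a b => Function.update m r (m a - m b)
  | .load r a => Function.update m r (m (m a))
  | .store a r => Function.update m (m a) (m r)
  | .read r a => Function.update m r (if out (m a) then 1 else 0)
  | _ => m

/-- The instruction only changes the memory. -/
def Instr.IsMem : Instr → Prop
  | .emit _ => False
  | .eval => False
  | .ret _ => False
  | _ => True

/-- The next configuration, if the next step is not an evaluation. -/
def Config.next (c : Config) : Config :=
  match c.code with
  | [] => c
  | .instr (.emit g) :: k => { c with code := k, circ := c.circ ++ [g.map c.mem] }
  | .instr .eval :: _ => c
  | .instr (.ret a) :: _ => { c with code := [], result := some (c.mem a) }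
  | .instr i :: k => { c with code := k, mem := i.eff c.outcome c.mem }
  | .seq p q :: k => { c with code := p :: q :: k }
  | .cond r p q :: k => { c with code := (if c.mem r ≠ 0 then p else q) :: k }
  | .loop r p :: k => { c with code := if c.mem r ≠ 0 then p :: .loop r p :: k else k }

/-- The next step exists and is not an evaluation. -/
def Config.IsDet (c : Config) : Prop :=
  match c.code with
  | [] => False
  | .instr .eval :: _ => False
  | _ => True

theorem Config.IsDet.step {A : Type*} [Inhabited A] (f : ℕ → ℕ) (O : Oracle A) {c : Config}
    (h : c.IsDet) : c.step f O = PMF.pure c.next := by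
  obtain ⟨code, mem, circ, outcome, result⟩ := c
  match code with
  | [] => exact h.elim
  | .instr i :: k => cases i <;> first | rfl | exact h.elim
  | .seq p q :: k => rfl
  | .cond r p q :: k => rfl
  | .loop r p :: k => rfl

theorem Config.IsDet.stepTime {c : Config} (h : c.IsDet) : c.stepTime = 1 := by
  obtain ⟨code, mem, circ, outcome, result⟩ := c
  match code with
  | [] => exact h.elim
  | .instr i :: k => cases i <;> first | rfl | exact h.elim
  | .seq p q :: k => rfl
  | .cond r p q :: k => rfl
  | .loop r p :: k => rfl

/-- Execution of `t` steps none of which is an evaluation. -/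
inductive Steps : ℕ → Config → Config → Prop
  | refl (c : Config) : Steps 0 c c
  | step {t : ℕ} {c c' : Config} (h : c.IsDet) (h' : Steps t c.next c') : Steps (t + 1) c c'

theorem Steps.trans {t t' : ℕ} {c c' c'' : Config} (h : Steps t c c') (h' : Steps t' c' c'') :
    Steps (t + t') c c'' := by
  induction h with
  | refl => rwa [zero_add]
  | step hd _ ih =>
    rw [Nat.add_right_comm]
    exact .step hd (ih h')

theorem Steps.single {c : Config} (h : c.IsDet) : Steps 1 c c.next := .step h (.refl _)

/-- The program `p` runs from the memory `m` and circuit `C` to `m'` and `C'` in `t` steps, without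
evaluations. -/
def Exec (out : ℕ → Bool) (p : Prog) (m : ℕ → ℕ) (C : Circuit) (t : ℕ) (m' : ℕ → ℕ)
    (C' : Circuit) : Prop :=
  ∀ k res, Steps t ⟨p :: k, m, C, out, res⟩ ⟨k, m', C', out, res⟩

section Exec

variable {out : ℕ → Bool} {p q : Prog} {m m' m'' : ℕ → ℕ} {C C' C'' : Circuit} {t t' : ℕ}

theorem Exec.instr {i : Instr} (h : i.IsMem) : Exec out (.instr i) m C 1 (i.eff out m) C := by
  intro k res
  cases i <;> first | exact Steps.single trivial | exact h.elim

theorem Exec.emit (g : Gate) : Exec out (.instr (.emit g)) m C 1 m (C ++ [g.map m]) :=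
  fun _ _ => Steps.single trivial

theorem Exec.seq (h : Exec out p m C t m' C') (h' : Exec out q m' C' t' m'' C'') :
    Exec out (.seq p q) m C (t + t' + 1) m'' C'' := fun k res =>
  .step trivial ((h (q :: k) res).trans (h' k res))

theorem Exec.cond_true {r : ℕ} (hr : m r ≠ 0) (h : Exec out p m C t m' C') :
    Exec out (.cond r p q) m C (t + 1) m' C' := fun k res => by
  refine .step trivial ?_
  have := h k res
  simpa [Config.next, hr] using this

theorem Exec.cond_false {r : ℕ} (hr : m r = 0) (h : Exec out q m C t m' C') :
    Exec out (.cond r p q) m C (t + 1) m' C' := fun k res => by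
  refine .step trivial ?_
  have := h k res
  simpa [Config.next, hr] using this

theorem Exec.loop_false {r : ℕ} (hr : m r = 0) : Exec out (.loop r p) m C 1 m C := fun k res => by
  refine .step trivial ?_
  have : (Config.mk (.loop r p :: k) m C out res).next = ⟨k, m, C, out, res⟩ := by
    change Config.mk (if m r ≠ 0 then _ else k) m C out res = _
    rw [if_neg (not_not_intro hr)]
  rw [this]
  exact Steps.refl _

theorem Exec.loop_true {r : ℕ} (hr : m r ≠ 0) (h : Exec out p m C t m' C')
    (h' : Exec out (.loop r p) m' C' t' m'' C'') :
    Exec out (.loop r p) m C (t + t' + 1) m'' C'' := fun k res => by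
  refine .step trivial ?_
  have := (h (.loop r p :: k) res).trans (h' k res)
  simpa [Config.next, hr] using this

/-- Straight-line code. -/
def block (i : Instr) : List Instr → Prog
  | [] => .instr i
  | j :: l => .seq (.instr i) (block j l)

/-- Each instruction costs one step, and so does each `seq` that joins two of them. -/
theorem Exec.block {i : Instr} {l : List Instr} (h : ∀ j ∈ i :: l, j.IsMem) :
    Exec out (block i l) m C (2 * l.length + 1) ((i :: l).foldl (Instr.eff out) m) C := by
  induction l generalizing i m with
  | nil => exact Exec.instr (h i List.mem_cons_self)
  | cons j l ih =>
    have := (Exec.instr (out := out) (m := m) (C := C) (h i List.mem_cons_self)).seq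
      (ih fun k hk => h k (List.mem_cons_of_mem _ hk))
    have e : 2 * (j :: l).length + 1 = 1 + (2 * l.length + 1) + 1 := by
      rw [List.length_cons]; ring
    rw [e]
    exact this

end Exec

/-! ### Abstract states

The cells `0, …, 47` are used freely.  The cells from `64` on hold a list of gates, four cells per
gate; the cell `48` holds the address of its end, and the other cells are used internally. -/

/-- The gate with the given number and parameters. -/
def decodeGate (κ p q r : ℕ) : Gate :=
  match κ with
  | 0 => .queryInv p q
  | 1 => .query p q
  | 2 => .H p
  | 3 => .X p
  | 4 => .Z p
  | 5 => .CCNOT p q r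
  | _ => .enum p q r

/-- Abstract state: free cells, list of gates, current circuit, number of steps so far. -/
structure AbsState : Type where
  /-- free cells -/
  sc : ℕ → ℕ
  /-- list of gates -/
  gs : List Gate
  /-- current circuit -/
  circ : Circuit
  /-- number of steps -/
  tm : ℕ

/-- The address of the gate number `i`. -/
def pos (i : ℕ) : ℕ := 64 + 4 * i

/-- The memory represents the abstract state. -/
structure Rep (m : ℕ → ℕ) (s : AbsState) : Prop where
  sc : ∀ c < 48, m c = s.sc c
  dst : m 48 = pos s.gs.length
  gs : ∀ i < s.gs.length, s.gs[i]? =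
    some (decodeGate (m (pos i)) (m (pos i + 1)) (m (pos i + 2)) (m (pos i + 3)))

/-- The weakest precondition of the program `p` for the postcondition `Q`. -/
def wp (out : ℕ → Bool) (p : Prog) (s : AbsState) (Q : AbsState → Prop) : Prop :=
  ∀ m, Rep m s → ∃ m' s' t, Exec out p m s.circ t m' s'.circ ∧ Rep m' s' ∧
    s'.tm = s.tm + t ∧ Q s'

/-! ### Rules for weakest preconditions -/

section wp

variable {out : ℕ → Bool} {p q : Prog} {s : AbsState} {Q Q' : AbsState → Prop}

theorem wp.mono (h : wp out p s Q) (hQ : ∀ s', Q s' → Q' s') : wp out p s Q' := fun m hm => by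
  obtain ⟨m', s', t, h1, h2, h3, h4⟩ := h m hm
  exact ⟨m', s', t, h1, h2, h3, hQ _ h4⟩

/-- The state, one step later. -/
def AbsState.tick (s : AbsState) : AbsState := { s with tm := s.tm + 1 }

theorem Rep.tick {m : ℕ → ℕ} (h : Rep m s) : Rep m s.tick := ⟨h.sc, h.dst, h.gs⟩

theorem wp_seq (h : wp out p s.tick fun s' => wp out q s' Q) : wp out (.seq p q) s Q := by
  intro m hm
  obtain ⟨m', s', t, h1, h2, h3, h4⟩ := h m hm.tick
  obtain ⟨m'', s'', t', h1', h2', h3', h4'⟩ := h4 m' h2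
  refine ⟨m'', s'', t + t' + 1, h1.seq h1', h2', ?_, h4'⟩
  rw [h3', h3]
  simp only [AbsState.tick]
  ring

theorem wp_cond {r : ℕ} (hr : r < 48) (h1 : s.sc r ≠ 0 → wp out p s.tick Q)
    (h2 : s.sc r = 0 → wp out q s.tick Q) : wp out (.cond r p q) s Q := by
  intro m hm
  by_cases h : s.sc r = 0
  · obtain ⟨m', s', t, e1, e2, e3, e4⟩ := h2 h m hm.tick
    refine ⟨m', s', t + 1, Exec.cond_false ((hm.sc r hr).trans h) e1, e2, ?_, e4⟩
    rw [e3]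
    simp only [AbsState.tick]
    ring
  · obtain ⟨m', s', t, e1, e2, e3, e4⟩ := h1 h m hm.tick
    refine ⟨m', s', t + 1, Exec.cond_true (by rwa [hm.sc r hr]) e1, e2, ?_, e4⟩
    rw [e3]
    simp only [AbsState.tick]
    ring

/-- The number `T` of iterations is known in advance, so the invariant is indexed by the iteration
and termination needs no separate argument. The time bound is part of the invariant. -/
theorem wp_loop {r : ℕ} (hr : r < 48) (I : ℕ → AbsState → Prop) (T : ℕ) (h0 : I 0 s)
    (hstep : ∀ j < T, ∀ s, I j s → s.sc r ≠ 0 ∧ wp out p s.tick (I (j + 1)))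
    (hend : ∀ s, I T s → s.sc r = 0 ∧ Q s.tick) : wp out (.loop r p) s Q := by
  induction T generalizing s I with
  | zero =>
    intro m hm
    obtain ⟨h1, h2⟩ := hend s h0
    exact ⟨m, s.tick, 1, Exec.loop_false ((hm.sc r hr).trans h1), hm.tick, rfl, h2⟩
  | succ T ih =>
    intro m hm
    obtain ⟨h1, h2⟩ := hstep 0 (Nat.succ_pos T) s h0
    obtain ⟨m', s', t, e1, e2, e3, e4⟩ := h2 m hm.tick
    obtain ⟨m'', s'', t', e1', e2', e3', e4'⟩ := ih (s := s') (fun j => I (j + 1)) e4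
      (fun j hj => hstep (j + 1) (by omega)) hend m' e2
    refine ⟨m'', s'', t + t' + 1, Exec.loop_true (by rwa [hm.sc r hr]) e1 e1', e2', ?_, e4'⟩
    rw [e3', e3]
    simp only [AbsState.tick]
    ring

/-- Since `r < 48`, neither the pointer to the end of the gate list nor the list itself is affected.
-/
theorem wp_of_update {i : Instr} (hi : i.IsMem) {r v : ℕ} (hr : r < 48)
    (he : ∀ m, Rep m s → i.eff out m = Function.update m r v)
    (h : Q { s with sc := Function.update s.sc r v, tm := s.tm + 1 }) :
    wp out (.instr i) s Q := by
  intro m hm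
  refine ⟨_, { s with sc := Function.update s.sc r v, tm := s.tm + 1 }, 1, Exec.instr hi, ?_,
    rfl, h⟩
  rw [he m hm]
  refine ⟨fun c hc => ?_, ?_, fun j hj => ?_⟩
  · by_cases h' : c = r
    · subst h'; simp
    · simp [h', hm.sc c hc]
  · rw [Function.update_of_ne (by omega)]
    exact hm.dst
  · have : 64 ≤ pos j := Nat.le_add_right _ _
    rw [Function.update_of_ne (by omega), Function.update_of_ne (by omega),
      Function.update_of_ne (by omega), Function.update_of_ne (by omega)]
    exact hm.gs j hj

theorem wp_const {r n : ℕ} (hr : r < 48)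
    (h : Q { s with sc := Function.update s.sc r n, tm := s.tm + 1 }) :
    wp out (.instr (.const r n)) s Q :=
  wp_of_update trivial hr (fun _ _ => rfl) h

theorem wp_add {r a b : ℕ} (hr : r < 48) (ha : a < 48) (hb : b < 48)
    (h : Q { s with sc := Function.update s.sc r (s.sc a + s.sc b), tm := s.tm + 1 }) :
    wp out (.instr (.add r a b)) s Q :=
  wp_of_update trivial hr (fun m hm => by rw [← hm.sc a ha, ← hm.sc b hb]; rfl) h

theorem wp_sub {r a b : ℕ} (hr : r < 48) (ha : a < 48) (hb : b < 48)
    (h : Q { s with sc := Function.update s.sc r (s.sc a - s.sc b), tm := s.tm + 1 }) :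
    wp out (.instr (.sub r a b)) s Q :=
  wp_of_update trivial hr (fun m hm => by rw [← hm.sc a ha, ← hm.sc b hb]; rfl) h

theorem wp_read {r a : ℕ} (hr : r < 48) (ha : a < 48)
    (h : Q { s with sc := Function.update s.sc r (if out (s.sc a) then 1 else 0),
                    tm := s.tm + 1 }) :
    wp out (.instr (.read r a)) s Q :=
  wp_of_update trivial hr (fun m hm => by rw [← hm.sc a ha]; rfl) h

/-- Store the address of the end of the list of gates. -/
def markP (r : ℕ) : Prog := block (.const r 0) [.add r 48 r]

theorem wp_mark {r : ℕ} (hr : r < 48)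
    (h : Q { s with sc := Function.update s.sc r (pos s.gs.length), tm := s.tm + 3 }) :
    wp out (markP r) s Q := by
  intro m hm
  refine ⟨_, { s with sc := Function.update s.sc r (pos s.gs.length), tm := s.tm + 3 }, 3,
    Exec.block (by simp [Instr.IsMem]), ?_, rfl, h⟩
  have he : [Instr.const r 0, Instr.add r 48 r].foldl (Instr.eff out) m =
      Function.update m r (pos s.gs.length) := by
    funext c
    by_cases h' : c = r
    · subst h'
      simp [Instr.eff, ← hm.dst, Function.update_of_ne (show 48 ≠ c by omega)]
    · simp [Instr.eff, h']
  rw [he]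
  refine ⟨fun c hc => ?_, ?_, fun j hj => ?_⟩
  · by_cases h' : c = r
    · subst h'; simp
    · simp [h', hm.sc c hc]
  · rw [Function.update_of_ne (by omega)]
    exact hm.dst
  · have : 64 ≤ pos j := Nat.le_add_right _ _
    rw [Function.update_of_ne (by omega), Function.update_of_ne (by omega),
      Function.update_of_ne (by omega), Function.update_of_ne (by omega)]
    exact hm.gs j hj

/-- Empty the list of gates. -/
def clearP : Prog := .instr (.const 48 64)

theorem wp_clear (h : Q { s with gs := [], tm := s.tm + 1 }) : wp out clearP s Q := by
  intro m hm
  refine ⟨_, { s with gs := [], tm := s.tm + 1 }, 1, Exec.instr trivial, ?_, rfl, h⟩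
  refine ⟨fun c hc => ?_, rfl, fun j hj => ?_⟩
  · exact (Function.update_of_ne (by omega) _ _).trans (hm.sc c hc)
  · simp at hj

/-- The working cells `49`–`63` are not part of the abstract state, so nothing is required of them.
-/
theorem Rep.append {m m' : ℕ → ℕ} (h : Rep m s) {κ x y z t : ℕ}
    (h1 : ∀ c < 48, m' c = m c) (h2 : m' 48 = pos (s.gs.length + 1))
    (h3 : ∀ c, 64 ≤ c → c < pos s.gs.length → m' c = m c)
    (ha : m' (pos s.gs.length) = κ) (hb : m' (pos s.gs.length + 1) = x)
    (hc : m' (pos s.gs.length + 2) = y) (hd : m' (pos s.gs.length + 3) = z) :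
    Rep m' { s with gs := s.gs ++ [decodeGate κ x y z], tm := t } := by
  refine ⟨fun c hc => (h1 c hc).trans (h.sc c hc), by simpa using h2, fun i hi => ?_⟩
  simp only [List.length_append, List.length_singleton] at hi
  rcases Nat.lt_succ_iff_lt_or_eq.mp hi with h' | rfl
  · rw [List.getElem?_append_left h', h.gs i h']
    have hp : ∀ d < 4, m' (pos i + d) = m (pos i + d) := by
      intro d hd
      apply h3 <;> simp only [pos] <;> omega
    rw [← hp 1 (by omega), ← hp 2 (by omega), ← hp 3 (by omega)]
    have := hp 0 (by omega)
    rw [add_zero] at this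
    rw [← this]
  · simp [ha, hb, hc, hd]

/-- The code that writes the cell `κ`, `x`, `y`, `z` to the end of the list of gates. -/
def writeCode (κ x y z : ℕ) : List Instr :=
  [.const 53 1, .add 49 48 53, .add 50 49 53, .add 51 50 53, .store 48 κ, .store 49 x, .store 50 y,
    .store 51 z, .add 48 51 53]

/-- The parameters must not lie in the cells `48`–`53`, since these receive the addresses before the
values are stored; the addresses themselves are at least `64`, so storing spoils no register. -/
theorem writeCode_eff {m : ℕ → ℕ} {κ x y z a : ℕ} (ha : m 48 = a) (h64 : 64 ≤ a)
    (hκ : κ < 48 ∨ 53 < κ ∧ κ < 64) (hx : x < 48 ∨ 53 < x ∧ x < 64)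
    (hy : y < 48 ∨ 53 < y ∧ y < 64) (hz : z < 48 ∨ 53 < z ∧ z < 64) (c : ℕ) :
    (writeCode κ x y z).foldl (Instr.eff out) m c =
      if c = a then m κ else if c = a + 1 then m x else if c = a + 2 then m y else
      if c = a + 3 then m z else if c = 48 then a + 4 else if c = 49 then a + 1 else
      if c = 50 then a + 2 else if c = 51 then a + 3 else if c = 53 then 1 else m c := by
  -- The computation is split after the address arithmetic, so that the indirect stores go to known
  -- addresses.
  obtain ⟨m₁, hm₁⟩ : ∃ m₁, m₁ = [Instr.const 53 1, .add 49 48 53, .add 50 49 53,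
      .add 51 50 53].foldl (Instr.eff out) m := ⟨_, rfl⟩
  have e : (writeCode κ x y z).foldl (Instr.eff out) m = [Instr.store 48 κ, .store 49 x,
      .store 50 y, .store 51 z, .add 48 51 53].foldl (Instr.eff out) m₁ := by rw [hm₁]; rfl
  have h1 : ∀ c, m₁ c = if c = 49 then a + 1 else if c = 50 then a + 2 else
      if c = 51 then a + 3 else if c = 53 then 1 else m c := by
    intro c
    rw [hm₁]
    simp only [List.foldl, Instr.eff, Function.update_apply]
    norm_num
    rw [ha]
    split_ifs <;> omega
  have h2 : ∀ r, r < 48 ∨ 53 < r ∧ r < 64 → m₁ r = m r := by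
    intro r hr
    rw [h1, if_neg (by omega), if_neg (by omega), if_neg (by omega), if_neg (by omega)]
  have e48 : m₁ 48 = a := by rw [h1]; simpa using ha
  have e49 : m₁ 49 = a + 1 := by rw [h1]; simp
  have e50 : m₁ 50 = a + 2 := by rw [h1]; simp
  have e51 : m₁ 51 = a + 3 := by rw [h1]; simp
  have e53 : m₁ 53 = 1 := by rw [h1]; simp
  have s1 : ∀ (u : ℕ → ℕ) d v, d < 64 → Function.update u a v d = u d := fun u d v hd =>
    Function.update_of_ne (by omega) _ _
  have s2 : ∀ (u : ℕ → ℕ) b d v, d < 64 → Function.update u (a + b) v d = u d := fun u b d v hd =>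
    Function.update_of_ne (by omega) _ _
  rw [e]
  simp only [List.foldl, Instr.eff]
  have hκ' : κ < 64 := by omega
  have hx' : x < 64 := by omega
  have hy' : y < 64 := by omega
  have hz' : z < 64 := by omega
  simp only [e48, s1 _ 49 _ (by norm_num), s1 _ 50 _ (by norm_num), s1 _ 51 _ (by norm_num),
    s1 _ 53 _ (by norm_num), s1 _ _ _ hx', s1 _ _ _ hy', s1 _ _ _ hz', e49, e50, e51, e53,
    s2 _ _ 50 _ (by norm_num), s2 _ _ 51 _ (by norm_num), s2 _ _ 53 _ (by norm_num),
    s2 _ _ _ _ hy', s2 _ _ _ _ hz', h2 _ hκ, h2 _ hx, h2 _ hy, h2 _ hz]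
  simp only [Function.update_apply, h1]
  split_ifs <;> omega

/-- Append a gate with parameters from the cells `x`, `y`, `z` to the list of gates. -/
def pushP (κ x y z : ℕ) : Prog := block (.const 54 κ) (writeCode 54 x y z)

theorem wp_push {κ x y z : ℕ} (hx : x < 48) (hy : y < 48) (hz : z < 48)
    (h : Q { s with gs := s.gs ++ [decodeGate κ (s.sc x) (s.sc y) (s.sc z)], tm := s.tm + 19 }) :
    wp out (pushP κ x y z) s Q := by
  intro m hm
  refine ⟨_, { s with gs := s.gs ++ [decodeGate κ (s.sc x) (s.sc y) (s.sc z)], tm := s.tm + 19 },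
    19, Exec.block (by simp [Instr.IsMem, writeCode]), ?_, rfl, h⟩
  set m₁ := Function.update m 54 κ with hm₁
  have hd : m₁ 48 = pos s.gs.length := (Function.update_of_ne (by norm_num) _ _).trans hm.dst
  have hlt : ∀ c ≠ 54, m₁ c = m c := fun c hc => Function.update_of_ne hc _ _
  have h64 : 64 ≤ pos s.gs.length := Nat.le_add_right _ _
  have he := writeCode_eff (out := out) (κ := 54) hd h64 (by omega) (Or.inl hx) (Or.inl hy)
    (Or.inl hz)
  have hf : (Instr.const 54 κ :: writeCode 54 x y z).foldl (Instr.eff out) m =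
      (writeCode 54 x y z).foldl (Instr.eff out) m₁ := rfl
  rw [hf]
  apply hm.append
  · intro c hc
    rw [he, if_neg (by omega), if_neg (by omega), if_neg (by omega), if_neg (by omega),
      if_neg (by omega), if_neg (by omega), if_neg (by omega), if_neg (by omega),
      if_neg (by omega), hlt c (by omega)]
  · rw [he, if_neg (by omega), if_neg (by omega), if_neg (by omega), if_neg (by omega),
      if_pos rfl, pos, pos]
    ring
  · intro c h1 h2
    rw [he, if_neg (by omega), if_neg (by omega), if_neg (by omega), if_neg (by omega),
      if_neg (by omega), if_neg (by omega), if_neg (by omega), if_neg (by omega),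
      if_neg (by omega), hlt c (by omega)]
  · rw [he, if_pos rfl, hm₁, Function.update_self]
  · rw [he, if_neg (by omega), if_pos rfl, hlt x (by omega), hm.sc x hx]
  · rw [he, if_neg (by omega), if_neg (by omega), if_pos rfl, hlt y (by omega), hm.sc y hy]
  · rw [he, if_neg (by omega), if_neg (by omega), if_neg (by omega), if_pos rfl,
      hlt z (by omega), hm.sc z hz]

/-- Load the gate at the address in the cell `a`. -/
def loadCode (a : ℕ) : List Instr :=
  [.add 55 a 53, .load 56 55, .add 55 55 53, .load 57 55, .add 55 55 53, .load 58 55, .load 54 a]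

/-- The working registers lie below the list and above the free cells, so neither the loaded gate
nor the address in `a` changes while loading. -/
theorem loadCode_eff {m : ℕ → ℕ} {a i : ℕ} (ha : a < 48) (hi : m a = pos i) (c : ℕ) :
    (Instr.const 53 1 :: loadCode a).foldl (Instr.eff out) m c =
      if c = 53 then 1 else if c = 54 then m (pos i) else if c = 55 then pos i + 3 else
      if c = 56 then m (pos i + 1) else if c = 57 then m (pos i + 2) else
      if c = 58 then m (pos i + 3) else m c := by
  have h64 : 64 ≤ pos i := Nat.le_add_right _ _
  generalize pos i = p at *
  have s1 : ∀ (u : ℕ → ℕ) d v, d < 64 → Function.update u d v p = u p := fun u d v hd =>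
    Function.update_of_ne (by omega) _ _
  have s2 : ∀ (u : ℕ → ℕ) b d v, d < 64 → Function.update u d v (p + b) = u (p + b) :=
    fun u b d v hd => Function.update_of_ne (by omega) _ _
  have s3 : ∀ (u : ℕ → ℕ) d v, 48 ≤ d → Function.update u d v a = u a := fun u d v hd =>
    Function.update_of_ne (by omega) _ _
  have s4 : ∀ (u : ℕ → ℕ) d d' v, d ≠ d' → Function.update u d v d' = u d' := fun u d d' v hd =>
    Function.update_of_ne (Ne.symm hd) _ _
  simp only [loadCode, List.foldl, Instr.eff]
  simp (disch := norm_num) only [s3, hi, Function.update_self, s4, add_assoc]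
  norm_num
  simp (disch := norm_num) only [s1, s2]
  simp only [Function.update_apply]
  split_ifs <;> first | rfl | omega

/-- The code that inverts the gate in the cells `54` and `56`–`58` and appends it to the list. -/
def copyInvP (a : ℕ) : Prog :=
  .seq (block (.const 53 1) (loadCode a))
    (.seq (.cond 54 (.seq (.instr (.sub 59 54 53))
      (.cond 59 (.instr (.const 59 0)) (.instr (.const 54 0)))) (.instr (.const 54 1)))
      (block (.const 55 0) (writeCode 54 56 57 58)))

/-- The number of the inverse of a gate. -/
def invCode : ℕ → ℕ
  | 0 => 1
  | 1 => 0
  | κ => κ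

theorem decodeGate_invCode (κ p q r : ℕ) :
    decodeGate (invCode κ) p q r = (decodeGate κ p q r).inv := by
  match κ with
  | 0 => rfl
  | 1 => rfl
  | 2 => rfl
  | 3 => rfl
  | 4 => rfl
  | 5 => rfl
  | _ + 6 => rfl

theorem wp_copyInv {a i : ℕ} {g : Gate} (ha : a < 48) (hi : s.sc a = pos i)
    (hg : s.gs[i]? = some g)
    (h : ∀ t ≤ 44, Q { s with gs := s.gs ++ [g.inv], tm := s.tm + t }) :
    wp out (copyInvP a) s Q := by
  intro m hm
  have hil : i < s.gs.length := (List.getElem?_eq_some_iff.mp hg).1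
  have hgi := hm.gs i hil
  rw [hg, Option.some_inj] at hgi
  set m₁ := (Instr.const 53 1 :: loadCode a).foldl (Instr.eff out) m with hm₁
  have h1 := loadCode_eff (out := out) (m := m) ha ((hm.sc a ha).trans hi)
  rw [← hm₁] at h1
  have hload : Exec out (block (.const 53 1) (loadCode a)) m s.circ 15 m₁ s.circ :=
    Exec.block (by simp [Instr.IsMem, loadCode])
  obtain ⟨m₂, t, ht, hinv, h54, h2⟩ : ∃ m₂ t, t ≤ 5 ∧ Exec out
      (.cond 54 (.seq (.instr (.sub 59 54 53))
      (.cond 59 (.instr (.const 59 0)) (.instr (.const 54 0)))) (.instr (.const 54 1)))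
      m₁ s.circ t m₂ s.circ ∧ m₂ 54 = invCode (m (pos i)) ∧
      ∀ c, c ≠ 54 → c ≠ 59 → m₂ c = m₁ c := by
    have e54 : m₁ 54 = m (pos i) := by rw [h1]; simp
    have e53 : m₁ 53 = 1 := by rw [h1]; simp
    -- Inversion exchanges the codes `0` and `1` of the two membership queries; all other codes
    -- stand for self-inverse gates. The write to the cell `59` merely fills a branch.
    match hκ : m (pos i) with
    | 0 =>
      refine ⟨_, _, ?_, Exec.cond_false (e54.trans hκ)
        (Exec.instr (i := .const 54 1) trivial), ?_, ?_⟩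
      · norm_num
      · simp [Instr.eff, invCode]
      · intro c hc hc'
        simp [Instr.eff, hc]
    | 1 =>
      refine ⟨_, _, ?_, Exec.cond_true (by rw [e54, hκ]; norm_num)
        ((Exec.instr (i := .sub 59 54 53) trivial).seq
        (Exec.cond_false ?_ (Exec.instr (i := .const 54 0) trivial))), ?_, ?_⟩
      · norm_num
      · simp [Instr.eff, e54, e53, hκ]
      · simp [Instr.eff, invCode]
      · intro c hc hc'
        simp [Instr.eff, hc, hc']
    | κ + 2 =>
      refine ⟨_, _, ?_, Exec.cond_true (by rw [e54, hκ]; norm_num)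
        ((Exec.instr (i := .sub 59 54 53) trivial).seq
        (Exec.cond_true ?_ (Exec.instr (i := .const 59 0) trivial))), ?_, ?_⟩
      · norm_num
      · simp [Instr.eff, e54, e53, hκ]
      · simp [Instr.eff, invCode, e54, hκ]
      · intro c hc hc'
        simp [Instr.eff, hc']
  -- The cell `55` is no longer needed; it is cleared because `block` takes a leading instruction
  -- besides a list.
  set m₃ := Function.update m₂ 55 0 with hm₃
  have h64 : 64 ≤ pos s.gs.length := Nat.le_add_right _ _
  have h3 : ∀ c, c < 48 ∨ c = 48 ∨ 64 ≤ c → m₃ c = m c := by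
    intro c hc
    rw [hm₃, Function.update_of_ne (by omega), h2 c (by omega) (by omega), h1]
    rw [if_neg (by omega), if_neg (by omega), if_neg (by omega), if_neg (by omega),
      if_neg (by omega), if_neg (by omega)]
  have he := writeCode_eff (out := out) (m := m₃) (κ := 54) (x := 56) (y := 57) (z := 58)
    ((h3 48 (by omega)).trans hm.dst) h64 (by omega) (by omega) (by omega) (by omega)
  have hwrite : Exec out (block (.const 55 0) (writeCode 54 56 57 58)) m₂ s.circ 19
      ((writeCode 54 56 57 58).foldl (Instr.eff out) m₃) s.circ :=
    Exec.block (by simp [Instr.IsMem, writeCode])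
  refine ⟨_, { s with gs := s.gs ++ [g.inv], tm := s.tm + (15 + (t + 19 + 1) + 1) }, _,
    hload.seq (hinv.seq hwrite), ?_, rfl, h (15 + (t + 19 + 1) + 1) (by omega)⟩
  rw [hgi, ← decodeGate_invCode]
  apply hm.append
  · intro c hc
    rw [he, if_neg (by omega), if_neg (by omega), if_neg (by omega), if_neg (by omega),
      if_neg (by omega), if_neg (by omega), if_neg (by omega), if_neg (by omega),
      if_neg (by omega), h3 c (by omega)]
  · rw [he, if_neg (by omega), if_neg (by omega), if_neg (by omega), if_neg (by omega),
      if_pos rfl, pos, pos]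
    ring
  · intro c h1 h2
    rw [he, if_neg (by omega), if_neg (by omega), if_neg (by omega), if_neg (by omega),
      if_neg (by omega), if_neg (by omega), if_neg (by omega), if_neg (by omega),
      if_neg (by omega), h3 c (by omega)]
  · rw [he, if_pos rfl, hm₃, Function.update_of_ne (by omega), h54]
  · rw [he, if_neg (by omega), if_pos rfl, hm₃, Function.update_of_ne (by omega),
      h2 _ (by omega) (by omega), h1]
    simp
  · rw [he, if_neg (by omega), if_neg (by omega), if_pos rfl, hm₃,
      Function.update_of_ne (by omega), h2 _ (by omega) (by omega), h1]
    simp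
  · rw [he, if_neg (by omega), if_neg (by omega), if_neg (by omega), if_pos rfl, hm₃,
      Function.update_of_ne (by omega), h2 _ (by omega) (by omega), h1]
    simp

/-- Emit the gate of the list whose number is in the cell `54`, or the gate `d` if the list is too
short. -/
def dispatch (d : Gate) : List Gate → Prog
  | [] => .instr (.emit d)
  | g :: l => .cond 54 (.seq (.instr (.sub 54 54 53)) (dispatch d l)) (.instr (.emit g))

/-- The kind of an emitted gate is fixed in the program text, so the numeric code in the cell `54`
is counted down through a chain of tests. The hypothesis `hl` says that no candidate gate uses that
cell for a parameter. -/
theorem exec_dispatch {d : Gate} {l : List Gate}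
    (hl : ∀ g ∈ d :: l, ∀ m v, g.map (Function.update m 54 v) = g.map m) {m : ℕ → ℕ} {C : Circuit}
    (h53 : m 53 = 1) : ∃ m' t, t ≤ 3 * l.length + 2 ∧
      Exec out (dispatch d l) m C t m' (C ++ [((l[m 54]?).getD d).map m]) ∧
      ∀ c ≠ 54, m' c = m c := by
  induction l generalizing m with
  | nil => exact ⟨m, 1, by simp, Exec.emit d, fun _ _ => rfl⟩
  | cons g l ih =>
    cases hκ : m 54 with
    | zero =>
      refine ⟨m, 2, by simp, ?_, fun _ _ => rfl⟩
      exact Exec.cond_false hκ (Exec.emit g)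
    | succ κ =>
      have h1 : Exec out (.instr (.sub 54 54 53)) m C 1 (Function.update m 54 κ) C := by
        have := Exec.instr (out := out) (m := m) (C := C) (i := .sub 54 54 53) trivial
        simpa [Instr.eff, hκ, h53] using this
      obtain ⟨m', t, ht, he, hm'⟩ := ih (fun g hg => hl g (by
        rcases List.mem_cons.mp hg with rfl | hg
        · exact List.mem_cons_self
        · exact List.mem_cons_of_mem _ (List.mem_cons_of_mem _ hg)))
        (m := Function.update m 54 κ) (by simp [h53])
      refine ⟨m', 1 + t + 1 + 1, ?_, Exec.cond_true (by omega) (h1.seq ?_), fun c hc => ?_⟩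
      · simp only [List.length_cons]; omega
      · have e1 : (((g :: l)[κ + 1]?).getD d).map m =
            ((l[(Function.update m 54 κ) 54]?).getD d).map (Function.update m 54 κ) := by
          rw [hl, Function.update_self, List.getElem?_cons_succ]
          cases h : l[(Function.update m 54 κ) 54]? with
          | none => exact List.mem_cons_self
          | some g' =>
            exact List.mem_cons_of_mem _ (List.mem_cons_of_mem _ (List.mem_of_getElem? h))
        rw [e1]
        exact he
      · rw [hm' c hc, Function.update_of_ne hc]

/-- Emit the gate at the address in the cell `a`. -/
def emitAtP (a : ℕ) : Prog :=
  .seq (block (.const 53 1) (loadCode a))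
    (dispatch (.enum 56 57 58) [.queryInv 56 57, .query 56 57, .H 56, .X 56, .Z 56, .CCNOT 56 57 58])

theorem wp_emitAt {a i : ℕ} {g : Gate} (ha : a < 48) (hi : s.sc a = pos i)
    (hg : s.gs[i]? = some g)
    (h : ∀ t ≤ 36, Q { s with circ := s.circ ++ [g], tm := s.tm + t }) :
    wp out (emitAtP a) s Q := by
  intro m hm
  have hil : i < s.gs.length := (List.getElem?_eq_some_iff.mp hg).1
  have hgi := hm.gs i hil
  rw [hg, Option.some_inj] at hgi
  set m₁ := (Instr.const 53 1 :: loadCode a).foldl (Instr.eff out) m with hm₁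
  have h1 := loadCode_eff (out := out) (m := m) ha ((hm.sc a ha).trans hi)
  rw [← hm₁] at h1
  have hload : Exec out (block (.const 53 1) (loadCode a)) m s.circ 15 m₁ s.circ :=
    Exec.block (by simp [Instr.IsMem, loadCode])
  obtain ⟨m₂, t, ht, he, h2⟩ := exec_dispatch (out := out) (d := .enum 56 57 58)
    (l := [.queryInv 56 57, .query 56 57, .H 56, .X 56, .Z 56, .CCNOT 56 57 58])
    (by simp [Gate.map]) (m := m₁) (C := s.circ) (by rw [h1]; simp)
  have e54 : m₁ 54 = m (pos i) := by rw [h1]; simp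
  have e56 : m₁ 56 = m (pos i + 1) := by rw [h1]; simp
  have e57 : m₁ 57 = m (pos i + 2) := by rw [h1]; simp
  have e58 : m₁ 58 = m (pos i + 3) := by rw [h1]; simp
  have hgate : g = ((([.queryInv 56 57, .query 56 57, .H 56, .X 56, .Z 56,
      .CCNOT 56 57 58] : List Gate)[m₁ 54]?).getD (.enum 56 57 58)).map m₁ := by
    rw [hgi, ← e54, ← e56, ← e57, ← e58]
    match m₁ 54 with
    | 0 => rfl
    | 1 => rfl
    | 2 => rfl
    | 3 => rfl
    | 4 => rfl
    | 5 => rfl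
    | _ + 6 => rfl
  refine ⟨m₂, { s with circ := s.circ ++ [g], tm := s.tm + (15 + t + 1) }, _, hload.seq ?_, ?_, rfl,
    h _ ?_⟩
  · exact hgate ▸ he
  · have h3 : ∀ c, c ≤ 48 ∨ 64 ≤ c → m₂ c = m c := by
      intro c hc
      rw [h2 c (by omega), h1]
      rw [if_neg (by omega), if_neg (by omega), if_neg (by omega), if_neg (by omega),
        if_neg (by omega), if_neg (by omega)]
    refine ⟨fun c hc => (h3 c (by omega)).trans (hm.sc c hc), (h3 48 (by omega)).trans hm.dst,
      fun j hj => ?_⟩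
    have : 64 ≤ pos j := Nat.le_add_right _ _
    rw [h3 _ (by omega), h3 _ (by omega), h3 _ (by omega), h3 _ (by omega)]
    exact hm.gs j hj
  · simp only [List.length_cons, List.length_nil] at ht
    omega

end wp

/-! ### Routines -/

/-- The instruction works on free cells and changes only cells from `lim` on. -/
def Instr.IsFree (lim : ℕ) : Instr → Prop
  | .const r _ => lim ≤ r ∧ r < 48
  | .add r a b => (lim ≤ r ∧ r < 48) ∧ a < 48 ∧ b < 48
  | .sub r a b => (lim ≤ r ∧ r < 48) ∧ a < 48 ∧ b < 48
  | .read r a => (lim ≤ r ∧ r < 48) ∧ a < 48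
  | _ => False

theorem Instr.IsFree.eff_of_lt {lim : ℕ} {i : Instr} (h : i.IsFree lim) (out : ℕ → Bool)
    (m : ℕ → ℕ) {c : ℕ} (hc : c < lim) : i.eff out m c = m c := by
  cases i with
  | const r n => exact Function.update_of_ne (by have := h.1; omega) _ _
  | add r a b => exact Function.update_of_ne (by have := h.1.1; omega) _ _
  | sub r a b => exact Function.update_of_ne (by have := h.1.1; omega) _ _
  | read r a => exact Function.update_of_ne (by have := h.1.1; omega) _ _
  | _ => exact h.elim

theorem foldl_eff_of_lt {lim : ℕ} {l : List Instr} (h : ∀ i ∈ l, i.IsFree lim) (out : ℕ → Bool)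
    (m : ℕ → ℕ) {c : ℕ} (hc : c < lim) : l.foldl (Instr.eff out) m c = m c := by
  induction l generalizing m with
  | nil => rfl
  | cons i l ih =>
    rw [List.foldl_cons, ih fun j hj => h j (List.mem_cons_of_mem _ hj)]
    exact (h i List.mem_cons_self).eff_of_lt out m hc

/-- `s'` arises from `s` by appending `G` to the list of gates and changing cells from `lim` on, in
at most `T` steps. -/
structure Ext (lim : ℕ) (s : AbsState) (G : List Gate) (T : ℕ) (s' : AbsState) : Prop where
  sc : ∀ c < lim, s'.sc c = s.sc c
  gs : s'.gs = s.gs ++ G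
  circ : s'.circ = s.circ
  tm : s'.tm ≤ s.tm + T

theorem Ext.tick (lim : ℕ) (s : AbsState) : Ext lim s [] 1 s.tick :=
  ⟨fun _ _ => rfl, (List.append_nil _).symm, rfl, le_rfl⟩

theorem Ext.mono {lim lim' T T' : ℕ} {s s' : AbsState} {G : List Gate} (h : Ext lim s G T s')
    (hl : lim' ≤ lim) (hT : T ≤ T') : Ext lim' s G T' s' :=
  ⟨fun c hc => h.sc c (by omega), h.gs, h.circ, h.tm.trans (by omega)⟩

theorem Ext.trans {lim lim' T T' : ℕ} {s s' s'' : AbsState} {G G' : List Gate}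
    (h : Ext lim s G T s') (h' : Ext lim' s' G' T' s'') (hl : lim ≤ lim') :
    Ext lim s (G ++ G') (T + T') s'' :=
  ⟨fun c hc => (h'.sc c (by omega)).trans (h.sc c hc),
    by rw [h'.gs, h.gs, List.append_assoc], h'.circ.trans h.circ, by
      have := h.tm
      have := h'.tm
      omega⟩

section wp

variable {out : ℕ → Bool} {p q : Prog} {s : AbsState} {Q : AbsState → Prop}

theorem wp_free {i : Instr} {lim : ℕ} (hi : i.IsFree lim)
    (h : Q { s with sc := i.eff out s.sc, tm := s.tm + 1 }) : wp out (.instr i) s Q := by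
  cases i with
  | const r n => exact wp_const hi.2 h
  | add r a b => exact wp_add hi.1.2 hi.2.1 hi.2.2 h
  | sub r a b => exact wp_sub hi.1.2 hi.2.1 hi.2.2 h
  | read r a => exact wp_read hi.1.2 hi.2 h
  | _ => exact hi.elim

theorem wp_block {lim : ℕ} {i : Instr} {l : List Instr} (hi : ∀ j ∈ i :: l, j.IsFree lim)
    (h : ∀ s', Ext lim s [] (2 * l.length + 1) s' →
      s'.sc = (i :: l).foldl (Instr.eff out) s.sc → Q s') : wp out (block i l) s Q := by
  suffices H : Q { s with sc := (i :: l).foldl (Instr.eff out) s.sc,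
                          tm := s.tm + (2 * l.length + 1) } → wp out (block i l) s Q from
    H (h _ ⟨fun c hc => foldl_eff_of_lt hi out _ hc, (List.append_nil _).symm, rfl, le_rfl⟩ rfl)
  clear h
  intro h
  induction l generalizing i s with
  | nil => exact wp_free (hi i List.mem_cons_self) h
  | cons j l ih =>
    refine wp_seq (wp_free (hi i List.mem_cons_self) ?_)
    refine ih (fun k hk => hi k (List.mem_cons_of_mem _ hk)) ?_
    have e : s.tm + 1 + 1 + (2 * l.length + 1) = s.tm + (2 * (j :: l).length + 1) := by
      rw [List.length_cons]; ring
    change Q ⟨_, _, _, s.tm + 1 + 1 + (2 * l.length + 1)⟩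
    rw [e]
    exact h

theorem wp_push_ext {κ x y z : ℕ} (hx : x < 48) (hy : y < 48) (hz : z < 48)
    (h : ∀ s', Ext 48 s [decodeGate κ (s.sc x) (s.sc y) (s.sc z)] 19 s' → s'.sc = s.sc → Q s') :
    wp out (pushP κ x y z) s Q :=
  wp_push hx hy hz (h _ ⟨fun _ _ => rfl, rfl, rfl, le_rfl⟩ rfl)

theorem wp_mark_ext {r lim : ℕ} (hr : r < 48) (hlim : lim ≤ r)
    (h : ∀ s', Ext lim s [] 3 s' → s'.sc r = pos s.gs.length → (∀ c ≠ r, s'.sc c = s.sc c) → Q s') :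
    wp out (markP r) s Q :=
  wp_mark hr (h _ ⟨fun _ _ => Function.update_of_ne (by omega) _ _, (List.append_nil _).symm,
    rfl, le_rfl⟩ (Function.update_self ..) fun _ hc => Function.update_of_ne hc _ _)

/-- Run `body` as often as the number in the cell `mc` says; `lim` is the counter. -/
def forP (lim mc : ℕ) (body : Prog) : Prog :=
  .seq (block (.const lim 0) [.const (lim + 1) 1, .sub (lim + 2) mc lim])
    (.loop (lim + 2) (.seq body (block (.add lim lim (lim + 1)) [.sub (lim + 2) mc lim])))

/-- Per iteration `5` steps are overhead: the loop test, the `seq`, and the update of the counter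
and of the remaining number; the initialization and the last test take `7`. By `hI` the invariant
may only depend on cells below `lim`, the gate list and the circuit. -/
theorem wp_for {lim mc M : ℕ} {body : Prog} (hlim : lim + 2 < 48) (hmc : mc < lim) {T : ℕ → ℕ}
    (I : ℕ → AbsState → Prop)
    (hI : ∀ j s s', I j s → (∀ c < lim, s'.sc c = s.sc c) → s'.gs = s.gs → s'.circ = s.circ →
      I j s')
    (hM : ∀ j s, I j s → s.sc mc = M) (h0 : I 0 s)
    (hbody : ∀ j < M, ∀ s, I j s → s.sc lim = j → s.sc (lim + 1) = 1 →
      wp out body s fun s' => I (j + 1) s' ∧ s'.sc lim = j ∧ s'.sc (lim + 1) = 1 ∧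
        s'.tm ≤ s.tm + T j)
    (hQ : ∀ s', I M s' → s'.tm ≤ s.tm + (∑ j ∈ Finset.range M, (T j + 5) + 7) → Q s') :
    wp out (forP lim mc body) s Q := by
  refine wp_seq (wp_block (lim := lim) (by simp [Instr.IsFree]; omega) fun s₁ h1 e1 => ?_)
  refine wp_loop hlim (fun j s' => I j s' ∧ s'.sc lim = j ∧ s'.sc (lim + 1) = 1 ∧
    s'.sc (lim + 2) = M - j ∧ s'.tm ≤ s.tm + (∑ i ∈ Finset.range j, (T i + 5) + 6)) M ?_ ?_ ?_
  · have hI0 : I 0 s₁ := hI 0 s s₁ h0 h1.sc (by simpa [AbsState.tick] using h1.gs) h1.circ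
    refine ⟨hI0, ?_, ?_, ?_, ?_⟩
    · simp [e1, Instr.eff]
    · simp [e1, Instr.eff]
    · have := hM 0 s h0
      simp [e1, Instr.eff, Function.update_of_ne (show mc ≠ lim by omega),
        Function.update_of_ne (show mc ≠ lim + 1 by omega), AbsState.tick, this]
    · have := h1.tm
      simp only [AbsState.tick, List.length_cons, List.length_nil] at this
      simp only [Finset.range_zero, Finset.sum_empty]
      omega
  · rintro j hj s' ⟨i1, i2, i3, i4, i5⟩
    refine ⟨by omega, wp_seq ((hbody j hj s'.tick.tick (hI j s' _ i1 (fun _ _ => rfl) rfl rfl)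
      i2 i3).mono ?_)⟩
    rintro s₂ ⟨j1, j2, j3, j4⟩
    refine wp_block (lim := lim) (by simp [Instr.IsFree]; omega) fun s₃ h3 e3 => ?_
    have hI3 : I (j + 1) s₃ := hI _ s₂ s₃ j1 h3.sc (by simpa using h3.gs) h3.circ
    refine ⟨hI3, ?_, ?_, ?_, ?_⟩
    · simp [e3, Instr.eff, j2, j3]
    · simp [e3, Instr.eff, j3]
    · have := hM _ s₂ j1
      simp [e3, Instr.eff, Function.update_of_ne (show mc ≠ lim by omega), j2, j3, this]
    · have := h3.tm
      simp only [AbsState.tick, List.length_cons, List.length_nil] at this j4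
      rw [Finset.sum_range_succ]
      omega
  · rintro s' ⟨i1, i2, i3, i4, i5⟩
    refine ⟨by omega, hQ _ (hI M s' _ i1 (fun _ _ => rfl) rfl rfl) ?_⟩
    simp only [AbsState.tick]
    omega

/-- The case of a body that appends the gates `G j`: the loop appends the concatenation, which
matches the `flatMap` form of the circuits. -/
theorem wp_for_ext {lim mc M : ℕ} {body : Prog} (hlim : lim + 2 < 48) (hmc : mc < lim) {T : ℕ}
    {G : ℕ → List Gate} (hM : s.sc mc = M)
    (hbody : ∀ j < M, ∀ s', (∀ c < lim, s'.sc c = s.sc c) → s'.sc lim = j → s'.sc (lim + 1) = 1 →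
      wp out body s' (Ext (lim + 2) s' (G j) T))
    (hQ : ∀ s', Ext lim s ((List.range M).flatMap G) (M * (T + 5) + 7) s' → Q s') :
    wp out (forP lim mc body) s Q := by
  refine wp_for (M := M) hlim hmc (T := fun _ => T) (fun j s' => (∀ c < lim, s'.sc c = s.sc c) ∧
    s'.gs = s.gs ++ (List.range j).flatMap G ∧ s'.circ = s.circ) ?_ ?_ ?_ ?_ ?_
  · rintro j s s' ⟨h1, h2, h3⟩ e1 e2 e3
    exact ⟨fun c hc => (e1 c hc).trans (h1 c hc), e2.trans h2, e3.trans h3⟩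
  · rintro j s' ⟨h1, h2, h3⟩
    exact (h1 _ hmc).trans hM
  · exact ⟨fun _ _ => rfl, by simp, rfl⟩
  · rintro j hj s' ⟨h1, h2, h3⟩ e1 e2
    refine (hbody j hj s' h1 e1 e2).mono fun s'' h => ?_
    refine ⟨⟨fun c hc => (h.sc c (by omega)).trans (h1 c hc), ?_, h.circ.trans h3⟩,
      (h.sc _ (by omega)).trans e1, (h.sc _ (by omega)).trans e2, h.tm⟩
    rw [h.gs, h2, List.range_succ, List.flatMap_append, List.append_assoc]
    simp
  · rintro s' ⟨h1, h2, h3⟩ ht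
    refine hQ s' ⟨h1, h2, h3, ?_⟩
    simpa using ht

/-- Append Hadamard gates. -/
def hadP : Prog := forP 25 18 (pushP 2 25 25 25)

theorem wp_had {m : ℕ} (hm : s.sc 18 = m)
    (hQ : ∀ s', Ext 25 s (hadC m) (24 * m + 7) s' → Q s') : wp out hadP s Q := by
  refine wp_for_ext (by norm_num) (by norm_num) (T := 19) (G := fun j => [.H j]) hm ?_ ?_
  · intro j hj s' _ h1 _
    refine wp_push_ext (by norm_num) (by norm_num) (by norm_num) fun s'' h _ => ?_
    rw [h1] at h
    exact h.mono (by norm_num) le_rfl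
  · intro s' h
    have e : (List.range m).flatMap (fun j => [Gate.H j]) = hadC m := by
      rw [hadC, List.map_eq_flatMap]
    rw [e] at h
    exact hQ s' (h.mono le_rfl (by omega))

/-- Append the gates that fill a bank of slots. -/
def bankP : Prog := forP 25 18
  (.seq (block (.add 28 9 25) [.add 29 28 28, .add 29 29 2, .const 30 0])
    (.seq (pushP 6 30 2 28) (pushP 1 29 28 30)))

theorem wp_bank {n s₀ M : ℕ} (hn : s.sc 2 = n) (hs : s.sc 9 = s₀) (hM : s.sc 18 = M)
    (hQ : ∀ s', Ext 25 s (bankC n s₀ M) (52 * M + 7) s' → Q s') : wp out bankP s Q := by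
  refine wp_for_ext (by norm_num) (by norm_num) (T := 47)
    (G := fun j => [.enum 0 n (s₀ + j), .query (n + 2 * (s₀ + j)) (s₀ + j)]) hM ?_ ?_
  · intro j hj s' h h1 _
    refine wp_seq (wp_block (lim := 28) (by simp [Instr.IsFree]) fun s₁ h1' e1 => ?_)
    have d1 : s₁.sc 28 = s₀ + j := by
      simp [e1, Instr.eff, AbsState.tick, h 9 (by norm_num), hs, h1]
    have d2 : s₁.sc 29 = n + 2 * (s₀ + j) := by
      simp [e1, Instr.eff, AbsState.tick, h 9 (by norm_num), h 2 (by norm_num), hs, h1, hn]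
      ring
    have d3 : s₁.sc 30 = 0 := by simp [e1, Instr.eff]
    have d4 : s₁.sc 2 = n := by
      rw [h1'.sc 2 (by norm_num)]
      exact (h 2 (by norm_num)).trans hn
    refine wp_seq (wp_push_ext (by norm_num) (by norm_num) (by norm_num) fun s₂ h2 e2 => ?_)
    refine wp_push_ext (by norm_num) (by norm_num) (by norm_num) fun s₃ h3 e3 => ?_
    have := (((((Ext.tick 27 s').trans h1' (by norm_num)).trans (Ext.tick 27 _) le_rfl).trans h2
      (by norm_num)).trans h3 (by norm_num)).mono (lim' := 27) (T' := 47) le_rfl (by norm_num)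
    simp only [AbsState.tick, e2, d1, d2, d3, d4] at this
    exact this
  · intro s' h
    exact hQ s' (h.mono le_rfl (by omega))

/-- Append the gates that compare the number of ones on the wires `w + d * i` with a threshold. -/
def thrP : Prog :=
  .seq (block (.const 22 1) [.add 23 18 22, .sub 24 23 21])
    (.seq (forP 25 24 (.seq (block (.add 28 21 25) [.add 28 28 28, .add 28 28 2, .add 28 28 26])
        (pushP 3 28 28 28)))
      (.seq (block (.add 22 23 23) [.const 23 0, .add 23 23 19, .const 24 1, .add 24 24 2])
        (forP 25 18 (.seq (forP 28 18
          (.seq (block (.add 31 28 28) [.add 31 31 24, .add 32 31 22, .add 33 31 26, .add 33 33 26])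
            (.seq (pushP 5 31 31 32) (.seq (pushP 5 23 31 32) (pushP 5 23 33 32)))))
          (block (.add 23 23 20) [.add 24 24 22])))))

theorem wp_thr {n w d M t : ℕ} (hn : s.sc 2 = n) (hM : s.sc 18 = M) (hw : s.sc 19 = w)
    (hd : s.sc 20 = d) (ht : s.sc 21 = t)
    (hQ : ∀ s', Ext 22 s (thrC n w d M t) (100 * (M + 1) ^ 2) s' → s'.sc 24 = thrFlag n M → Q s') :
    wp out thrP s Q := by
  refine wp_seq (wp_block (lim := 22) (by simp [Instr.IsFree]) fun s₁ h1 e1 => ?_)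
  have a1 : s₁.sc 24 = M + 1 - t := by simp [e1, Instr.eff, AbsState.tick, hM, ht]
  have a2 : s₁.sc 23 = M + 1 := by simp [e1, Instr.eff, AbsState.tick, hM]
  have c1 : ∀ c < 22, s₁.sc c = s.sc c := h1.sc
  refine wp_seq (wp_for_ext (T := 27) (G := fun j => [.X (n + 1 + 2 * (t + j))]) (by norm_num)
    (by norm_num) a1 ?_ fun s₂ h2 => ?_)
  · intro j hj s' h h1 h1'
    refine wp_seq (wp_block (lim := 28) (by simp [Instr.IsFree]) fun s₁' k1 e1 => ?_)
    have d1 : s₁'.sc 28 = n + 1 + 2 * (t + j) := by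
      simp [e1, Instr.eff, AbsState.tick, h 21 (by norm_num), h 2 (by norm_num),
        c1 21 (by norm_num), c1 2 (by norm_num), hn, ht, h1, h1']
      ring
    refine wp_push_ext (by norm_num) (by norm_num) (by norm_num) fun s₂ h2 e2 => ?_
    have := ((((Ext.tick 27 s').trans k1 (by norm_num)).trans h2 (by norm_num))).mono (lim' := 27)
      (T' := 27) le_rfl (by norm_num)
    simp only [d1] at this
    exact this
  have b2 : s₂.sc 23 = M + 1 := (h2.sc 23 (by norm_num)).trans a2
  have c2 : ∀ c < 22, s₂.sc c = s.sc c := fun c hc => (h2.sc c (by omega)).trans (c1 c hc)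
  refine wp_seq (wp_block (lim := 22) (by simp [Instr.IsFree]) fun s₃ h3 e3 => ?_)
  have c3 : ∀ c < 22, s₃.sc c = s.sc c := fun c hc => (h3.sc c hc).trans (c2 c hc)
  have f1 : s₃.sc 22 = 2 * (M + 1) := by simp [e3, Instr.eff, AbsState.tick, b2]; ring
  have f2 : s₃.sc 23 = w := by simp [e3, Instr.eff, AbsState.tick, c2 19 (by norm_num), hw]
  have f3 : s₃.sc 24 = n + 1 := by
    simp [e3, Instr.eff, AbsState.tick, c2 2 (by norm_num), hn]; ring
  -- The cell `23` runs through the input qubits and the cell `24` through the first qubits of the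
  -- rows. After the last row the cell `24` points to the output qubit of the threshold circuit.
  refine wp_for (M := M) (T := fun _ => M * 80 + 12) (by norm_num) (by norm_num)
    (fun j s' => (∀ c < 23, s'.sc c = s₃.sc c) ∧ s'.sc 23 = w + d * j ∧
      s'.sc 24 = n + 1 + 2 * (j * (M + 1)) ∧ s'.gs = s₃.gs ++ thrRows n w d M j ∧
      s'.circ = s₃.circ) ?_ ?_ ?_ ?_ ?_
  · rintro j s s' ⟨h1, h2, h3, h4, h5⟩ e1 e2 e3
    exact ⟨fun c hc => (e1 c (by omega)).trans (h1 c hc), (e1 _ (by norm_num)).trans h2,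
      (e1 _ (by norm_num)).trans h3, e2.trans h4, e3.trans h5⟩
  · rintro j s' ⟨h1, -⟩
    exact (h1 _ (by norm_num)).trans ((c3 _ (by norm_num)).trans hM)
  · exact ⟨fun _ _ => rfl, by simpa using f2, by simpa using f3, by simp [thrRows], rfl⟩
  · rintro j hj s' ⟨i1, i2, i3, i4, i5⟩ l1 l2
    refine wp_seq (wp_for_ext (T := 75) (M := M)
      (G := fun j' => selectC (w + d * j) (n + 1 + 2 * (j * (M + 1)) + 2 * j') (2 * (M + 1)))
      (by norm_num) (by norm_num) ((i1 _ (by norm_num)).trans ((c3 _ (by norm_num)).trans hM))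
      ?_ fun s₄ h4 => ?_)
    · intro j' _ s₅ g1 g2 g3
      have g22 : s₅.sc 22 = 2 * (M + 1) := by
        rw [g1 _ (by norm_num)]; exact (i1 _ (by norm_num)).trans f1
      have g23 : s₅.sc 23 = w + d * j := by rw [g1 _ (by norm_num)]; exact i2
      have g24 : s₅.sc 24 = n + 1 + 2 * (j * (M + 1)) := by rw [g1 _ (by norm_num)]; exact i3
      have g26 : s₅.sc 26 = 1 := by rw [g1 _ (by norm_num)]; exact l2
      refine wp_seq (wp_block (lim := 31) (by simp [Instr.IsFree]) fun s₆ h6 e6 => ?_)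
      have d1 : s₆.sc 31 = n + 1 + 2 * (j * (M + 1)) + 2 * j' := by
        simp [e6, Instr.eff, AbsState.tick, g2, g24]; ring
      have d2 : s₆.sc 32 = n + 1 + 2 * (j * (M + 1)) + 2 * j' + 2 * (M + 1) := by
        simp [e6, Instr.eff, AbsState.tick, g2, g24, g22]; ring
      have d3 : s₆.sc 33 = n + 1 + 2 * (j * (M + 1)) + 2 * j' + 2 := by
        simp [e6, Instr.eff, AbsState.tick, g2, g24, g26]; ring
      have d4 : s₆.sc 23 = w + d * j := (h6.sc _ (by norm_num)).trans g23
      refine wp_seq (wp_push_ext (by norm_num) (by norm_num) (by norm_num) fun s₇ h7 e7 => ?_)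
      refine wp_seq (wp_push_ext (by norm_num) (by norm_num) (by norm_num) fun s₈ h8 e8 => ?_)
      refine wp_push_ext (by norm_num) (by norm_num) (by norm_num) fun s₉ h9 e9 => ?_
      have := (((((((Ext.tick 30 s₅).trans h6 (by norm_num)).trans (Ext.tick 30 _) le_rfl).trans h7
        (by norm_num)).trans (Ext.tick 30 _) le_rfl).trans h8 (by norm_num)).trans h9
        (by norm_num)).mono (lim' := 30) (T' := 75) le_rfl (by norm_num)
      simp only [AbsState.tick, e8, e7, d1, d2, d3, d4] at this
      exact this
    · refine wp_block (lim := 23) (by simp [Instr.IsFree]) fun s₅ h5 e5 => ?_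
      have k1 : ∀ c < 28, s₄.sc c = s'.sc c := h4.sc
      have k20 : s₄.sc 20 = d := by
        rw [k1 _ (by norm_num), i1 _ (by norm_num), c3 _ (by norm_num), hd]
      have k22 : s₄.sc 22 = 2 * (M + 1) := by
        rw [k1 _ (by norm_num), i1 _ (by norm_num), f1]
      refine ⟨⟨fun c hc => ?_, ?_, ?_, ?_, ?_⟩, ?_, ?_, ?_⟩
      · rw [h5.sc c hc, k1 c (by omega), i1 c hc]
      · simp [e5, Instr.eff, k20, k1 23 (by norm_num), i2]; ring
      · simp [e5, Instr.eff, k22, k1 24 (by norm_num), i3]; ring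
      · rw [h5.gs, h4.gs]
        simp only [AbsState.tick, i4]
        simp only [thrRows, List.range_succ, List.flatMap_append, List.append_assoc,
          List.append_nil, List.flatMap_cons, List.flatMap_nil]
        rfl
      · rw [h5.circ, h4.circ]; exact i5
      · simp [e5, Instr.eff, k1 25 (by norm_num), l1]
      · simp [e5, Instr.eff, k1 26 (by norm_num), l2]
      · have u1 := h5.tm
        have u2 := h4.tm
        simp only [AbsState.tick, List.length_cons, List.length_nil] at u1 u2
        omega
  · rintro s' ⟨i1, i2, i3, i4, i5⟩ ht'
    refine hQ s' ⟨fun c hc => ?_, ?_, ?_, ?_⟩ i3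
    · rw [i1 c (by omega), c3 c hc]
    · rw [i4, h3.gs]
      simp only [AbsState.tick, h2.gs, h1.gs, thrC, thrInit, List.append_nil, List.append_assoc]
      rw [List.map_eq_flatMap]
    · rw [i5, h3.circ]
      exact h2.circ.trans h1.circ
    · have u1 := h1.tm
      have u2 := h2.tm
      have u3 := h3.tm
      simp only [AbsState.tick, List.length_cons, List.length_nil] at u1 u2 u3
      simp only [Finset.sum_const, Finset.card_range, smul_eq_mul] at ht'
      have u4 : (M + 1 - t) * (27 + 5) ≤ (M + 1) * (27 + 5) := Nat.mul_le_mul_right _ (by omega)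
      have : s'.tm ≤ s.tm + (M * (M * 80 + 12 + 5) + 7 + (M + 1) * (27 + 5) + 30) := by omega
      nlinarith

/-- Append the inverse of the gates between two marks. -/
def mirrorP (a b : ℕ) : Prog :=
  .seq (block (.const 44 0) [.add 44 44 b, .const 46 4, .sub 45 44 a])
    (.loop 45 (.seq (.instr (.sub 44 44 46)) (.seq (copyInvP 44) (.instr (.sub 45 44 a)))))

/-- The segment is read from its end to its beginning, which reverses the order. The list grows
meanwhile, but only behind everything already there, so the addresses within `S` stay valid. The
gates `Y` after the segment are left out. -/
theorem wp_mirror {a b : ℕ} (ha : a < 44) (hb : b < 44) {X S Y : List Gate}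
    (hgs : s.gs = X ++ S ++ Y) (hX : s.sc a = pos X.length) (hS : s.sc b = pos (X ++ S).length)
    (hQ : ∀ s', Ext 44 s (Circuit.inv S) (50 * S.length + 10) s' → Q s') :
    wp out (mirrorP a b) s Q := by
  refine wp_seq (wp_block (lim := 44) (by simp [Instr.IsFree]; omega) fun s₁ h1 e1 => ?_)
  have a44 : s₁.sc 44 = pos (X.length + S.length) := by
    simp [e1, Instr.eff, AbsState.tick, Function.update_of_ne (show b ≠ 44 by omega), hS]
  have a46 : s₁.sc 46 = 4 := by simp [e1, Instr.eff]
  have a45 : s₁.sc 45 = pos (X.length + S.length) - pos X.length := by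
    simp [e1, Instr.eff, AbsState.tick, Function.update_of_ne (show b ≠ 44 by omega), hS,
      Function.update_of_ne (show a ≠ 44 by omega), Function.update_of_ne (show a ≠ 46 by omega),
      hX]
  refine wp_loop (by norm_num) (fun j s' => (∀ c < 44, s'.sc c = s.sc c) ∧
    s'.sc 44 = pos (X.length + (S.length - j)) ∧ s'.sc 46 = 4 ∧
    s'.sc 45 = pos (X.length + (S.length - j)) - pos X.length ∧
    s'.gs = s.gs ++ Circuit.inv (S.drop (S.length - j)) ∧ s'.circ = s.circ ∧
    s'.tm ≤ s.tm + 8 + 50 * j) S.length ?_ ?_ ?_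
  · refine ⟨h1.sc, a44, a46, a45, ?_, h1.circ, ?_⟩
    · rw [h1.gs]
      simp [AbsState.tick, Circuit.inv]
    · have := h1.tm
      simp only [AbsState.tick, List.length_cons, List.length_nil] at this
      omega
  · rintro j hj s' ⟨i1, i2, i3, i4, i5, i6, i7⟩
    refine ⟨?_, ?_⟩
    · rw [i4]
      simp only [pos]
      omega
    have hlt : S.length - (j + 1) < S.length := by omega
    have e' : S.length - j = S.length - (j + 1) + 1 := by omega
    refine wp_seq (wp_free (lim := 44) (by simp [Instr.IsFree]) ?_)
    refine wp_seq (wp_copyInv (i := X.length + (S.length - (j + 1))) (g := S[S.length - (j + 1)])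
      (by norm_num) ?_ ?_ fun t ht => ?_)
    · simp [Instr.eff, AbsState.tick, i2, i3, e', pos]
      omega
    · simp only [AbsState.tick, i5, hgs]
      rw [List.append_assoc, List.append_assoc, List.getElem?_append_right (by omega),
        List.getElem?_append_left (by omega), Nat.add_sub_cancel_left]
      exact List.getElem?_eq_getElem hlt
    refine wp_free (lim := 44) (by simp [Instr.IsFree]; omega) ?_
    have hsub : pos (X.length + (S.length - j)) - 4 = pos (X.length + (S.length - (j + 1))) := by
      simp only [pos]; omega
    refine ⟨fun c hc => ?_, ?_, ?_, ?_, ?_, i6, ?_⟩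
    · simp only [Instr.eff, AbsState.tick]
      rw [Function.update_of_ne (by omega), Function.update_of_ne (by omega), i1 c hc]
    · simp [Instr.eff, AbsState.tick, i2, i3, hsub]
    · simp [Instr.eff, AbsState.tick, i3]
    · simp [Instr.eff, AbsState.tick, i2, i3, hsub, Function.update_of_ne (show a ≠ 44 by omega),
        i1 a ha, hX]
    · simp only [AbsState.tick, i5, List.append_assoc]
      congr 1
      rw [List.drop_eq_getElem_cons hlt, ← e']
      simp [Circuit.inv]
    · simp only [AbsState.tick]
      omega
  · rintro s' ⟨i1, i2, i3, i4, i5, i6, i7⟩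
    refine ⟨by rw [i4]; simp, hQ _ ⟨i1, ?_, i6, ?_⟩⟩
    · simpa [AbsState.tick] using i5
    · simp only [AbsState.tick]
      omega

/-- Emit the gates from a mark on. -/
def emitP (a : ℕ) : Prog :=
  .seq (markP 45) (.seq (block (.const 44 0) [.add 44 44 a, .const 46 4, .sub 47 45 44])
    (.loop 47 (.seq (emitAtP 44) (block (.add 44 44 46) [.sub 47 45 44]))))

/-- Emission does not change the gate list, so its end can be marked once and compared with the
moving address. -/
theorem wp_emit {a : ℕ} (ha : a < 44) {X S : List Gate} (hgs : s.gs = X ++ S)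
    (hX : s.sc a = pos X.length)
    (hQ : ∀ s', (∀ c < 44, s'.sc c = s.sc c) → s'.circ = s.circ ++ S →
      s'.tm ≤ s.tm + 50 * S.length + 20 → Q s') :
    wp out (emitP a) s Q := by
  refine wp_seq (wp_mark_ext (lim := 44) (by norm_num) (by norm_num) fun s₀ h0 e0 _ => ?_)
  simp only [AbsState.tick] at e0
  refine wp_seq (wp_block (lim := 44) (by simp [Instr.IsFree]; omega) fun s₁ h1 e1 => ?_)
  have a0 : s₀.sc a = pos X.length := (h0.sc a ha).trans hX
  have a44 : s₁.sc 44 = pos X.length := by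
    simp [e1, Instr.eff, AbsState.tick, Function.update_of_ne (show a ≠ 44 by omega), a0]
  have a45 : s₁.sc 45 = pos (X.length + S.length) := by
    simp [e1, Instr.eff, AbsState.tick, e0, hgs]
  have a46 : s₁.sc 46 = 4 := by simp [e1, Instr.eff]
  have a47 : s₁.sc 47 = pos (X.length + S.length) - pos X.length := by
    simp [e1, Instr.eff, AbsState.tick, Function.update_of_ne (show a ≠ 44 by omega), e0, hgs, a0]
  have b1 := h0.gs
  have b2 := h1.gs
  simp only [AbsState.tick, List.append_nil] at b1 b2
  refine wp_loop (by norm_num) (fun j s' => (∀ c < 44, s'.sc c = s.sc c) ∧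
    s'.sc 44 = pos (X.length + j) ∧ s'.sc 46 = 4 ∧ s'.sc 45 = pos (X.length + S.length) ∧
    s'.sc 47 = pos (X.length + S.length) - pos (X.length + j) ∧
    s'.gs = s.gs ∧ s'.circ = s.circ ++ S.take j ∧
    s'.tm ≤ s.tm + 18 + 50 * j) S.length ?_ ?_ ?_
  · refine ⟨fun c hc => (h1.sc c hc).trans (h0.sc c hc), a44, a46, a45, a47, b2.trans b1, ?_, ?_⟩
    · simpa [AbsState.tick] using h1.circ.trans h0.circ
    · have := h1.tm
      have := h0.tm
      simp only [AbsState.tick, List.length_cons, List.length_nil] at *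
      omega
  · rintro j hj s' ⟨i1, i2, i3, i4, i5, i6, i7, i8⟩
    refine ⟨?_, ?_⟩
    · rw [i5]
      simp only [pos]
      omega
    refine wp_seq (wp_emitAt (i := X.length + j) (g := S[j]) (by norm_num) i2 ?_ fun t ht => ?_)
    · simp only [AbsState.tick, i6, hgs]
      rw [List.getElem?_append_right (by omega), Nat.add_sub_cancel_left]
      exact List.getElem?_eq_getElem hj
    refine wp_block (lim := 44) (by simp [Instr.IsFree]) fun s₂ h2 e2 => ?_
    have hadd : pos (X.length + j) + 4 = pos (X.length + (j + 1)) := by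
      simp only [pos]; omega
    refine ⟨fun c hc => (h2.sc c hc).trans (i1 c hc), ?_, ?_, ?_, ?_, ?_, ?_, ?_⟩
    · simp [e2, Instr.eff, AbsState.tick, i2, i3, hadd]
    · simp [e2, Instr.eff, AbsState.tick, i3]
    · simp [e2, Instr.eff, AbsState.tick, i4]
    · simp [e2, Instr.eff, AbsState.tick, i2, i3, i4, hadd]
    · rw [h2.gs]
      simpa [AbsState.tick] using i6
    · rw [h2.circ]
      simp only [AbsState.tick, i7, List.append_assoc, List.take_add_one,
        List.getElem?_eq_getElem hj]
      rfl
    · have := h2.tm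
      simp only [AbsState.tick, List.length_cons, List.length_nil] at this
      omega
  · rintro s' ⟨i1, i2, i3, i4, i5, i6, i7, i8⟩
    refine ⟨by rw [i5]; simp, hQ _ i1 (by simpa [AbsState.tick] using i7) ?_⟩
    simp only [AbsState.tick]
    omega

end wp

/-! ### Sizes of the circuits -/

theorem length_hadC (m : ℕ) : (hadC m).length = m := by simp [hadC]

theorem length_bankC (n s₀ M : ℕ) : (bankC n s₀ M).length = 2 * M := by
  simp [bankC, List.length_flatMap, mul_comm]

theorem length_thrC (n w d M t : ℕ) : (thrC n w d M t).length ≤ 4 * (M + 1) ^ 2 := by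
  have h : (thrRows n w d M M).length = M * (M * 3) := by
    simp [thrRows, thrRow, selectC, List.length_flatMap]
  rw [thrC, List.length_append, h, thrInit, List.length_map, List.length_range]
  have : M + 1 - t ≤ M + 1 := Nat.sub_le _ _
  nlinarith

theorem length_reflectC (B : Circuit) (n w d M t : ℕ) :
    (reflectC B n w d M t).length ≤ 2 * B.length + 9 * (M + 1) ^ 2 := by
  have := length_thrC n w d M t
  have h : 0 < (M + 1) ^ 2 := by positivity
  simp only [reflectC, List.length_append, List.length_cons, Circuit.length_inv]
  omega

/-- The cost of a level is of order `(k + 11) ^ 2`; it is replaced by an exponential with base less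
than `3`, which the recursion absorbs. -/
theorem sq_le_two_pow (k : ℕ) : (k + 11) ^ 2 ≤ 121 * 2 ^ k := by
  induction k with
  | zero => norm_num
  | succ k ih =>
    have h : (k + 1 + 11) ^ 2 ≤ 2 * (k + 11) ^ 2 := by
      have := Nat.zero_le (k ^ 2)
      ring_nf
      linarith
    rw [pow_succ 2]
    omega

theorem two_pow_le_three_pow (k : ℕ) : 2 ^ k ≤ 3 ^ k := Nat.pow_le_pow_left (by norm_num) k

/-- The recursion is `L (k + 1) ≤ 3 L k + O((k + 11) ^ 2)`. The added term is small because both the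
bank and the diffusion have size linear in `k`, not in `n`; so no logarithmic factor appears. -/
theorem length_ampC {n : ℕ} {m : ℕ → ℕ} (hm : ∀ k, m k ≤ 4 * k + 5) (k : ℕ) :
    (ampC n m k).length ≤ 40000 * 3 ^ k := by
  -- Strengthened induction hypothesis: tripling the deficit `40000 * 2 ^ k` leaves, beyond the new
  -- deficit, a reserve of `40000 * 2 ^ k` that pays for the two reflections.
  suffices (ampC n m k).length + 40000 * 2 ^ k ≤ 40000 * 3 ^ k by omega
  induction k with
  | zero => simp [ampC]
  | succ k ih =>
    have h1 := length_reflectC (levelBank n k) n (n + 2 * slotBase k) 2 (2 * (10 + k)) (10 + k)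
    have h2 := length_reflectC (hadC (m k)) n 0 1 (m k) 1
    rw [levelBank, length_bankC] at h1
    rw [length_hadC] at h2
    have h3 : m k + 1 ≤ 4 * (k + 11) := by have := hm k; omega
    have h4 : (m k + 1) ^ 2 ≤ (4 * (k + 11)) ^ 2 := Nat.pow_le_pow_left h3 2
    have h5 := sq_le_two_pow k
    simp only [ampC, selC, difC, levelBank, List.length_append, Circuit.length_inv, pow_succ 2 k,
      pow_succ 3 k]
    nlinarith

theorem length_searchC {n K : ℕ} {m : ℕ → ℕ} (hm : ∀ k, m k ≤ 4 * k + 5) (hn : n ≤ 4 * K + 1) :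
    (searchC n m K).length ≤ 41000 * 3 ^ K := by
  have h1 := length_ampC (n := n) hm K
  have h2 : K < 3 ^ K := Nat.lt_pow_self (by norm_num)
  simp only [searchC, levelBank, List.length_append, Circuit.length_inv, length_hadC,
    length_bankC]
  omega

/-! ### The program that builds the circuits -/

/-- Append `reflectC`, where the bank begins at the mark `a`. -/
def reflectP (a : ℕ) : Prog :=
  .seq thrP (.seq (markP 22) (.seq (pushP 4 24 24 24) (mirrorP a 22)))

/-- Append `selC`. -/
def selectP : Prog :=
  .seq (markP 15) (.seq (block (.add 18 10 10) []) (.seq bankP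
    (.seq (block (.add 19 9 9) [.add 19 19 2, .const 20 2, .const 21 0, .add 21 21 10])
      (reflectP 15))))

/-- Append `difC`. -/
def diffuseP : Prog :=
  .seq (markP 17) (.seq (block (.sub 18 8 11) [.sub 18 8 18]) (.seq hadP
    (.seq (block (.const 19 0) [.const 20 1, .const 21 1]) (reflectP 17))))

/-- Extend `ampC` by one level. -/
def levelP : Prog :=
  .seq selectP (.seq (markP 16) (.seq (mirrorP 7 15) (.seq diffuseP (.seq (mirrorP 16 17)
    (block (.const 18 4) [.add 8 8 18, .const 18 2, .add 11 11 18, .add 9 9 10, .add 9 9 10,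
      .add 10 10 13])))))

section wp

variable {out : ℕ → Bool} {s : AbsState} {Q : AbsState → Prop}

/-- The bank or the Hadamard gates `B` are already in the list from the mark `a` on. After the
threshold circuit and the phase gate `Z`, everything from `a` up to just before `Z` is mirrored. -/
theorem wp_reflect {n w d M t a : ℕ} (ha : a < 22) (hn : s.sc 2 = n) (hM : s.sc 18 = M)
    (hw : s.sc 19 = w) (hd : s.sc 20 = d) (ht : s.sc 21 = t) {X B : List Gate}
    (hgs : s.gs = X ++ B) (hX : s.sc a = pos X.length)
    (hQ : ∀ s', Ext 22 s (thrC n w d M t ++ .Z (thrFlag n M) :: Circuit.inv (B ++ thrC n w d M t))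
      (50 * B.length + 350 * (M + 1) ^ 2) s' → Q s') :
    wp out (reflectP a) s Q := by
  have hlen := length_thrC n w d M t
  refine wp_seq (wp_thr (s := s.tick) hn hM hw hd ht fun s₁ h1 e1 => ?_)
  refine wp_seq (wp_mark_ext (lim := 22) (by norm_num) le_rfl fun s₂ h2 e2 f2 => ?_)
  refine wp_seq (wp_push_ext (by norm_num) (by norm_num) (by norm_num) fun s₃ h3 e3 => ?_)
  have g24 : s₂.sc 24 = thrFlag n M := (f2 24 (by norm_num)).trans e1
  have g1 : s₁.gs = X ++ B ++ thrC n w d M t := by rw [h1.gs]; simp [AbsState.tick, hgs]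
  have g3 : s₃.gs = X ++ (B ++ thrC n w d M t) ++ [.Z (thrFlag n M)] := by
    rw [h3.gs, AbsState.tick, h2.gs]
    simp [AbsState.tick, g1, g24, decodeGate]
  have g22 : s₃.sc 22 = pos (X ++ (B ++ thrC n w d M t)).length := by
    rw [e3, ← List.append_assoc, ← g1]
    exact e2
  have ga : s₃.sc a = pos X.length := by
    rw [e3]
    exact (f2 a (by omega)).trans ((h1.sc a ha).trans hX)
  refine wp_mirror (by omega) (by norm_num) g3 ga g22 fun s₄ h4 => hQ s₄ ?_
  have := ((((((Ext.tick 22 s).trans h1 le_rfl).trans (Ext.tick 22 _) le_rfl).trans h2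
    le_rfl).trans (Ext.tick 22 _) le_rfl).trans h3 (by norm_num)).trans h4 (by norm_num)
  refine ⟨this.sc, ?_, this.circ, ?_⟩
  · rw [this.gs]
    simp [AbsState.tick, g24, decodeGate]
  · have := this.tm
    rw [List.length_append] at this
    nlinarith

theorem wp_select {n k : ℕ} (hn : s.sc 2 = n) (hs : s.sc 9 = slotBase k) (ht : s.sc 10 = 10 + k)
    (hQ : ∀ s', Ext 15 s (selC n k) (550 * (2 * (10 + k) + 1) ^ 2) s' →
      s'.sc 15 = pos s.gs.length → Q s') :
    wp out selectP s Q := by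
  refine wp_seq (wp_mark_ext (lim := 15) (by norm_num) le_rfl fun s₁ h1 e1 _ => ?_)
  refine wp_seq (wp_block (lim := 18) (by simp [Instr.IsFree]) fun s₂ h2 e2 => ?_)
  have a1 := ((Ext.tick 15 s).trans h1 le_rfl)
  have a2 := (a1.trans (Ext.tick 15 _) le_rfl).trans h2 (by norm_num)
  have d2 : s₂.sc 18 = 2 * (10 + k) := by
    have : s₁.sc 10 = 10 + k := (a1.sc 10 (by norm_num)).trans ht
    simp [e2, Instr.eff, AbsState.tick, this]
    ring
  refine wp_seq (wp_bank (s := s₂.tick) ((a2.sc 2 (by norm_num)).trans hn)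
    ((a2.sc 9 (by norm_num)).trans hs) d2 fun s₃ h3 => ?_)
  have a3 := (a2.trans (Ext.tick 15 _) le_rfl).trans h3 (by norm_num)
  refine wp_seq (wp_block (lim := 19) (by simp [Instr.IsFree]) fun s₄ h4 e4 => ?_)
  have a4 := (a3.trans (Ext.tick 15 _) le_rfl).trans h4 (by norm_num)
  have c15 : s₄.sc 15 = pos s.gs.length := by
    rw [h4.sc 15 (by norm_num)]
    refine (h3.sc 15 (by norm_num)).trans ((h2.sc 15 (by norm_num)).trans e1)
  refine wp_reflect (n := n) (w := n + 2 * slotBase k) (d := 2) (M := 2 * (10 + k)) (t := 10 + k)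
    (X := s.gs) (B := levelBank n k)
    (by norm_num) ((a4.sc 2 (by norm_num)).trans hn) ?_ ?_ ?_ ?_ ?_ c15 fun s₅ h5 => ?_
  · rw [h4.sc 18 (by norm_num)]
    exact (h3.sc 18 (by norm_num)).trans d2
  · simp [e4, Instr.eff, AbsState.tick, a3.sc 9 (by norm_num), a3.sc 2 (by norm_num), hn, hs]
    ring
  · simp [e4, Instr.eff]
  · simp [e4, Instr.eff, AbsState.tick, a3.sc 10 (by norm_num), ht]
  · rw [a4.gs]
    simp [levelBank]
  · have a5 := a4.trans h5 (by norm_num)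
    refine hQ s₅ ⟨a5.sc, ?_, a5.circ, ?_⟩ ((h5.sc 15 (by norm_num)).trans c15)
    · rw [a5.gs]
      simp [selC, reflectC, levelBank]
    · have := a5.tm
      rw [levelBank, length_bankC] at this
      simp only [List.length_cons, List.length_nil] at this
      nlinarith

theorem wp_diffuse {n x y m : ℕ} (hn : s.sc 2 = n) (hx : s.sc 8 = x) (hy : s.sc 11 = y)
    (hm : m = min x y)
    (hQ : ∀ s', Ext 17 s (difC n m) (550 * (m + 1) ^ 2) s' →
      s'.sc 17 = pos s.gs.length → Q s') :
    wp out diffuseP s Q := by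
  refine wp_seq (wp_mark_ext (lim := 17) (by norm_num) le_rfl fun s₁ h1 e1 _ => ?_)
  refine wp_seq (wp_block (lim := 18) (by simp [Instr.IsFree]) fun s₂ h2 e2 => ?_)
  have a1 := ((Ext.tick 17 s).trans h1 le_rfl)
  have a2 := (a1.trans (Ext.tick 17 _) le_rfl).trans h2 (by norm_num)
  have d2 : s₂.sc 18 = m := by
    simp [e2, Instr.eff, AbsState.tick, a1.sc 8 (by norm_num), a1.sc 11 (by norm_num), hx, hy]
    omega
  refine wp_seq (wp_had (s := s₂.tick) d2 fun s₃ h3 => ?_)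
  have a3 := (a2.trans (Ext.tick 17 _) le_rfl).trans h3 (by norm_num)
  refine wp_seq (wp_block (lim := 19) (by simp [Instr.IsFree]) fun s₄ h4 e4 => ?_)
  have a4 := (a3.trans (Ext.tick 17 _) le_rfl).trans h4 (by norm_num)
  have c17 : s₄.sc 17 = pos s.gs.length := by
    rw [h4.sc 17 (by norm_num)]
    refine (h3.sc 17 (by norm_num)).trans ((h2.sc 17 (by norm_num)).trans e1)
  refine wp_reflect (n := n) (w := 0) (d := 1) (M := m) (t := 1) (X := s.gs) (B := hadC m)
    (by norm_num) ((a4.sc 2 (by norm_num)).trans hn) ?_ ?_ ?_ ?_ ?_ c17 fun s₅ h5 => ?_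
  · rw [h4.sc 18 (by norm_num)]
    exact (h3.sc 18 (by norm_num)).trans d2
  · simp [e4, Instr.eff]
  · simp [e4, Instr.eff]
  · simp [e4, Instr.eff]
  · rw [a4.gs]
    simp
  · have a5 := a4.trans h5 (by norm_num)
    refine hQ s₅ ⟨a5.sc, ?_, a5.circ, ?_⟩ ((h5.sc 17 (by norm_num)).trans c17)
    · rw [a5.gs]
      simp [difC, reflectC]
    · have := a5.tm
      rw [length_hadC] at this
      simp only [List.length_cons, List.length_nil] at this
      nlinarith

/-- Two of the three occurrences of the previous level are obtained by copying: first its inverse,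
then the inverse of that inverse. So the time is proportional to the length of the circuit. -/
theorem wp_level {n k y : ℕ} {m : ℕ → ℕ} {X : List Gate} (hn : s.sc 2 = n)
    (h7 : s.sc 7 = pos X.length) (h8 : s.sc 8 = 4 * k + 5) (h9 : s.sc 9 = slotBase k)
    (h10 : s.sc 10 = 10 + k) (h11 : s.sc 11 = y) (h13 : s.sc 13 = 1)
    (hm : ∀ k, m k ≤ 4 * k + 5) (hk : m k = min (4 * k + 5) y) (hgs : s.gs = X ++ ampC n m k)
    (hQ : ∀ s', (∀ c < 15, c < 8 ∨ 11 < c → s'.sc c = s.sc c) → s'.sc 8 = 4 * (k + 1) + 5 →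
      s'.sc 9 = slotBase (k + 1) → s'.sc 10 = 10 + (k + 1) → s'.sc 11 = y + 2 →
      s'.gs = X ++ ampC n m (k + 1) → s'.circ = s.circ → s'.tm ≤ s.tm + 10 ^ 7 * 3 ^ k → Q s') :
    wp out levelP s Q := by
  refine wp_seq (wp_select (s := s.tick) hn h9 h10 fun s₁ k1 e1 => ?_)
  have a1 := (Ext.tick 15 s).trans k1 le_rfl
  refine wp_seq (wp_mark_ext (lim := 16) (by norm_num) le_rfl fun s₂ k2 e2 _ => ?_)
  have a2 := (a1.trans (Ext.tick 15 _) le_rfl).trans k2 (by norm_num)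
  have g2 : s₂.gs = X ++ ampC n m k ++ selC n k := by rw [a2.gs]; simp [hgs]
  refine wp_seq (wp_mirror (s := s₂.tick) (by norm_num) (by norm_num) g2
    ((a2.sc 7 (by norm_num)).trans h7) ?_ fun s₃ k3 => ?_)
  · rw [← hgs]
    exact (k2.sc 15 (by norm_num)).trans e1
  have a3 := (a2.trans (Ext.tick 15 _) le_rfl).trans k3 (by norm_num)
  refine wp_seq (wp_diffuse (s := s₃.tick) (m := m k) ((a3.sc 2 (by norm_num)).trans hn)
    ((a3.sc 8 (by norm_num)).trans h8) ((a3.sc 11 (by norm_num)).trans h11) hk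
    fun s₄ k4 e4 => ?_)
  have a4 := (a3.trans (Ext.tick 15 _) le_rfl).trans k4 (by norm_num)
  have g4 : s₄.gs = (X ++ ampC n m k ++ selC n k) ++ (ampC n m k).inv ++ difC n (m k) := by
    rw [a4.gs]; simp [hgs]
  -- The segment between the marks `16` and `17` is the inverse of the previous level; mirroring it
  -- restores the level itself.
  refine wp_seq (wp_mirror (s := s₄.tick) (by norm_num) (by norm_num) g4 ?_ ?_ fun s₅ k5 => ?_)
  · rw [← g2]
    refine (k4.sc 16 (by norm_num)).trans ((k3.sc 16 (by norm_num)).trans ?_)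
    rw [AbsState.tick, e2, k2.gs]
    simp
  · refine e4.trans ?_
    rw [AbsState.tick, a3.gs]
    simp [hgs]
  have a5 := (a4.trans (Ext.tick 15 _) le_rfl).trans k5 (by norm_num)
  refine wp_block (lim := 8) (by simp [Instr.IsFree]) fun s₆ k6 e6 => ?_
  refine hQ s₆ ?_ ?_ ?_ ?_ ?_ ?_ (k6.circ.trans a5.circ) ?_
  · intro c hc hc'
    rw [e6]
    simp only [List.foldl, Instr.eff]
    repeat rw [Function.update_of_ne (by omega)]
    exact a5.sc c hc
  · simp [e6, Instr.eff, a5.sc 8 (by norm_num), h8]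
    ring
  · simp [e6, Instr.eff, a5.sc 9 (by norm_num), a5.sc 10 (by norm_num), h9, h10]
    rw [slotBase_succ]
    ring
  · simp [e6, Instr.eff, a5.sc 10 (by norm_num), a5.sc 13 (by norm_num), h10, h13]
    ring
  · simp [e6, Instr.eff, a5.sc 11 (by norm_num), h11]
  · rw [k6.gs]
    simp only [a5.gs, hgs, ampC, Circuit.inv_inv]
    simp
  · have u5 := a5.tm
    have u6 := k6.tm
    have hA := length_ampC (n := n) hm k
    have h4 : (m k + 1) ^ 2 ≤ (4 * (k + 11)) ^ 2 :=
      Nat.pow_le_pow_left (by have := hm k; omega) 2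
    have h4' : (2 * (10 + k) + 1) ^ 2 ≤ (2 * (k + 11)) ^ 2 := Nat.pow_le_pow_left (by omega) 2
    have h5 := sq_le_two_pow k
    have h6 := two_pow_le_three_pow k
    have h7 : 1 ≤ 3 ^ k := Nat.one_le_pow _ _ (by norm_num)
    simp only [List.length_cons, List.length_nil, Circuit.length_inv] at u5 u6
    rw [mul_pow] at h4 h4'
    have h8 : (k + 11) ^ 2 ≤ 121 * 3 ^ k := h5.trans (by omega)
    generalize (k + 11) ^ 2 = q at *
    generalize (m k + 1) ^ 2 = q1 at *
    generalize (2 * (10 + k) + 1) ^ 2 = q2 at *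
    generalize 3 ^ k = q3 at *
    omega

/-- Build the circuit `searchC`. -/
def buildP : Prog :=
  .seq clearP (.seq (markP 15) (.seq (block (.const 18 0) [.add 18 18 2]) (.seq hadP
    (.seq (markP 6) (.seq (mirrorP 15 6) (.seq (markP 7)
      (.seq (block (.const 8 5) [.const 9 0, .const 10 10, .const 11 2, .add 11 2 11,
        .sub 11 11 1, .sub 11 11 1])
      (.seq (forP 12 1 levelP) (.seq (block (.add 18 10 10) []) (.seq bankP (emitP 6)))))))))))

/-- The Hadamard gates are written only in order to be mirrored; emission begins after them, at the
mark in the cell `6`. The cell `11` holds `n + 2 - 2 K + 2 k`, the second argument of the minimum in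
`levelBits`. -/
theorem wp_build {n K : ℕ} (h1 : s.sc 1 = K) (h2 : s.sc 2 = n) (hn : n ≤ 4 * K + 1)
    (hK : 2 * K ≤ n) (hc : s.circ = [])
    (hQ : ∀ s', (∀ c < 6, s'.sc c = s.sc c) → s'.sc 9 = slotBase K → s'.sc 10 = 10 + K →
      s'.circ = searchC n (levelBits n K) K → s'.tm ≤ s.tm + 2 * 10 ^ 7 * 3 ^ K → Q s') :
    wp out buildP s Q := by
  have hm : ∀ k, levelBits n K k ≤ 4 * k + 5 := fun k => Nat.min_le_left _ _
  refine wp_seq (wp_clear ?_)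
  set s₀ : AbsState := { s.tick with gs := [], tm := s.tick.tm + 1 } with hs₀
  refine wp_seq (wp_mark_ext (lim := 15) (by norm_num) le_rfl fun s₁ k1 e1 _ => ?_)
  have a1 := (Ext.tick 6 s₀).trans k1 (by norm_num)
  refine wp_seq (wp_block (lim := 18) (by simp [Instr.IsFree]) fun s₂ k2 e2 => ?_)
  have a2 := (a1.trans (Ext.tick 6 _) le_rfl).trans k2 (by norm_num)
  have d2 : s₂.sc 18 = n := by
    have := (a1.sc 2 (by norm_num)).trans h2
    simp [e2, Instr.eff, AbsState.tick, this]
  refine wp_seq (wp_had (s := s₂.tick) d2 fun s₃ k3 => ?_)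
  have a3 := (a2.trans (Ext.tick 6 _) le_rfl).trans k3 (by norm_num)
  have g3 : s₃.gs = hadC n := by rw [a3.gs]; simp [hs₀]
  refine wp_seq (wp_mark_ext (lim := 6) (by norm_num) le_rfl fun s₄ k4 e4 f4 => ?_)
  have a4 := (a3.trans (Ext.tick 6 _) le_rfl).trans k4 (by norm_num)
  have g4 : s₄.gs = hadC n := by rw [k4.gs]; simpa [AbsState.tick] using g3
  have c15 : s₄.sc 15 = pos 0 :=
    (f4 15 (by norm_num)).trans ((k3.sc 15 (by norm_num)).trans ((k2.sc 15 (by norm_num)).trans e1))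
  have c6 : s₄.sc 6 = pos (hadC n).length := e4.trans (by rw [AbsState.tick, g3])
  refine wp_seq (wp_mirror (s := s₄.tick) (X := []) (S := hadC n) (Y := []) (by norm_num)
    (by norm_num) (by simpa [AbsState.tick] using g4) c15 c6 fun s₅ k5 => ?_)
  have a5 := (a4.trans (Ext.tick 6 _) le_rfl).trans k5 (by norm_num)
  have g5 : s₅.gs = hadC n ++ (hadC n).inv := by rw [k5.gs]; simp [AbsState.tick, g4]
  refine wp_seq (wp_mark_ext (lim := 7) (by norm_num) le_rfl fun s₆ k6 e6 _ => ?_)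
  have a6 := (a5.trans (Ext.tick 6 _) le_rfl).trans k6 (by norm_num)
  have g6 : s₆.gs = hadC n ++ (hadC n).inv := by rw [k6.gs]; simpa [AbsState.tick] using g5
  refine wp_seq (wp_block (lim := 8) (by simp [Instr.IsFree]) fun s₇ k7 e7 => ?_)
  have a7 := (a6.trans (Ext.tick 6 _) le_rfl).trans k7 (by norm_num)
  have g7 : s₇.gs = hadC n ++ (hadC n).inv := by rw [k7.gs]; simpa [AbsState.tick] using g6
  have b6 : s₇.sc 6 = pos (hadC n).length :=
    (k7.sc 6 (by norm_num)).trans ((k6.sc 6 (by norm_num)).trans ((k5.sc 6 (by norm_num)).trans c6))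
  have b7 : s₇.sc 7 = pos (hadC n ++ (hadC n).inv).length := by
    refine (k7.sc 7 (by norm_num)).trans (e6.trans ?_)
    rw [AbsState.tick, g5]
  have b11 : s₇.sc 11 = n + 2 - 2 * K := by
    have u1 := (a6.sc 1 (by norm_num)).trans h1
    have u2 := (a6.sc 2 (by norm_num)).trans h2
    simp [e7, Instr.eff, AbsState.tick, u1, u2]
    omega
  refine wp_seq (wp_for (M := K) (T := fun k => 10 ^ 7 * 3 ^ k) (by norm_num) (by norm_num)
    (fun k s' => (∀ c < 6, s'.sc c = s.sc c) ∧ s'.sc 6 = s₇.sc 6 ∧ s'.sc 7 = s₇.sc 7 ∧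
      s'.sc 8 = 4 * k + 5 ∧ s'.sc 9 = slotBase k ∧ s'.sc 10 = 10 + k ∧
      s'.sc 11 = n + 2 - 2 * K + 2 * k ∧
      s'.gs = hadC n ++ (hadC n).inv ++ ampC n (levelBits n K) k ∧ s'.circ = []) ?_ ?_ ?_ ?_ ?_)
  · rintro j s s' ⟨i1, i2, i3, i4, i5, i6, i7, i8, i9⟩ l1 l2 l3
    exact ⟨fun c hc => (l1 c (by omega)).trans (i1 c hc), (l1 _ (by norm_num)).trans i2,
      (l1 _ (by norm_num)).trans i3, (l1 _ (by norm_num)).trans i4, (l1 _ (by norm_num)).trans i5,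
      (l1 _ (by norm_num)).trans i6, (l1 _ (by norm_num)).trans i7, l2.trans i8, l3.trans i9⟩
  · rintro j s' ⟨i1, -⟩
    exact (i1 1 (by norm_num)).trans h1
  · refine ⟨a7.sc, rfl, rfl, ?_, ?_, ?_, b11, ?_, ?_⟩
    · simp [AbsState.tick, e7, Instr.eff]
    · simp [AbsState.tick, e7, Instr.eff, slotBase]
    · simp [AbsState.tick, e7, Instr.eff]
    · simpa [AbsState.tick, ampC] using g7
    · exact a7.circ.trans hc
  · rintro k hk s' ⟨i1, i2, i3, i4, i5, i6, i7, i8, i9⟩ l1 l2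
    refine wp_level ((i1 2 (by norm_num)).trans h2) (i3.trans b7) i4 i5 i6 i7 l2 hm ?_ i8 ?_
    · rw [levelBits]
      congr 1
      omega
    · intro s'' j1 j2 j3 j4 j5 j6 j7 j8
      refine ⟨⟨fun c hc => (j1 c (by omega) (by omega)).trans (i1 c hc),
        (j1 6 (by norm_num) (by norm_num)).trans i2, (j1 7 (by norm_num) (by norm_num)).trans i3,
        j2, j3, j4, j5.trans (by ring), j6, j7.trans i9⟩,
        (j1 12 (by norm_num) (by norm_num)).trans l1, (j1 13 (by norm_num) (by norm_num)).trans l2,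
        j8⟩
  · rintro s₈ ⟨i1, i2, i3, i4, i5, i6, i7, i8, i9⟩ ht8
    refine wp_seq (wp_block (lim := 18) (by simp [Instr.IsFree]) fun s₉ k9 e9 => ?_)
    have d9 : s₉.sc 18 = 2 * (10 + K) := by
      simp [e9, Instr.eff, AbsState.tick, i6]
      ring
    refine wp_seq (wp_bank (s := s₉.tick) ((k9.sc 2 (by norm_num)).trans
      ((i1 2 (by norm_num)).trans h2)) ((k9.sc 9 (by norm_num)).trans i5) d9 fun s₁₀ k10 => ?_)
    have g10 : s₁₀.gs = hadC n ++ searchC n (levelBits n K) K := by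
      rw [k10.gs, AbsState.tick, k9.gs]
      simp [AbsState.tick, i8, searchC, levelBank]
    have b6' : s₁₀.sc 6 = pos (hadC n).length :=
      (k10.sc 6 (by norm_num)).trans ((k9.sc 6 (by norm_num)).trans (i2.trans b6))
    refine wp_emit (by norm_num) g10 b6' fun s₁₁ j1 j2 j3 => hQ s₁₁ ?_ ?_ ?_ ?_ ?_
    · exact fun c hc => (j1 c (by omega)).trans ((k10.sc c (by omega)).trans
        ((k9.sc c (by omega)).trans (i1 c hc)))
    · exact (j1 9 (by norm_num)).trans ((k10.sc 9 (by norm_num)).trans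
        ((k9.sc 9 (by norm_num)).trans i5))
    · exact (j1 10 (by norm_num)).trans ((k10.sc 10 (by norm_num)).trans
        ((k9.sc 10 (by norm_num)).trans i6))
    · rw [j2]
      have : s₁₀.circ = [] := k10.circ.trans (k9.circ.trans i9)
      rw [this, List.nil_append]
    · have u7 := a7.tm
      have u9 := k9.tm
      have u10 := k10.tm
      have hs := length_searchC (n := n) (K := K) hm hn
      -- A coarse geometric sum; the extra `10 ^ 7` on the left makes the case `K = 0` an equality
      -- and leaves room for the cost outside the loop.
      have hsum : ∑ k ∈ Finset.range K, (10 ^ 7 * 3 ^ k + 5) + 10 ^ 7 ≤ 10 ^ 7 * 3 ^ K + 5 * K := by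
        clear * -
        induction K with
        | zero => simp
        | succ K ih =>
          rw [Finset.sum_range_succ, pow_succ 3 K]
          omega
      have hK' : K < 3 ^ K := Nat.lt_pow_self (by norm_num)
      simp only [hs₀, AbsState.tick, List.length_cons, List.length_nil, length_hadC] at u7 u9 u10 ht8
      generalize ∑ k ∈ Finset.range K, (10 ^ 7 * 3 ^ k + 5) = S at *
      generalize 3 ^ K = q at *
      generalize (searchC n (levelBits n K) K).length = L at *
      omega

end wp

/-! ### Sizes of the search spaces -/

/-- The number of index bits used in the stage `K`. -/
def stageBits : ℕ → ℕ
  | 0 => 0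
  | K + 1 => if 9 * 9 ^ K ≤ 8 * 2 ^ stageBits K then stageBits K + 3 else stageBits K + 4

/-- When `9 ^ K` is multiplied by `9`, the power of two is multiplied by `8` if that is still
enough, and by `16` otherwise; in the second case `8 * 2 ^ b < 9 * 9 ^ K` keeps the result below
twice the target. -/
theorem stageBits_bounds (K : ℕ) : 9 ^ K ≤ 2 ^ stageBits K ∧ 2 ^ stageBits K ≤ 2 * 9 ^ K := by
  induction K with
  | zero => norm_num [stageBits]
  | succ K ih =>
    rw [stageBits, pow_succ]
    split_ifs with h
    · rw [pow_add]
      omega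
    · rw [pow_add]
      omega

theorem le_stageBits (K : ℕ) : 3 * K ≤ stageBits K := by
  induction K with
  | zero => exact Nat.zero_le _
  | succ K ih =>
    rw [stageBits]
    split_ifs <;> omega

theorem stageBits_le (K : ℕ) : stageBits K ≤ 4 * K := by
  induction K with
  | zero => exact Nat.zero_le _
  | succ K ih =>
    rw [stageBits]
    split_ifs <;> omega

/-- The circuit of the stage `K`. -/
def stageC (K : ℕ) : Circuit := searchC (stageBits K) (levelBits (stageBits K) K) K

theorem length_stageC (K : ℕ) : (stageC K).length ≤ 41000 * 3 ^ K :=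
  length_searchC (fun _ => Nat.min_le_left _ _) ((stageBits_le K).trans (Nat.le_succ _))

/-! ### The program -/

/-- Count the ones among the answers of the last bank. -/
def countP : Prog :=
  .seq (block (.add 18 10 10) [.const 19 0])
    (forP 25 18 (block (.add 28 9 25) [.add 28 28 28, .add 28 28 2, .read 28 28, .add 19 19 28]))

/-- Read the index. -/
def indexP : Prog :=
  .seq (block (.const 20 0) [.const 21 1])
    (forP 25 2 (.seq (.instr (.read 28 25)) (.seq (.cond 28 (.instr (.add 20 20 21))
      (.instr (.const 28 0))) (.instr (.add 21 21 21)))))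

/-- Go to the next round. -/
def advanceP : Prog :=
  .seq (block (.const 22 1) [.sub 5 5 22]) (.cond 5 (.instr (.const 23 0))
    (.seq (block (.const 5 16) [.add 1 1 22, .add 23 3 3, .add 23 23 23, .add 23 23 23, .add 3 3 23,
      .add 4 4 4, .add 4 4 4, .add 4 4 4, .const 24 3, .add 2 2 24, .sub 23 3 4])
      (.cond 23 (block (.add 4 4 4) [.add 2 2 22]) (.instr (.const 23 0)))))

/-- The classical processing of an outcome. -/
def finishP : Prog :=
  .seq countP (.seq indexP (.seq (.instr (.sub 22 10 19)) (.cond 22 advanceP (.instr (.ret 20)))))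

/-- A round. -/
def roundP : Prog := .seq buildP (.seq (.instr .eval) finishP)

/-- Initialization. -/
def initP : Prog := block (.const 48 64) [.const 0 1, .const 3 1, .const 4 1, .const 5 16]

/-- The guessing algorithm. -/
def guessP : Prog := .seq initP (.loop 0 roundP)

/-- The free cells at the beginning of the round `j`. -/
structure Ready (j : ℕ) (s : AbsState) : Prop where
  one : s.sc 0 = 1
  stage : s.sc 1 = j / 16
  bits : s.sc 2 = stageBits (j / 16)
  target : s.sc 3 = 9 ^ (j / 16)
  size : s.sc 4 = 2 ^ stageBits (j / 16)
  left : s.sc 5 = 16 - j % 16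

theorem Ready.congr {j : ℕ} {s s' : AbsState} (h : Ready j s) (hs : ∀ c < 6, s'.sc c = s.sc c) :
    Ready j s' where
  one := (hs _ (by norm_num)).trans h.one
  stage := (hs _ (by norm_num)).trans h.stage
  bits := (hs _ (by norm_num)).trans h.bits
  target := (hs _ (by norm_num)).trans h.target
  size := (hs _ (by norm_num)).trans h.size
  left := (hs _ (by norm_num)).trans h.left

section wp

variable {out : ℕ → Bool} {s : AbsState} {Q : AbsState → Prop}

theorem wp_count {n s₀ t : ℕ} (hn : s.sc 2 = n) (h9 : s.sc 9 = s₀) (h10 : s.sc 10 = t)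
    (hQ : ∀ s', (∀ c < 18, s'.sc c = s.sc c) → s'.circ = s.circ →
      s'.sc 19 = bitCount true out (n + 2 * s₀) 2 (2 * t) → s'.tm ≤ s.tm + (28 * t + 11) → Q s') :
    wp out countP s Q := by
  refine wp_seq (wp_block (lim := 18) (by simp [Instr.IsFree]) fun s₁ h1 e1 => ?_)
  have d1 : s₁.sc 18 = 2 * t := by
    simp [e1, Instr.eff, AbsState.tick, h10]
    ring
  have d2 : s₁.sc 19 = 0 := by simp [e1, Instr.eff]
  have u1 := h1.tm
  simp only [AbsState.tick, List.length_cons, List.length_nil] at u1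
  refine wp_for (M := 2 * t) (T := fun _ => 9) (by norm_num) (by norm_num)
    (fun j s' => (∀ c < 19, s'.sc c = s₁.sc c) ∧ s'.circ = s.circ ∧
      s'.sc 19 = bitCount true out (n + 2 * s₀) 2 j) ?_ ?_ ?_ ?_ ?_
  · rintro j s s' ⟨h1, h2, h3⟩ e1 e2 e3
    exact ⟨fun c hc => (e1 c (by omega)).trans (h1 c hc), e3.trans h2,
      (e1 _ (by norm_num)).trans h3⟩
  · rintro j s' ⟨h1, -⟩
    exact (h1 _ (by norm_num)).trans d1
  · exact ⟨fun _ _ => rfl, h1.circ, by simpa [bitCount] using d2⟩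
  · rintro j hj s' ⟨i1, i2, i3⟩ l1 l2
    refine wp_block (lim := 19) (by simp [Instr.IsFree]) fun s₂ h2 e2 => ?_
    have j9 : s'.sc 9 = s₀ := by
      rw [i1 _ (by norm_num), h1.sc _ (by norm_num)]; exact h9
    have j2 : s'.sc 2 = n := by
      rw [i1 _ (by norm_num), h1.sc _ (by norm_num)]; exact hn
    have ew : s₀ + j + (s₀ + j) + n = n + 2 * s₀ + 2 * j := by ring
    refine ⟨⟨fun c hc => (h2.sc c hc).trans (i1 c hc), h2.circ.trans i2, ?_⟩, ?_, ?_, h2.tm⟩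
    · rw [bitCount_succ, ← i3]
      simp [e2, Instr.eff, j9, j2, l1, ew]
    · simp [e2, Instr.eff, l1]
    · simp [e2, Instr.eff, l2]
  · rintro s' ⟨i1, i2, i3⟩ ht
    refine hQ s' (fun c hc => (i1 c (by omega)).trans (h1.sc c hc)) i2 i3 ?_
    simp only [Finset.sum_const, Finset.card_range, smul_eq_mul] at ht
    omega

theorem wp_index {n : ℕ} (hn : s.sc 2 = n)
    (hQ : ∀ s', (∀ c < 20, s'.sc c = s.sc c) → s'.circ = s.circ →
      s'.sc 20 = readNat out 0 n → s'.tm ≤ s.tm + (12 * n + 11) → Q s') :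
    wp out indexP s Q := by
  refine wp_seq (wp_block (lim := 20) (by simp [Instr.IsFree]) fun s₁ h1 e1 => ?_)
  have d1 : s₁.sc 20 = 0 := by simp [e1, Instr.eff]
  have d2 : s₁.sc 21 = 1 := by simp [e1, Instr.eff]
  have u1 := h1.tm
  simp only [AbsState.tick, List.length_cons, List.length_nil] at u1
  refine wp_for (M := n) (T := fun _ => 6) (by norm_num) (by norm_num)
    (fun j s' => (∀ c < 20, s'.sc c = s₁.sc c) ∧ s'.circ = s.circ ∧
      s'.sc 20 = readNat out 0 j ∧ s'.sc 21 = 2 ^ j) ?_ ?_ ?_ ?_ ?_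
  · rintro j s s' ⟨h1, h2, h3, h4⟩ e1 e2 e3
    exact ⟨fun c hc => (e1 c (by omega)).trans (h1 c hc), e3.trans h2,
      (e1 _ (by norm_num)).trans h3, (e1 _ (by norm_num)).trans h4⟩
  · rintro j s' ⟨i1, -⟩
    exact (i1 _ (by norm_num)).trans ((h1.sc _ (by norm_num)).trans hn)
  · exact ⟨fun _ _ => rfl, h1.circ, by simpa [readNat] using d1, by simpa using d2⟩
  · rintro j hj s' ⟨i1, i2, i3, i4⟩ l1 l2
    refine wp_seq (wp_free (lim := 20) (by simp [Instr.IsFree]) ?_)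
    refine wp_seq (wp_cond (by norm_num) (fun h => ?_) fun h => ?_)
    · have ho : out j = true := by
        simpa [Instr.eff, AbsState.tick, l1] using h
      refine wp_free (lim := 20) (by simp [Instr.IsFree]) (wp_free (lim := 20)
        (by simp [Instr.IsFree]) ?_)
      refine ⟨⟨fun c hc => ?_, i2, ?_, ?_⟩, ?_, ?_, ?_⟩
      · simp only [Instr.eff, AbsState.tick]
        repeat rw [Function.update_of_ne (by omega)]
        exact i1 c hc
      · simp [Instr.eff, AbsState.tick, i3, i4, readNat, Finset.sum_range_succ, ho]
      · simp [Instr.eff, AbsState.tick, i4]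
        ring
      · simp [Instr.eff, AbsState.tick, l1]
      · simp [Instr.eff, AbsState.tick, l2]
      · simp only [AbsState.tick]
        omega
    · have ho : out j = false := by
        simpa [Instr.eff, AbsState.tick, l1] using h
      refine wp_free (lim := 20) (by simp [Instr.IsFree]) (wp_free (lim := 20)
        (by simp [Instr.IsFree]) ?_)
      refine ⟨⟨fun c hc => ?_, i2, ?_, ?_⟩, ?_, ?_, ?_⟩
      · simp only [Instr.eff, AbsState.tick]
        repeat rw [Function.update_of_ne (by omega)]
        exact i1 c hc
      · simp [Instr.eff, AbsState.tick, i3, readNat, Finset.sum_range_succ, ho]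
      · simp [Instr.eff, AbsState.tick, i4]
        ring
      · simp [Instr.eff, AbsState.tick, l1]
      · simp [Instr.eff, AbsState.tick, l2]
      · simp only [AbsState.tick]
        omega
  · rintro s' ⟨i1, i2, i3, i4⟩ ht
    refine hQ s' (fun c hc => (i1 c (by omega)).trans (h1.sc c hc)) i2 i3 ?_
    simp only [Finset.sum_const, Finset.card_range, smul_eq_mul] at ht
    omega

/-- The cells `3` and `4` hold `9 ^ K` and the power of two, maintained by additions alone, so that
the choice between `3` and `4` further bits is one truncated subtraction. -/
theorem wp_advance {j : ℕ} (hs : Ready j s)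
    (hQ : ∀ s', Ready (j + 1) s' → s'.circ = s.circ → s'.tm ≤ s.tm + 36 → Q s') :
    wp out advanceP s Q := by
  have hstage := hs.stage
  have hbits := hs.bits
  have htarget := hs.target
  have hsize := hs.size
  have hleft := hs.left
  refine wp_seq (wp_block (lim := 0) (by simp [Instr.IsFree]) fun s₁ h1 e1 => ?_)
  have u1 := h1.tm
  simp only [AbsState.tick, List.length_cons, List.length_nil] at u1
  have d5 : s₁.sc 5 = 15 - j % 16 := by
    simp [e1, Instr.eff, AbsState.tick, hleft]
    omega
  have d22 : s₁.sc 22 = 1 := by simp [e1, Instr.eff]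
  have dc : ∀ c < 5, s₁.sc c = s.sc c := by
    intro c hc
    simp only [e1, List.foldl, Instr.eff, AbsState.tick]
    rw [Function.update_of_ne (by omega), Function.update_of_ne (by omega)]
  refine wp_cond (by norm_num) (fun h => ?_) fun h => ?_
  · have e : (j + 1) / 16 = j / 16 := by omega
    refine wp_free (lim := 6) (by simp [Instr.IsFree]) (hQ _ ⟨?_, ?_, ?_, ?_, ?_, ?_⟩ h1.circ ?_)
    · simp [Instr.eff, AbsState.tick, dc 0 (by norm_num), hs.one]
    · simp [Instr.eff, AbsState.tick, dc 1 (by norm_num), hstage, e]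
    · simp [Instr.eff, AbsState.tick, dc 2 (by norm_num), hbits, e]
    · simp [Instr.eff, AbsState.tick, dc 3 (by norm_num), htarget, e]
    · simp [Instr.eff, AbsState.tick, dc 4 (by norm_num), hsize, e]
    · simp [Instr.eff, AbsState.tick, d5]
      omega
    · simp only [AbsState.tick]
      omega
  · have e : (j + 1) / 16 = j / 16 + 1 := by omega
    have e' : (j + 1) % 16 = 0 := by omega
    refine wp_seq (wp_block (lim := 0) (by simp [Instr.IsFree]) fun s₂ h2 e2 => ?_)
    have u2 := h2.tm
    simp only [AbsState.tick, List.length_cons, List.length_nil] at u2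
    have f0 : s₂.sc 0 = 1 := by simp [e2, Instr.eff, AbsState.tick, dc 0 (by norm_num), hs.one]
    have f1 : s₂.sc 1 = j / 16 + 1 := by
      simp [e2, Instr.eff, AbsState.tick, dc 1 (by norm_num), hstage, d22]
    have f2 : s₂.sc 2 = stageBits (j / 16) + 3 := by
      simp [e2, Instr.eff, AbsState.tick, dc 2 (by norm_num), hbits]
    have f3 : s₂.sc 3 = 9 * 9 ^ (j / 16) := by
      simp [e2, Instr.eff, AbsState.tick, dc 3 (by norm_num), htarget]
      ring
    have f4 : s₂.sc 4 = 8 * 2 ^ stageBits (j / 16) := by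
      simp [e2, Instr.eff, AbsState.tick, dc 4 (by norm_num), hsize]
      ring
    have f5 : s₂.sc 5 = 16 := by simp [e2, Instr.eff]
    have f22 : s₂.sc 22 = 1 := by simp [e2, Instr.eff, AbsState.tick, d22]
    have f23 : s₂.sc 23 = 9 * 9 ^ (j / 16) - 8 * 2 ^ stageBits (j / 16) := by
      rw [← f3, ← f4]
      simp [e2, Instr.eff]
    refine wp_cond (by norm_num) (fun h' => ?_) fun h' => ?_
    · have hb : stageBits (j / 16 + 1) = stageBits (j / 16) + 4 := by
        rw [stageBits, if_neg (by omega)]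
      refine wp_block (lim := 0) (by simp [Instr.IsFree]) fun s₃ h3 e3 => ?_
      refine hQ _ ⟨?_, ?_, ?_, ?_, ?_, ?_⟩ (h3.circ.trans (h2.circ.trans h1.circ)) ?_
      · simp [e3, Instr.eff, AbsState.tick, f0]
      · simp [e3, Instr.eff, AbsState.tick, f1, e]
      · simp [e3, Instr.eff, AbsState.tick, f2, f22, e, hb]
      · simp [e3, Instr.eff, AbsState.tick, f3, e]
        ring
      · simp [e3, Instr.eff, AbsState.tick, f4, e, hb]
        ring
      · simp [e3, Instr.eff, AbsState.tick, f5, e']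
      · have := h3.tm
        simp only [AbsState.tick, List.length_cons, List.length_nil] at this
        omega
    · have hb : stageBits (j / 16 + 1) = stageBits (j / 16) + 3 := by
        rw [stageBits, if_pos (by omega)]
      refine wp_free (lim := 6) (by simp [Instr.IsFree])
        (hQ _ ⟨?_, ?_, ?_, ?_, ?_, ?_⟩ (h2.circ.trans h1.circ) ?_)
      · simp [Instr.eff, AbsState.tick, f0]
      · simp [Instr.eff, AbsState.tick, f1, e]
      · simp [Instr.eff, AbsState.tick, f2, e, hb]
      · simp [Instr.eff, AbsState.tick, f3, e]
        ring
      · simp [Instr.eff, AbsState.tick, f4, e, hb]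
        ring
      · simp [Instr.eff, AbsState.tick, f5, e']
      · simp only [AbsState.tick]
        omega

end wp

/-! ### A round -/

/-- The machine is about to begin the round `j`. -/
structure AtRound (j : ℕ) (c : Config) : Prop where
  code : c.code = [.loop 0 roundP]
  circ : c.circ = []
  result : c.result = none
  ready : ∃ s, Rep c.mem s ∧ Ready j s

theorem exists_steps_start : ∃ c, Steps 10 (Config.start guessP) c ∧ AtRound 0 c := by
  have h : Exec (fun _ => false) initP (fun _ => 0) [] 9 _ [] :=
    Exec.block (by simp [Instr.IsMem])
  refine ⟨_, .step trivial (h [.loop 0 roundP] none), rfl, rfl, rfl,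
    ⟨fun c => if c = 0 then 1 else if c = 3 then 1 else if c = 4 then 1 else if c = 5 then 16 else 0,
      [], [], 0⟩, ⟨?_, ?_, ?_⟩, ?_⟩
  · intro c hc
    simp only [List.foldl, Instr.eff, Function.update_apply]
    split_ifs <;> first | rfl | omega
  · simp [Instr.eff, pos]
  · simp
  · constructor <;> simp [stageBits]

/-- All randomness of a round is in one evaluation. Before and after it the run is deterministic,
and the time before it is the same for all outcomes. The stated bound also covers the cost of the
evaluation itself. -/
theorem AtRound.exists_eval {j : ℕ} {c : Config} (h : AtRound j c) :
    ∃ t₁ c₁ k, Steps t₁ c c₁ ∧ c₁.code = .instr .eval :: k ∧ c₁.circ = stageC (j / 16) ∧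
      ∀ o, ∃ t₂ c₂, Steps t₂ { c₁ with code := k, circ := [], outcome := o } c₂ ∧
        t₁ + t₂ + 1 + (stageC (j / 16)).length ≤ 3 * 10 ^ 7 * 3 ^ (j / 16) ∧
        (Accept (stageBits (j / 16)) (j / 16) o →
          c₂.code = [] ∧ c₂.result = some (readNat o 0 (stageBits (j / 16)))) ∧
        (¬Accept (stageBits (j / 16)) (j / 16) o → AtRound (j + 1) c₂) := by
  obtain ⟨code, mem, circ, out, res⟩ := c
  obtain ⟨rfl, rfl, rfl, s, hr, hs⟩ := h
  simp only at hr
  set K := j / 16 with hK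
  have hn := stageBits_le K
  have hn' := le_stageBits K
  have hq : K < 3 ^ K := Nat.lt_pow_self (by norm_num)
  obtain ⟨m₁, s₁, t, hE, hr₁, ht, i1, i2, i3, i4, i5⟩ := wp_build (out := out)
    (s := { s with circ := [] }) hs.stage hs.bits
    (hn.trans (Nat.le_succ _)) (le_trans (by omega) hn') rfl
    (Q := fun s' => (∀ c < 6, s'.sc c = s.sc c) ∧ s'.sc 9 = slotBase K ∧ s'.sc 10 = 10 + K ∧
      s'.circ = stageC K ∧ s'.tm ≤ s.tm + 2 * 10 ^ 7 * 3 ^ K)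
    (fun s' h1 h2 h3 h4 h5 => ⟨h1, h2, h3, h4, h5⟩) mem ⟨hr.sc, hr.dst, hr.gs⟩
  have hlen := length_stageC K
  have h0 : mem 0 ≠ 0 := by rw [hr.sc 0 (by norm_num), hs.one]; norm_num
  set k : List Prog := [finishP, .loop 0 roundP] with hk
  have hs1 : Steps (t + 3) ⟨[.loop 0 roundP], mem, [], out, none⟩
      ⟨.instr .eval :: k, m₁, stageC K, out, none⟩ := by
    have a := (hE [.seq (.instr .eval) finishP, .loop 0 roundP] none).trans
      (Steps.single (c := ⟨[.seq (.instr .eval) finishP, .loop 0 roundP], m₁, s₁.circ, out, none⟩)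
        trivial)
    rw [i4] at a
    refine .step trivial ?_
    have : (Config.mk [.loop 0 roundP] mem [] out none).next =
        ⟨[roundP, .loop 0 roundP], mem, [], out, none⟩ := by
      simp [Config.next, h0]
    rw [this]
    exact .step trivial a
  -- The three extra steps are the loop test and the two `seq` steps around the construction of the
  -- circuit.
  refine ⟨t + 3, _, k, hs1, rfl, rfl, fun o => ?_⟩
  have hr1 : Ready j s₁ := hs.congr i1
  obtain ⟨m₂, s₂, t₂, hE₂, hr₂, ht₂, j1, j2, j3, j4⟩ := wp_count (out := o)
    (s := { s₁ with circ := [] }) hr1.bits i2 i3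
    (Q := fun s' => (∀ c < 18, s'.sc c = s₁.sc c) ∧ s'.circ = [] ∧
      s'.sc 19 = bitCount true o (stageBits K + 2 * slotBase K) 2 (2 * (10 + K)) ∧
      s'.tm ≤ s₁.tm + (28 * (10 + K) + 11))
    (fun s' h1 h2 h3 h4 => ⟨h1, h2, h3, h4⟩) m₁ ⟨hr₁.sc, hr₁.dst, hr₁.gs⟩
  have hr2 : Ready j s₂ := hr1.congr fun c hc => j1 c (by omega)
  obtain ⟨m₃, s₃, t₃, hE₃, hr₃, ht₃, k1, k2, k3, k4⟩ := wp_index (out := o)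
    (s := s₂) hr2.bits
    (Q := fun s' => (∀ c < 20, s'.sc c = s₂.sc c) ∧ s'.circ = s₂.circ ∧
      s'.sc 20 = readNat o 0 (stageBits K) ∧ s'.tm ≤ s₂.tm + (12 * stageBits K + 11))
    (fun s' h1 h2 h3 h4 => ⟨h1, h2, h3, h4⟩) m₂ hr₂
  have hr3 : Ready j s₃ := hr2.congr fun c hc => k1 c (by omega)
  obtain ⟨m₄, s₄, t₄, hE₄, hr₄, ht₄, l1, l2, l3, l4⟩ := wp_free (out := o)
    (s := s₃) (i := .sub 22 10 19) (lim := 22) (by simp [Instr.IsFree])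
    (Q := fun s' => (∀ c < 22, s'.sc c = s₃.sc c) ∧ s'.circ = s₃.circ ∧
      s'.sc 22 = s₃.sc 10 - s₃.sc 19 ∧ s'.tm ≤ s₃.tm + 1)
    ⟨fun c hc => Function.update_of_ne (by omega) _ _, rfl, by simp [Instr.eff], le_rfl⟩ m₃ hr₃
  have hr4 : Ready j s₄ := hr3.congr fun c hc => l1 c (by omega)
  have c22 : s₄.sc 22 = 10 + K - bitCount true o (stageBits K + 2 * slotBase K) 2
      (2 * (10 + K)) := by
    rw [l3, k1 10 (by norm_num), j1 10 (by norm_num), i3, k1 19 (by norm_num), j3]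
  have c20 : m₄ 20 = readNat o 0 (stageBits K) := by
    rw [hr₄.sc 20 (by norm_num), l1 20 (by norm_num), k3]
  have hs2 : Steps (t₂ + t₃ + t₄ + 3) ⟨k, m₁, [], o, none⟩
      ⟨[.cond 22 advanceP (.instr (.ret 20)), .loop 0 roundP], m₄, [], o, none⟩ := by
    rw [j2] at hE₂
    rw [k2, j2] at hE₃
    rw [l2, k2, j2] at hE₄
    have a := Steps.step (c := ⟨[.seq (.instr (.sub 22 10 19)) (.cond 22 advanceP
      (.instr (.ret 20))), .loop 0 roundP], m₃, [], o, none⟩) trivial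
      (hE₄ [.cond 22 advanceP (.instr (.ret 20)), .loop 0 roundP] none)
    have b := Steps.step (c := ⟨[.seq indexP (.seq (.instr (.sub 22 10 19)) (.cond 22 advanceP
      (.instr (.ret 20)))), .loop 0 roundP], m₂, [], o, none⟩) trivial ((hE₃ _ none).trans a)
    have d := Steps.step (c := ⟨k, m₁, [], o, none⟩) trivial ((hE₂ _ none).trans b)
    have e : t₂ + (t₃ + (t₄ + 1) + 1) + 1 = t₂ + t₃ + t₄ + 3 := by ring
    exact e ▸ d
  have hm22 : m₄ 22 = _ := (hr₄.sc 22 (by norm_num)).trans c22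
  by_cases hacc : Accept (stageBits K) K o
  · have hz : m₄ 22 = 0 := by
      rw [hm22]
      simp only [Accept] at hacc
      omega
    have a : Steps 2 ⟨[.cond 22 advanceP (.instr (.ret 20)), .loop 0 roundP], m₄, [], o, none⟩
        ⟨[], m₄, [], o, some (m₄ 20)⟩ := by
      refine .step trivial ?_
      have : (Config.mk [.cond 22 advanceP (.instr (.ret 20)), .loop 0 roundP] m₄ [] o none).next =
          ⟨[.instr (.ret 20), .loop 0 roundP], m₄, [], o, none⟩ := by
        simp [Config.next, hz]
      rw [this]
      exact Steps.single trivial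
    refine ⟨_, _, hs2.trans a, ?_, fun _ => ⟨rfl, by simp [c20]⟩, fun h => absurd hacc h⟩
    simp only at ht ht₂ ht₃ ht₄
    omega
  · have hz : m₄ 22 ≠ 0 := by
      rw [hm22]
      simp only [Accept] at hacc
      omega
    obtain ⟨m₅, s₅, t₅, hE₅, hr₅, ht₅, q1, q2, q3⟩ := wp_advance (out := o)
      (s := s₄) hr4
      (Q := fun s' => Ready (j + 1) s' ∧ s'.circ = s₄.circ ∧ s'.tm ≤ s₄.tm + 36)
      (fun s' h1 h2 h3 => ⟨h1, h2, h3⟩) m₄ hr₄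
    rw [q2, l2, k2, j2] at hE₅
    have a : Steps (t₅ + 1) ⟨[.cond 22 advanceP (.instr (.ret 20)), .loop 0 roundP], m₄, [], o, none⟩
        ⟨[.loop 0 roundP], m₅, [], o, none⟩ := Exec.cond_true hz hE₅ _ _
    refine ⟨_, _, hs2.trans a, ?_, fun h => absurd h hacc, fun _ => ⟨rfl, rfl, rfl, s₅, hr₅, q1⟩⟩
    simp only at ht ht₂ ht₃ ht₄
    omega

/-! ### Expectations -/

/-- Expectation of a function. -/
def expectation {α : Type*} (p : PMF α) (g : α → ℝ≥0∞) : ℝ≥0∞ := ∑' a, p a * g a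

section mean

variable {α β : Type*} (p : PMF α)

theorem mean_pure (a : α) (g : α → ℝ≥0∞) : expectation (PMF.pure a) g = g a := by
  rw [expectation, tsum_eq_single a]
  · simp
  · intro b hb
    simp [PMF.pure_apply, hb]

theorem mean_bind (q : α → PMF β) (g : β → ℝ≥0∞) :
    expectation (p.bind q) g = expectation p fun a => expectation (q a) g := by
  simp only [expectation, PMF.bind_apply, ← ENNReal.tsum_mul_right, ← ENNReal.tsum_mul_left]
  rw [ENNReal.tsum_comm]
  simp only [mul_assoc]

theorem mean_map (h : α → β) (g : β → ℝ≥0∞) :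
    expectation (p.map h) g = expectation p fun a => g (h a) := by
  rw [← PMF.bind_pure_comp, mean_bind]
  simp only [Function.comp_apply, mean_pure]

theorem mean_mono {g g' : α → ℝ≥0∞} (h : ∀ a, g a ≤ g' a) : expectation p g ≤ expectation p g' :=
  ENNReal.tsum_le_tsum fun a => mul_le_mul_right (h a) _

theorem mean_add (g g' : α → ℝ≥0∞) :
    expectation p (fun a => g a + g' a) = expectation p g + expectation p g' := by
  simp only [expectation, mul_add]
  exact ENNReal.tsum_add

theorem mean_const (v : ℝ≥0∞) : expectation p (fun _ => v) = v := by
  rw [expectation, ENNReal.tsum_mul_right, p.tsum_coe, one_mul]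

theorem mean_indicator (S : Set α) (v : ℝ≥0∞) :
    expectation p (S.indicator fun _ => v) = p.toOuterMeasure S * v := by
  rw [PMF.toOuterMeasure_apply, ← ENNReal.tsum_mul_right, expectation]
  congr 1
  funext a
  by_cases h : a ∈ S <;> simp [h]

theorem toOuterMeasure_compl_le {S : Set α} {r : ℝ} (h0 : 0 ≤ r) (h1 : r ≤ 1)
    (h : ENNReal.ofReal r ≤ p.toOuterMeasure S) :
    p.toOuterMeasure Sᶜ ≤ ENNReal.ofReal (1 - r) := by
  have e : p.toOuterMeasure S + p.toOuterMeasure Sᶜ = 1 := by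
    have := mean_const p 1
    rw [← this, ← mul_one (p.toOuterMeasure S), ← mul_one (p.toOuterMeasure Sᶜ),
      ← mean_indicator, ← mean_indicator, ← mean_add]
    congr 1
    funext a
    by_cases h : a ∈ S <;> simp [h]
  have e' : ENNReal.ofReal r + p.toOuterMeasure Sᶜ ≤ ENNReal.ofReal r + ENNReal.ofReal (1 - r) := by
    rw [← ENNReal.ofReal_add h0 (by linarith)]
    refine (add_le_add_left h _).trans ?_
    rw [e]
    simp
  exact (ENNReal.add_le_add_iff_left ENNReal.ofReal_ne_top).mp e'

end mean

/-! ### Expected time and success probability as functions of the configuration -/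

section run

variable {A : Type*} [Inhabited A] (f : ℕ → ℕ) (O : Oracle A)

/-- Expectation after one step. -/
def stepMean (g : Config → ℝ≥0∞) (c : Config) : ℝ≥0∞ := expectation (c.step f O) g

theorem mean_run_succ (p : Prog) (n : ℕ) (g : Config → ℝ≥0∞) :
    expectation (p.run f O (n + 1)) g = expectation (p.run f O n) (stepMean f O g) :=
  mean_bind _ _ _

theorem stepMean_det {c : Config} (h : c.IsDet) (g : Config → ℝ≥0∞) :
    stepMean f O g c = g c.next := by
  rw [stepMean, h.step, mean_pure]

theorem stepMean_eval {c : Config} {k : List Prog} (h : c.code = .instr .eval :: k)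
    (g : Config → ℝ≥0∞) : stepMean f O g c =
      expectation (c.circ.eval f O) fun o => g { c with code := k, circ := [], outcome := o } := by
  obtain ⟨code, mem, circ, outcome, result⟩ := c
  subst h
  exact mean_map _ _ _

/-- Expected time of the first `N` steps from a configuration. -/
def meanTime : ℕ → Config → ℝ≥0∞
  | 0, _ => 0
  | N + 1, c => c.stepTime + stepMean f O (meanTime N) c

theorem meanTime_mono (N : ℕ) (c : Config) : meanTime f O N c ≤ meanTime f O (N + 1) c := by
  induction N generalizing c with
  | zero => exact zero_le
  | succ N ih => exact add_le_add_right (mean_mono _ ih) _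

/-- The horizon is deliberately not reduced on the right; an upper bound suffices, and this keeps
the later inductions on the horizon simple. -/
theorem meanTime_of_steps {t : ℕ} {c c' : Config} (h : Steps t c c') (N : ℕ) :
    meanTime f O N c ≤ t + meanTime f O N c' := by
  induction h generalizing N with
  | refl => simp
  | @step t c c' hd _ ih =>
    cases N with
    | zero => exact zero_le
    | succ N =>
      rw [meanTime, stepMean_det f O hd, hd.stepTime, Nat.cast_add, add_comm (t : ℝ≥0∞), add_assoc]
      exact add_le_add_right ((ih N).trans (add_le_add_right (meanTime_mono f O N c') _)) _

theorem meanTime_of_halted {c : Config} (h : c.code = []) (N : ℕ) : meanTime f O N c = 0 := by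
  induction N with
  | zero => rfl
  | succ N ih =>
    obtain ⟨code, mem, circ, outcome, result⟩ := c
    subst h
    change ((0 : ℕ) : ℝ≥0∞) + expectation (PMF.pure _) _ = 0
    rw [mean_pure, ih]
    simp

/-- Connects the definition of the cost, which follows the distribution forward in time, with the
backward recursion used for estimates. With finite horizons no finiteness of the expectation has to
be known beforehand. -/
theorem sum_mean_run (p : Prog) (N m : ℕ) :
    ∑ n ∈ Finset.range N, expectation (p.run f O (m + n)) (fun c => (c.stepTime : ℝ≥0∞)) =
      expectation (p.run f O m) (meanTime f O N) := by
  induction N generalizing m with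
  | zero => simp [meanTime, expectation]
  | succ N ih =>
    have h := ih (m + 1)
    rw [mean_run_succ] at h
    change _ = expectation _ fun c => (c.stepTime : ℝ≥0∞) + stepMean f O (meanTime f O N) c
    rw [mean_add, ← h, Finset.sum_range_succ', add_comm]
    congr 1
    refine Finset.sum_congr rfl fun n _ => ?_
    rw [show m + (n + 1) = m + 1 + n by ring]

theorem expectedCost_time_le (p : Prog) {V : ℝ≥0∞}
    (h : ∀ N, meanTime f O N (Config.start p) ≤ V) : p.expectedCost f O Config.stepTime ≤ V := by
  change ∑' n, expectation (p.run f O n) (fun c => (c.stepTime : ℝ≥0∞)) ≤ V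
  rw [ENNReal.tsum_eq_iSup_nat]
  refine iSup_le fun N => ?_
  have := sum_mean_run f O p N 0
  simp only [zero_add] at this
  rw [this]
  exact (mean_pure _ _).trans_le (h N)

theorem stepQueries_le (c : Config) : c.stepQueries ≤ c.stepTime := by
  obtain ⟨code, mem, circ, outcome, result⟩ := c
  match code with
  | [] => exact le_rfl
  | .instr i :: k =>
    cases i with
    | eval => exact List.countP_le_length.trans (Nat.le_add_left _ _)
    | ret a => exact le_rfl
    | _ => exact Nat.zero_le _
  | .seq p q :: k => exact Nat.zero_le _
  | .cond r p q :: k => exact Nat.zero_le _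
  | .loop r p :: k => exact Nat.zero_le _

theorem expectedCost_queries_le (p : Prog) :
    p.expectedCost f O Config.stepQueries ≤ p.expectedCost f O Config.stepTime :=
  ENNReal.tsum_le_tsum fun n => mean_mono (p.run f O n) fun c => by
    exact_mod_cast stepQueries_le c

/-- The probability of having halted with the result `i` after `n` steps. -/
def resultProb (i : ℕ) : ℕ → Config → ℝ≥0∞
  | 0, c => {c : Config | c.code = [] ∧ c.result = some i}.indicator (fun _ => 1) c
  | n + 1, c => stepMean f O (resultProb i n) c

theorem resultProb_of_halted {i : ℕ} {c : Config} (h : c.code = []) (h' : c.result = some i)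
    (n : ℕ) : resultProb f O i n c = 1 := by
  induction n with
  | zero => simp [resultProb, h, h']
  | succ n ih =>
    obtain ⟨code, mem, circ, outcome, result⟩ := c
    subst h
    change expectation (PMF.pure _) _ = 1
    rw [mean_pure, ih]

theorem resultProb_succ (i n : ℕ) (c : Config) :
    resultProb f O i n c ≤ resultProb f O i (n + 1) c := by
  induction n generalizing c with
  | zero =>
    by_cases h : c.code = [] ∧ c.result = some i
    · rw [resultProb_of_halted f O h.1 h.2, resultProb_of_halted f O h.1 h.2]
    · simp [resultProb, h]
  | succ n ih => exact mean_mono _ ih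

theorem resultProb_mono {i n n' : ℕ} (h : n ≤ n') (c : Config) :
    resultProb f O i n c ≤ resultProb f O i n' c :=
  monotone_nat_of_le_succ (f := fun n => resultProb f O i n c)
    (fun n => resultProb_succ f O i n c) h

theorem resultProb_of_steps {t : ℕ} {c c' : Config} (h : Steps t c c') (i n : ℕ) :
    resultProb f O i (t + n) c = resultProb f O i n c' := by
  induction h with
  | refl => rw [zero_add]
  | step hd _ ih =>
    rw [Nat.add_right_comm, resultProb, stepMean_det f O hd, ih]

/-- The same passage from forward distributions to a backward recursion, here for the probability of
success. -/
theorem mean_resultProb (p : Prog) (i n m : ℕ) :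
    expectation (p.run f O m) (resultProb f O i n) =
      (p.run f O (m + n)).toOuterMeasure {c | c.code = [] ∧ c.result = some i} := by
  induction n generalizing m with
  | zero =>
    rw [← mul_one (PMF.toOuterMeasure _ _), ← mean_indicator]
    rfl
  | succ n ih =>
    rw [show m + (n + 1) = m + 1 + n by ring, ← ih (m + 1), mean_run_succ]
    rfl

/-! ### A round -/

variable {f O} {i j : ℕ} {c : Config}

/-- Acceptance halts the machine, so the remaining cost `V` is paid only with the probability of
rejection. -/
theorem AtRound.meanTime_le (h : AtRound j c) {N : ℕ} {V : ℝ≥0∞}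
    (hV : ∀ c, AtRound (j + 1) c → meanTime f O N c ≤ V) :
    meanTime f O (N + 1) c ≤ (3 * 10 ^ 7 * 3 ^ (j / 16) : ℕ) +
      ((stageC (j / 16)).eval f O).toOuterMeasure
        {o | Accept (stageBits (j / 16)) (j / 16) o}ᶜ * V := by
  obtain ⟨t₁, c₁, k, hs, hk, hC, ho⟩ := h.exists_eval
  have htime : c₁.stepTime = 1 + c₁.circ.length := by
    obtain ⟨code, mem, circ, outcome, result⟩ := c₁
    subst hk
    rfl
  refine (meanTime_of_steps f O hs (N + 1)).trans ?_
  rw [meanTime, stepMean_eval f O hk, htime, hC, ← mean_indicator]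
  refine le_trans (le_of_eq ?_) ((mean_mono ((stageC (j / 16)).eval f O) (g := fun o =>
    ((t₁ + (1 + (stageC (j / 16)).length) : ℕ) : ℝ≥0∞) +
      meanTime f O N { c₁ with code := k, circ := [], outcome := o })
    (g' := fun o => ((3 * 10 ^ 7 * 3 ^ (j / 16) : ℕ) : ℝ≥0∞) +
      {o | Accept (stageBits (j / 16)) (j / 16) o}ᶜ.indicator (fun _ => V) o)
    fun o => ?_).trans (le_of_eq ?_))
  · rw [mean_add, mean_const]
    push_cast
    ring
  · obtain ⟨t₂, c₂, hs₂, ht, hacc, hrej⟩ := ho o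
    have h1 := meanTime_of_steps f O hs₂ N
    have h2 : meanTime f O N c₂ ≤
        {o | Accept (stageBits (j / 16)) (j / 16) o}ᶜ.indicator (fun _ => V) o := by
      by_cases ha : Accept (stageBits (j / 16)) (j / 16) o
      · rw [meanTime_of_halted f O (hacc ha).1]
        exact zero_le
      · rw [Set.indicator_of_mem (by exact ha)]
        exact hV _ (hrej ha)
    refine (add_le_add_right (h1.trans (add_le_add_right h2 _)) _).trans ?_
    rw [← add_assoc, ← Nat.cast_add]
    refine add_le_add_left ?_ _
    exact_mod_cast (by omega)
  · rw [mean_add, mean_const]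

/-- The function `g` is a guaranteed success probability given the outcome: at most `1` for a
correct acceptance, `0` for a wrong one, and a value promised by the next round otherwise. -/
theorem AtRound.le_resultProb (h : AtRound j c) {n : ℕ} {g : (ℕ → Bool) → ℝ≥0∞}
    (hacc : ∀ o, Accept (stageBits (j / 16)) (j / 16) o →
      readNat o 0 (stageBits (j / 16)) = i → g o ≤ 1)
    (hwrong : ∀ o, Accept (stageBits (j / 16)) (j / 16) o →
      readNat o 0 (stageBits (j / 16)) ≠ i → g o = 0)
    (hrej : ∀ o, ¬Accept (stageBits (j / 16)) (j / 16) o → ∀ c, AtRound (j + 1) c →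
      g o ≤ resultProb f O i n c) :
    expectation ((stageC (j / 16)).eval f O) g ≤
      resultProb f O i (3 * 10 ^ 7 * 3 ^ (j / 16) + n) c := by
  obtain ⟨t₁, c₁, k, hs, hk, hC, ho⟩ := h.exists_eval
  -- An arbitrary outcome, used only to learn that `t₁ + 1` fits into the time budget of the round.
  obtain ⟨t₂, c₂, -, ht, -⟩ := ho fun _ => false
  obtain ⟨T, hT⟩ : ∃ T, 3 * 10 ^ 7 * 3 ^ (j / 16) + n = t₁ + (T + 1) :=
    ⟨3 * 10 ^ 7 * 3 ^ (j / 16) + n - t₁ - 1, by omega⟩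
  rw [hT, resultProb_of_steps f O hs, resultProb, stepMean_eval f O hk, hC]
  refine mean_mono _ fun o => ?_
  obtain ⟨t₂, c₂, hs₂, ht, ha, hr⟩ := ho o
  have h1 : resultProb f O i n c₂ ≤
      resultProb f O i T { c₁ with code := k, circ := [], outcome := o } := by
    rw [← resultProb_of_steps f O hs₂]
    exact resultProb_mono f O (by omega) _
  refine le_trans ?_ h1
  by_cases hA : Accept (stageBits (j / 16)) (j / 16) o
  · by_cases hi : readNat o 0 (stageBits (j / 16)) = i
    · rw [resultProb_of_halted f O (ha hA).1 ((ha hA).2.trans (by rw [hi]))]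
      exact hacc o hA hi
    · rw [hwrong o hA hi]
      exact zero_le
  · exact hrej o hA _ (hr hA)

end run

/-! ### Analysis of the algorithm -/

section analysis

variable {A : Type*} [Inhabited A] {f : ℕ → ℕ} {O : Oracle A} {i K₀ : ℕ}

/-- Since `(15 / 14) ^ 16 ≥ 3`, a smooth geometric growth per round dominates the tripling after
every 16 rounds. -/
theorem three_pow_div_le (j r : ℕ) : (3 : ℝ) ^ ((16 * j + r) / 16) ≤ 3 ^ j * (15 / 14) ^ r := by
  have e : (16 * j + r) / 16 = j + r / 16 := by omega
  rw [e, pow_add]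
  refine mul_le_mul_of_nonneg_left ?_ (by positivity)
  calc (3 : ℝ) ^ (r / 16) ≤ ((15 / 14) ^ 16) ^ (r / 16) :=
        pow_le_pow_left₀ (by norm_num) (by norm_num) _
    _ = (15 / 14) ^ (16 * (r / 16)) := by rw [pow_mul]
    _ ≤ (15 / 14) ^ r := pow_le_pow_right₀ (by norm_num) (Nat.mul_div_le _ _)

/-- Rejection excludes the successful outcomes, which have probability at least `1/9` as soon as the
search space contains `i`. -/
theorem prob_reject_le (hgood : answerProb O (f i) false ≤ 1 / 10)
    (hbad : ∀ j, j ≠ i → answerProb O (f j) true ≤ 1 / 10) {K : ℕ} (hi : i < 9 ^ K) :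
    ((stageC K).eval f O).toOuterMeasure {o | Accept (stageBits K) K o}ᶜ ≤
      ENNReal.ofReal (8 / 9) := by
  have hb := stageBits_bounds K
  have h := eval_success hb.1 hb.2 (hi.trans_le hb.1) hgood hbad
  rw [show (8 / 9 : ℝ) = 1 - 1 / 9 by norm_num]
  refine toOuterMeasure_compl_le _ (by norm_num) (by norm_num) (h.trans ?_)
  exact MeasureTheory.OuterMeasure.mono _ fun o ho => ho.1

/-- The factor `21` solves `v = 1 + (8/9)(15/14) v`, that is, it sums the geometric series with
ratio `20/21`. The bound is inductive in the horizon `N`, for all rounds at once. -/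
theorem meanTime_late (hgood : answerProb O (f i) false ≤ 1 / 10)
    (hbad : ∀ j, j ≠ i → answerProb O (f j) true ≤ 1 / 10) (hi : i < 9 ^ K₀) (N r : ℕ) (c : Config)
    (h : AtRound (16 * K₀ + r) c) : meanTime f O N c ≤
      ENNReal.ofReal (21 * (3 * 10 ^ 7 * (3 ^ K₀ * (15 / 14) ^ r))) := by
  induction N generalizing r c with
  | zero => exact zero_le
  | succ N ih =>
    refine (h.meanTime_le (ih (r + 1))).trans ?_
    have hK : i < 9 ^ ((16 * K₀ + r) / 16) :=
      hi.trans_le (Nat.pow_le_pow_right (by norm_num) (by omega))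
    have h1 : (((3 * 10 ^ 7 * 3 ^ ((16 * K₀ + r) / 16) : ℕ)) : ℝ≥0∞) ≤
        ENNReal.ofReal (3 * 10 ^ 7 * (3 ^ K₀ * (15 / 14) ^ r)) := by
      rw [← ENNReal.ofReal_natCast]
      refine ENNReal.ofReal_le_ofReal ?_
      push_cast
      have := three_pow_div_le K₀ r
      linarith
    refine (add_le_add h1 (mul_le_mul_left (prob_reject_le hgood hbad hK) _)).trans ?_
    rw [← ENNReal.ofReal_mul (p := 8 / 9) (by norm_num),
      ← ENNReal.ofReal_add (by positivity) (by positivity)]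
    refine ENNReal.ofReal_le_ofReal (le_of_eq ?_)
    rw [pow_succ (15 / 14 : ℝ)]
    ring

/-- Before the search space contains `i` no rejection probability below `1` is available, so all
those rounds are counted in full. Their costs grow geometrically by stages and stay of order `3 ^
K₀`. -/
theorem meanTime_early (hgood : answerProb O (f i) false ≤ 1 / 10)
    (hbad : ∀ j, j ≠ i → answerProb O (f j) true ≤ 1 / 10) (hi : i < 9 ^ K₀) (N d : ℕ) {j : ℕ}
    (hj : j + d = 16 * K₀) (c : Config) (h : AtRound j c) : meanTime f O N c ≤
      (3 * 10 ^ 7 * (∑ l ∈ Finset.Ico j (16 * K₀), 3 ^ (l / 16) + 21 * 3 ^ K₀) : ℕ) := by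
  induction d generalizing j c N with
  | zero =>
    rw [add_zero] at hj
    subst hj
    refine (meanTime_late hgood hbad hi N 0 c h).trans ?_
    rw [← ENNReal.ofReal_natCast]
    refine ENNReal.ofReal_le_ofReal (le_of_eq ?_)
    simp
    ring
  | succ d ih =>
    cases N with
    | zero => exact zero_le
    | succ N =>
      refine (h.meanTime_le (ih N (by omega))).trans ?_
      rw [Finset.sum_eq_sum_Ico_succ_bot (by omega : j < 16 * K₀)]
      have hp : ((stageC (j / 16)).eval f O).toOuterMeasure
          {o | Accept (stageBits (j / 16)) (j / 16) o}ᶜ ≤ 1 :=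
        (PMF.toOuterMeasure_mono _ (Set.subset_univ _)).trans_eq
          ((PMF.toOuterMeasure_apply_eq_one_iff _ _).mpr (Set.subset_univ _))
      refine (add_le_add_right (mul_le_mul_left hp _) _).trans (le_of_eq ?_)
      push_cast
      ring

theorem sum_stage {M : Type*} [AddCommMonoid M] (g : ℕ → M) (K : ℕ) :
    ∑ l ∈ Finset.range (16 * K), g (l / 16) = ∑ k ∈ Finset.range K, 16 • g k := by
  induction K with
  | zero => simp
  | succ K ih =>
    rw [mul_add, mul_one, Finset.sum_range_add, ih, Finset.sum_range_succ fun k => 16 • g k]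
    congr 1
    have h : ∀ x ∈ Finset.range 16, g ((16 * K + x) / 16) = g K := fun x hx => by
      rw [show (16 * K + x) / 16 = K by have := Finset.mem_range.mp hx; omega]
    rw [Finset.sum_congr rfl h]
    simp

theorem time_le (hgood : answerProb O (f i) false ≤ 1 / 10)
    (hbad : ∀ j, j ≠ i → answerProb O (f j) true ≤ 1 / 10) (hi : i < 9 ^ K₀) :
    guessP.expectedCost f O Config.stepTime ≤ (9 * 10 ^ 8 * 3 ^ K₀ : ℕ) := by
  obtain ⟨c, hs, hc⟩ := exists_steps_start
  refine expectedCost_time_le f O _ fun N => (meanTime_of_steps f O hs N).trans ?_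
  refine (add_le_add_right (meanTime_early hgood hbad hi N (16 * K₀) (zero_add _) c hc) _).trans ?_
  rw [← Nat.cast_add, Nat.cast_le, ← Finset.range_eq_Ico, sum_stage fun k => 3 ^ k]
  have h : ∑ k ∈ Finset.range K₀, 16 • 3 ^ k ≤ 8 * 3 ^ K₀ := by
    clear hi
    induction K₀ with
    | zero => simp
    | succ K ih =>
      rw [Finset.sum_range_succ, pow_succ, smul_eq_mul]
      omega
  have : 1 ≤ 3 ^ K₀ := Nat.one_le_pow _ _ (by norm_num)
  omega

/-- Backward induction over the rounds before stage `K₀`: each may spoil the success guaranteed for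
the first round of that stage, but only by accepting a wrong index. The number `n` of steps is
uniform in the configuration, so that the induction can continue through a random outcome. -/
theorem exists_resultProb (hgood : answerProb O (f i) false ≤ 1 / 10)
    (hbad : ∀ j, j ≠ i → answerProb O (f j) true ≤ 1 / 10) (hi : i < 9 ^ K₀) (d : ℕ) {j : ℕ}
    (hj : j + d = 16 * K₀) : ∃ n, ∀ c, AtRound j c → ENNReal.ofReal (1 / 9) ≤
      resultProb f O i n c +
        ∑ l ∈ Finset.Ico j (16 * K₀), ENNReal.ofReal ((2 / 5) ^ (10 + l / 16)) := by
  induction d generalizing j with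
  | zero =>
    rw [add_zero] at hj
    refine ⟨3 * 10 ^ 7 * 3 ^ (j / 16) + 0, fun c hc => ?_⟩
    have hK : i < 9 ^ (j / 16) := by rwa [hj, Nat.mul_div_cancel_left _ (by norm_num)]
    have hb := stageBits_bounds (j / 16)
    have h := eval_success hb.1 hb.2 (hK.trans_le hb.1) hgood hbad
    refine le_add_right (h.trans ?_)
    rw [← mul_one (PMF.toOuterMeasure _ _), ← mean_indicator]
    refine hc.le_resultProb (fun o _ _ => ?_) (fun o _ h => ?_) fun o h c _ => ?_
    · exact Set.indicator_le_self' (fun _ _ => zero_le) o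
    · exact Set.indicator_of_notMem (fun h' => h h'.2) _
    · rw [Set.indicator_of_notMem fun h' => h h'.1]
      exact zero_le
  | succ d ih =>
    obtain ⟨n, hn⟩ := ih (show j + 1 + d = 16 * K₀ by omega)
    refine ⟨3 * 10 ^ 7 * 3 ^ (j / 16) + n, fun c hc => ?_⟩
    set S := ∑ l ∈ Finset.Ico (j + 1) (16 * K₀), ENNReal.ofReal ((2 / 5) ^ (10 + l / 16)) with hS
    set W : Set (ℕ → Bool) := {o | Accept (stageBits (j / 16)) (j / 16) o ∧
      readNat o 0 (stageBits (j / 16)) ≠ i} with hW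
    -- The guarantee is zero on a wrong acceptance and `1/9 - S` on every other outcome, which is
    -- also below the probability `1` obtained on an early correct acceptance.
    have h1 := hc.le_resultProb (f := f) (O := O) (i := i) (n := n)
      (g := Wᶜ.indicator fun _ => ENNReal.ofReal (1 / 9) - S)
      (fun o _ _ => ?_) (fun o h h' => ?_) fun o h c hc => ?_
    · have h2 := eval_false_accept (O := O) (f := f) (n := stageBits (j / 16)) (K := j / 16) hbad
      rw [Finset.sum_eq_sum_Ico_succ_bot (by omega : j < 16 * K₀)]
      calc ENNReal.ofReal (1 / 9) ≤ (ENNReal.ofReal (1 / 9) - S) + S := le_tsub_add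
        _ = expectation ((stageC (j / 16)).eval f O) (fun _ => ENNReal.ofReal (1 / 9) - S) + S := by
          rw [mean_const]
        _ ≤ expectation ((stageC (j / 16)).eval f O) (fun o =>
            Wᶜ.indicator (fun _ => ENNReal.ofReal (1 / 9) - S) o + W.indicator (fun _ => 1) o) +
            S := by
          refine add_le_add_left (mean_mono _ fun o => ?_) _
          by_cases ho : o ∈ W
          · simp only [ho, Set.indicator_of_mem, Set.mem_compl_iff, not_true, not_false_eq_true,
              Set.indicator_of_notMem, zero_add]
            refine tsub_le_self.trans ?_
            rw [← ENNReal.ofReal_one]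
            exact ENNReal.ofReal_le_ofReal (by norm_num)
          · simp [ho]
        _ ≤ _ := by
          rw [mean_add, mean_indicator _ W, mul_one, add_assoc]
          exact add_le_add h1 (add_le_add_left h2 _)
    · refine (Set.indicator_le_self' (fun _ _ => zero_le) o).trans (tsub_le_self.trans ?_)
      rw [← ENNReal.ofReal_one]
      exact ENNReal.ofReal_le_ofReal (by norm_num)
    · have hw : o ∈ W := ⟨h, h'⟩
      simp [hw]
    · exact (Set.indicator_le_self' (fun _ _ => zero_le) o).trans
        (tsub_le_iff_right.mpr (hn c hc))

theorem le_iSup_run (hgood : answerProb O (f i) false ≤ 1 / 10)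
    (hbad : ∀ j, j ≠ i → answerProb O (f j) true ≤ 1 / 10) : ENNReal.ofReal (1 / 10) ≤
      ⨆ n, (guessP.run f O n).toOuterMeasure {c | c.code = [] ∧ c.result = some i} := by
  -- Only the existence of some late stage matters for the success probability, so the wasteful
  -- choice `K₀ = i` serves: the sum of the error probabilities converges anyway.
  have hi : i < 9 ^ i := Nat.lt_pow_self (by norm_num)
  obtain ⟨n, hn⟩ := exists_resultProb hgood hbad hi (16 * i) (zero_add _)
  obtain ⟨c, hs, hc⟩ := exists_steps_start
  have h := hn c hc
  rw [← resultProb_of_steps f O hs, ← Finset.range_eq_Ico,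
    sum_stage fun k => ENNReal.ofReal ((2 / 5) ^ (10 + k))] at h
  have h2 := mean_resultProb f O guessP i (10 + n) 0
  rw [zero_add] at h2
  refine le_trans ?_ (le_iSup _ (10 + n))
  rw [← h2]
  change _ ≤ expectation (PMF.pure (Config.start guessP)) _
  rw [mean_pure]
  -- Each stage has 16 rounds. The sum is below `16 (2/5)^10 (5/3) ≤ 1/90`, the gap between `1/9`
  -- and `1/10`.
  have hsum : ∑ k ∈ Finset.range i, 16 • ENNReal.ofReal ((2 / 5) ^ (10 + k)) ≤
      ENNReal.ofReal (1 / 90) := by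
    have : ∀ k, 16 • ENNReal.ofReal ((2 / 5) ^ (10 + k)) =
        ENNReal.ofReal (16 * (2 / 5) ^ (10 + k)) := fun k => by
      rw [ENNReal.ofReal_mul (by norm_num), nsmul_eq_mul]
      norm_num
    simp only [this]
    rw [← ENNReal.ofReal_sum_of_nonneg fun _ _ => by positivity]
    refine ENNReal.ofReal_le_ofReal ?_
    have h : ∀ i : ℕ, ∑ k ∈ Finset.range i, 16 * (2 / 5 : ℝ) ^ (10 + k) =
        16 * (2 / 5) ^ 10 * (5 / 3) * (1 - (2 / 5) ^ i) := by
      intro i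
      induction i with
      | zero => simp
      | succ i ih =>
        rw [Finset.sum_range_succ, ih, pow_add, pow_succ]
        ring
    rw [h]
    have : (0 : ℝ) ≤ (2 / 5) ^ i := by positivity
    nlinarith
  have h3 := h.trans (add_le_add_right hsum _)
  rw [show (1 / 9 : ℝ) = 1 / 10 + 1 / 90 by norm_num,
    ENNReal.ofReal_add (by norm_num) (by norm_num)] at h3
  exact (ENNReal.add_le_add_iff_right ENNReal.ofReal_ne_top).mp h3

/-- For the least `K` with `i < 9 ^ K`, the predecessor fails: `9 ^ (K - 1) ≤ i`, so `3 ^ K ≤ 3 √i`.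
The case `K = 0` uses `√(i + 1) ≥ 1`. -/
theorem exists_three_pow_le (i : ℕ) : ∃ K : ℕ, i < 9 ^ K ∧ (3 : ℝ) ^ K ≤ 3 * √(i + 1) := by
  classical
  have hex : ∃ K, i < 9 ^ K := ⟨i, Nat.lt_pow_self (by norm_num)⟩
  refine ⟨Nat.find hex, Nat.find_spec hex, ?_⟩
  have h1 : (1 : ℝ) ≤ √(i + 1) := by
    rw [Real.one_le_sqrt]
    have : (0 : ℝ) ≤ i := Nat.cast_nonneg i
    linarith
  cases h : Nat.find hex with
  | zero =>
    rw [pow_zero]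
    linarith
  | succ K =>
    have h2 : ¬i < 9 ^ K := Nat.find_min hex (by omega)
    have h3 : (9 : ℝ) ^ K ≤ i := by exact_mod_cast not_lt.mp h2
    rw [pow_succ, mul_comm]
    refine mul_le_mul_of_nonneg_left ?_ (by norm_num)
    refine Real.le_sqrt_of_sq_le ?_
    rw [← pow_mul, mul_comm, pow_mul]
    norm_num
    linarith

theorem time_le_sqrt (hgood : answerProb O (f i) false ≤ 1 / 10)
    (hbad : ∀ j, j ≠ i → answerProb O (f j) true ≤ 1 / 10) :
    guessP.expectedCost f O Config.stepTime ≤ 27 * 10 ^ 8 * ENNReal.ofReal √(i + 1) := by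
  obtain ⟨K, hi, hK⟩ := exists_three_pow_le i
  refine (time_le hgood hbad hi).trans ?_
  have e : (27 * 10 ^ 8 : ℝ≥0∞) = ENNReal.ofReal (27 * 10 ^ 8) := by
    rw [ENNReal.ofReal_mul (by norm_num), ENNReal.ofReal_pow (by norm_num)]
    norm_num
  rw [e, ← ENNReal.ofReal_mul (by norm_num), ← ENNReal.ofReal_natCast]
  refine ENNReal.ofReal_le_ofReal ?_
  push_cast
  linarith

end analysis

/-! ### From indices to elements, and the average over `X` -/

section Guessing

variable {E A : Type*} [Inhabited A] {code : E → ℕ} {σ : ℕ → E} {O : Oracle A} {i : ℕ}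

theorem Recognizes.answerProb_false_le (h : Recognizes code O (σ i)) :
    answerProb O ((code ∘ σ) i) false ≤ 1 / 10 := by
  have h1 := answerProb_add O (code (σ i)) true
  have h2 := h.1
  simp only [Bool.not_true] at h1
  simp only [Function.comp_apply]
  linarith

theorem Recognizes.answerProb_true_le (hσ : Function.Injective σ) (h : Recognizes code O (σ i))
    (j : ℕ) (hj : j ≠ i) : answerProb O ((code ∘ σ) j) true ≤ 1 / 10 := by
  have h1 := answerProb_add O (code (σ j)) true
  have h2 := h.2 (σ j) (fun h' => hj (hσ h'))
  simp only [Bool.not_true] at h1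
  simp only [Function.comp_apply]
  linarith

theorem le_returnProb (hσ : Function.Injective σ) (h : Recognizes code O (σ i)) :
    ENNReal.ofReal (1 / 10) ≤ guessP.returnProb code σ O (σ i) := by
  refine (le_iSup_run h.answerProb_false_le (h.answerProb_true_le hσ)).trans ?_
  exact iSup_mono fun n => MeasureTheory.OuterMeasure.mono _ fun c hc => ⟨i, hc.2, rfl⟩

/-- Surjectivity of `σ` makes `E` countable, so the integral is a sum over `E`, which `σ` turns into
a sum over guess numbers; the bound then holds term by term. -/
theorem lintegral_le_guessingComplexity [MeasurableSpace E] [DiscreteMeasurableSpace E]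
    {Ω : Type*} [MeasurableSpace Ω] (P : MeasureTheory.Measure Ω) {X : Ω → E} (hX : Measurable X)
    (hσ : Function.Bijective σ) {g : E → ℝ≥0∞} {K : ℝ≥0∞}
    (hg : ∀ i, g (σ i) ≤ K * ENNReal.ofReal √(i + 1)) :
    ∫⁻ ω, g (X ω) ∂P ≤ K * guessingComplexity P X σ := by
  have : Countable E := hσ.surjective.countable
  rw [← MeasureTheory.lintegral_map (measurable_of_countable g) hX,
    MeasureTheory.lintegral_countable', ← (Equiv.ofBijective σ hσ).tsum_eq, guessingComplexity,
    ← ENNReal.tsum_mul_left]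
  refine ENNReal.tsum_le_tsum fun i => ?_
  rw [MeasureTheory.Measure.map_apply hX (measurableSet_singleton _), ← mul_assoc]
  exact mul_le_mul_left (hg i) _

end Guessing

end QGuess

end

theorem mainTheorem4 :
    ∃ (𝒜 : QGuess.Prog) (c K : NNReal), 0 < c ∧
      ∀ {E : Type*} [MeasurableSpace E] [DiscreteMeasurableSpace E]
        {Ω : Type*} [MeasurableSpace Ω] (P : MeasureTheory.Measure Ω)
        [MeasureTheory.IsProbabilityMeasure P] (X : Ω → E) (_hX : Measurable X)
        (code : E → ℕ) (_hcode : Function.Injective code)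
        (σ : ℕ → E) (_hσ : Function.Bijective σ)
        (_hord : ∀ i j : ℕ, i ≤ j → P {ω | X ω = σ j} ≤ P {ω | X ω = σ i})
        {A : Type*} [Inhabited A] (O : E → QGuess.Oracle A)
        (_hO : ∀ x, QGuess.Recognizes code (O x) x),
        (∀ x, (c : ENNReal) ≤ 𝒜.returnProb code σ (O x) x) ∧
        ∫⁻ ω, 𝒜.time code σ (O (X ω)) ∂P ≤ K * QGuess.guessingComplexity P X σ ∧
        ∫⁻ ω, 𝒜.queries code σ (O (X ω)) ∂P ≤ K * QGuess.guessingComplexity P X σ := by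
  -- The factor is `9 * 10 ^ 8` from `time_le` times `3` from `3 ^ K ≤ 3 √(i + 1)`.
  refine ⟨QGuess.guessP, 1 / 10, 27 * 10 ^ 8, by norm_num, ?_⟩
  intro E _ _ Ω _ P _ X hX code _ σ hσ _ A _ O hO
  have hT : ∀ i, QGuess.guessP.time code σ (O (σ i)) ≤
      27 * 10 ^ 8 * ENNReal.ofReal √(i + 1) := fun i =>
    QGuess.time_le_sqrt (hO (σ i)).answerProb_false_le ((hO (σ i)).answerProb_true_le hσ.injective)
  refine ⟨fun x => ?_, ?_, ?_⟩
  · obtain ⟨i, rfl⟩ := hσ.surjective x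
    refine le_trans (le_of_eq ?_) (QGuess.le_returnProb hσ.injective (hO (σ i)))
    rw [ENNReal.ofReal_div_of_pos (by norm_num)]
    simp
  · push_cast
    exact QGuess.lintegral_le_guessingComplexity P hX hσ
      (g := fun x => QGuess.guessP.time code σ (O x)) hT
  · push_cast
    exact QGuess.lintegral_le_guessingComplexity P hX hσ
      (g := fun x => QGuess.guessP.queries code σ (O x)) fun i =>
        (QGuess.expectedCost_queries_le _ _ _).trans (hT i)
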